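/- **Setting.** There are $T$ periods, $d$ resources with initial capacities $B_1,\dots,B_d$, and $K$ arms. In each period a policy chooses an arm $k$, possibly at random, given the past choices and observations, or it ends the process. Outcomes of different periods are independent. The process stops as soon as the cumulative use of some resource exceeds its capacity; revenue is collected only in periods before this happens. *BNRM-LS.* Arm $k$ is a price vector $(p_{j,k})_{j\le n}$ for $n$ products. Under it the demands $Q_{j,k}\in[0,1]$ are independent over the products $j$ and have unknown distributions. The demand vector is observed, the revenue is $\sum_j p_{j,k}Q_{j,k}$, and the amount $\sum_j a_{ij}Q_{j,k}$ of resource $i$ is used. Here $0\le p_{j,k}\le\bar p$ and $0\le a_{ij}\le\bar a$. *BwK-LS.* Arm $k$ yields a reward in $[0,R_{\max}]$ and a cost vector in $[0,C_{\max}]^d$, with an arbitrary unknown joint distribution; both are observed. Here $0\le R_{\max}\le\bar r$ and $0\le C_{\max}\le\bar c$. In both setups a policy makes a switch whenever two consecutive chosen arms differ, and $s$ is the switching budget. For a learning policy $\phi$, the overall regret $R^\phi(T)$ (respectively the $s$-switch regret $R^\phi_s(T)$) is the supremum, over all admissible distributions, of the best expected revenue of a policy chosen knowing the distributions (respectively of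 such a policy that makes at most $s$ switches almost surely), minus the expected revenue of $\phi$. **The algorithm LS-2SLP.** Let $\nu=\lfloor (s-d-1)/(K-1)\rfloor$ (read as $0$ if the quotient is negative), $t_0=0$, and for $1\le l\le\nu+1$ let $$t_l=\Big\lfloor K^{1-\frac{2-2^{-(l-1)}}{2-2^{-\nu}}}\,T^{\frac{2-2^{-(l-1)}}{2-2^{-\nu}}}\Big\rfloor .$$ With $B_{\min}=\min_iB_i$ and $a_{\max}=\max_{i,j}a_{ij}$, let $\gamma=1-3\,\frac{a_{\max}\sqrt{dn\log(dKT)}\,\log T}{B_{\min}}\,t_1$ in BNRM-LS and $\gamma=1-3\,\frac{C_{\max}\sqrt{d\log(dKT)}\,\log T}{B_{\min}}\,t_1$ in BwK-LS. Let $T_0=0$ and let $T_l$ be the last period of epoch $l$. For each arm $k$ let $n_k$ be the number of its pulls so far; let $\bar r_k,\bar c_{i,k}$ be its empirical mean reward and costs ($0$ if it was never pulled; in BNRM-LS they are $\sum_jp_{j,k}\bar q_{j,k}$ and $\sum_ja_{ij}\bar q_{j,k}$, where $\bar q_{j,k}$ is the empirical mean demand); and let $\rho_k=\sqrt{\log((d+1)KT)/n_k}$.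 1. Start with the bounds $L^{\rm rew}_k=L^{\rm cost}_{i,k}=0$ and $U^{\rm rew}_k=U^{\rm cost}_{i,k}=\infty$. At the start of each epoch $l=2,\dots,\nu$, for every $k$ with $n_k>0$, replace $U^{\rm rew}_k$ by $\min\{\bar r_k+w_k\rho_k,\,U^{\rm rew}_k\}$, $L^{\rm rew}_k$ by $\max\{\bar r_k-w_k\rho_k,\,L^{\rm rew}_k\}$, $U^{\rm cost}_{i,k}$ by $\min\{\bar c_{i,k}+v_i\rho_k,\,U^{\rm cost}_{i,k}\}$ and $L^{\rm cost}_{i,k}$ by $\max\{\bar c_{i,k}-v_i\rho_k,\,L^{\rm cost}_{i,k}\}$. Here $w_k=\|(p_{j,k})_j\|_2$ and $v_i=\|(a_{ij})_j\|_2$ in BNRM-LS, and $w_k=R_{\max}$ and $v_i=C_{\max}$ in BwK-LS. 2. In epoch $l\le\nu$ let $J_l$ be the maximum of $\sum_kL^{\rm rew}_kx_k$ over $x\ge0$ with $\sum_kx_k\le T$ and $\sum_kU^{\rm cost}_{i,k}x_k\le B_i$ for all $i$. For each arm $j$ let $x^{l,j}$ maximize $x_j$ over $x\ge0$ with $\sum_kx_k\le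 T$, $\sum_kU^{\rm rew}_kx_k\ge J_l$ and $\sum_kL^{\rm cost}_{i,k}x_k\le B_i$ for all $i$ (arbitrary if there is no maximizer). Put $N_k=\frac{t_l-t_{l-1}}{T}\cdot\frac1K\sum_jx^{l,j}_k$. 3. In the last epoch $\nu+1$ let $x^*$ be a maximizer of $\sum_k\bar r_kx_k$ over $x\ge0$ with $\sum_kx_k\le T$ and $\sum_k\bar c_{i,k}x_k\le B_i$ for all $i$, with the least number of non-zero components. Put $N_k=\frac{T-t_\nu}{T}x^*_k$. 4. In each epoch play each arm $k$ for $\max(0,\lfloor\gamma N_k\rfloor)$ consecutive periods, in any order of the arms that starts with the last arm of the preceding epochs (with an arbitrary, possibly random, initial arm if none was played yet). The algorithm ends after epoch $\nu+1$, or earlier when the process stops or the horizon is reached. **Theorem.** In each of the two setups, for every $\beta>0$ there is a constant $c>0$, depending only on $\beta,n,\bar p,\bar a$ in BNRM-LS and only on $\beta,\bar r,\bar c$ in BwK-LS, such that the following holds for all $T\ge2$, $d\ge1$, $K>d+1$, all $s\ge0$ and all problems with $B_i\ge\beta T$ for every $i$. Every LS-2SLP policy $\phi$ (with any measurable way of breaking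 ties) makes at most $s$ switches almost surely under all admissible distributions, and $$R^\phi_s(T)\;\le\;R^\phi(T)\;\le\;\Big(c\,\sqrt{d\log(dKT)}\;K^{1-\frac{1}{2-2^{-\nu}}}\,\log T\Big)\,T^{\frac{1}{2-2^{-\nu}}},\qquad \nu=\Big\lfloor\frac{s-d-1}{K-1}\Big\rfloor .$$ -/

import Mathlib

open MeasureTheory

noncomputable section

namespace LimitedSwitch

/-! ### Histories and policies -/

/-- A history: the arms (price vectors) chosen so far, in order, with what was observed. -/
abbrev Hist (K : ℕ) (Obs : Type) : Type := List (Fin K × Obs)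

/-- The internal randomness of a policy: a uniform variable on `[0,1]`. -/
abbrev Seed : Type := unitInterval

/-- A non-anticipating, possibly randomized policy. Given its internal randomness and the history,
it chooses the next arm; the value `none` means that it ends the process for good. -/
structure Policy (K : ℕ) (Obs : Type) [MeasurableSpace Obs] where
  act : Seed → Hist K Obs → Option (Fin K)
  measurable_act : ∀ (t : ℕ) (k : Fin K),
    MeasurableSet {p : Seed × (Fin t → Fin K × Obs) | act p.1 (List.ofFn p.2) = some k}

/-- The number of positions at which two consecutive entries of a list differ. -/
def switches {K : ℕ} (l : List (Fin K)) : ℕ :=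
  (l.zip l.tail).countP (fun p => decide (p.1 ≠ p.2))

/-! ### The resource-constrained learning environment common to both models -/

/-- `T` periods, `d` resources with initial capacities `B`, `K` arms. Choosing arm `k` and observing
`o` yields the revenue `rew k o` and uses the amount `cost i k o` of resource `i`. -/
structure Env (d K : ℕ) (Obs : Type) where
  T : ℕ
  B : Fin d → ℝ
  rew : Fin K → Obs → ℝ
  cost : Fin d → Fin K → Obs → ℝ

namespace Env

variable {d K : ℕ} {Obs : Type} [MeasurableSpace Obs]

/-- No resource has been used beyond its initial capacity. -/
def WithinBudget (E : Env d K Obs) (h : Hist K Obs) : Prop :=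
  ∀ i, (h.map (fun e => E.cost i e.1 e.2)).sum ≤ E.B i

open Classical in
/-- The history after `t` periods when `ω t k` is the outcome of arm `k` in period `t`. The process
stops for good as soon as the cumulative use of some resource exceeds its capacity (the period in
which this happens is the last entry), the policy ends it, or the horizon is reached. -/
def hist (E : Env d K Obs) (φ : Policy K Obs) (u : Seed) (ω : Fin E.T → Fin K → Obs) :
    ℕ → Hist K Obs
  | 0 => []
  | t + 1 =>
    let h := hist E φ u ω t
    if ht : t < E.T then
      if h.length = t ∧ E.WithinBudget h then
        match φ.act u h with
        | some k => h ++ [(k, ω ⟨t, ht⟩ k)]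
        | none => h
      else h
    else h

open Classical in
/-- The revenue collected before a resource constraint is violated: only the last period of a
history can violate one, and it then yields nothing. -/
def revenue (E : Env d K Obs) (h : Hist K Obs) : ℝ :=
  ((if E.WithinBudget h then h else h.dropLast).map (fun e => E.rew e.1 e.2)).sum

/-- Joint law of the internal randomness of the policy and of the outcomes. `D k` is the
distribution of the outcome of arm `k`; periods are independent. -/
def law (E : Env d K Obs) (D : Fin K → Measure Obs) :
    Measure (Seed × (Fin E.T → Fin K → Obs)) :=
  (volume : Measure Seed).prod (Measure.pi fun _ => Measure.pi D)

/-- Expected revenue of a policy under the outcome distributions `D`. -/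
def Rev (E : Env d K Obs) (D : Fin K → Measure Obs) (φ : Policy K Obs) : ℝ :=
  ∫ x, E.revenue (E.hist φ x.1 x.2 E.T) ∂(E.law D)

/-- Under the distributions `D`, the policy switches at most `s` times almost surely. -/
def SwitchesAtMost (E : Env d K Obs) (s : ℕ) (D : Fin K → Measure Obs) (φ : Policy K Obs) : Prop :=
  ∀ᵐ x ∂(E.law D), switches ((E.hist φ x.1 x.2 E.T).map Prod.fst) ≤ s

/-- `φ` is an `s`-switch learning policy: it switches at most `s` times almost surely under every
possible choice `D ∈ 𝒟` of the distributions. -/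
def IsSwitchLearning (E : Env d K Obs) (𝒟 : Set (Fin K → Measure Obs)) (s : ℕ)
    (φ : Policy K Obs) : Prop :=
  ∀ D ∈ 𝒟, E.SwitchesAtMost s D φ

/-- Optimal expected revenue of a clairvoyant policy (chosen knowing `D`) that switches at most `s`
times under `D`. -/
def optRevSwitch (E : Env d K Obs) (s : ℕ) (D : Fin K → Measure Obs) : EReal :=
  ⨆ π ∈ {π : Policy K Obs | E.SwitchesAtMost s D π}, (E.Rev D π : EReal)

/-- Optimal expected revenue of a clairvoyant policy with unlimited switches. -/
def optRev (E : Env d K Obs) (D : Fin K → Measure Obs) : EReal :=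
  ⨆ π : Policy K Obs, (E.Rev D π : EReal)

/-- The `s`-switch regret: worst case over the possible distributions. -/
def switchRegret (E : Env d K Obs) (𝒟 : Set (Fin K → Measure Obs)) (s : ℕ)
    (φ : Policy K Obs) : EReal :=
  ⨆ D ∈ 𝒟, (E.optRevSwitch s D - (E.Rev D φ : EReal))

/-- The overall regret: worst case over the possible distributions. -/
def overallRegret (E : Env d K Obs) (𝒟 : Set (Fin K → Measure Obs)) (φ : Policy K Obs) : EReal :=
  ⨆ D ∈ 𝒟, (E.optRev D - (E.Rev D φ : EReal))

end Env

/-! ### The LS-2SLP algorithm -/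

/-- `ν(s,d) = ⌊(s-d-1)/(K-1)⌋`, understood as `0` when the quotient is negative. -/
def nu (s d K : ℕ) : ℕ := ⌊((s : ℝ) - d - 1) / ((K : ℝ) - 1)⌋₊

/-- The time points `t_l`, `0 ≤ l ≤ ν + 1`. -/
def tpt (K T ν l : ℕ) : ℕ :=
  if l = 0 then 0
  else
    ⌊(K : ℝ) ^ (1 - (2 - (1 / 2 : ℝ) ^ (l - 1)) / (2 - (1 / 2 : ℝ) ^ ν)) *
      (T : ℝ) ^ ((2 - (1 / 2 : ℝ) ^ (l - 1)) / (2 - (1 / 2 : ℝ) ^ ν))⌋₊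

/-- Number of periods in which arm `k` was chosen. -/
def pulls {K : ℕ} {Obs : Type} (h : Hist K Obs) (k : Fin K) : ℕ :=
  h.countP (fun e => decide (e.1 = k))

/-- Empirical mean of `f` over the periods in which arm `k` was chosen (`0` if there is none). -/
def empMean {K : ℕ} {Obs : Type} (f : Obs → ℝ) (h : Hist K Obs) (k : Fin K) : ℝ :=
  ((h.filter (fun e => decide (e.1 = k))).map (fun e => f e.2)).sum / (pulls h k : ℝ)

/-- The data that the algorithm works with: horizon, capacities, switching budget, discounting
factor, the empirical mean rewards and costs of the arms computed from a history, and the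
factors by which the confidence radii of rewards and costs are scaled. -/
structure Learner (d K : ℕ) (Obs : Type) where
  T : ℕ
  B : Fin d → ℝ
  s : ℕ
  gamma : ℝ
  estRew : Hist K Obs → Fin K → ℝ
  estCost : Hist K Obs → Fin d → Fin K → ℝ
  radRew : Fin K → ℝ
  radCost : Fin d → ℝ

/-- Upper and lower confidence bounds on rewards and costs; the upper ones may be `∞`. -/
structure Bounds (d K : ℕ) where
  Urew : Fin K → EReal
  Lrew : Fin K → ℝ
  Ucost : Fin d → Fin K → EReal
  Lcost : Fin d → Fin K → ℝ

/-- The choices that the description of the algorithm leaves open: the random initial action `z₀`,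
the optimal solutions `x^{l,j}` of the exploration LPs and that of the last LP when they are not
unique, and the order in which the arms are played in an epoch. They may depend on the internal
randomness, the epoch and the data collected before it. -/
structure Choices (K : ℕ) (Obs : Type) where
  z0 : Seed → Fin K
  explore : Seed → ℕ → Hist K Obs → Fin K → Fin K → ℝ
  final : Seed → Hist K Obs → Fin K → ℝ
  order : Seed → ℕ → Hist K Obs → Fin K → List (Fin K)

/-- Each arm `k` for `m k` consecutive periods, in the given order of the arms. -/
def block {K : ℕ} (order : List (Fin K)) (m : Fin K → ℕ) : List (Fin K) :=
  order.flatMap (fun k => List.replicate (m k) k)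

/-- The number of non-zero components. -/
def l0norm {K : ℕ} (x : Fin K → ℝ) : ℕ := {k | x k ≠ 0}.ncard

namespace Learner

variable {d K : ℕ} {Obs : Type}

/-- Initial confidence bounds: `0` and `∞`. -/
def initBounds (d K : ℕ) : Bounds d K where
  Urew _ := ⊤
  Lrew _ := 0
  Ucost _ _ := ⊤
  Lcost _ _ := 0

/-- The confidence radius `√(log((d+1)KT) / n_k)`, for `n_k > 0`. -/
def radius (A : Learner d K Obs) (h : Hist K Obs) (k : Fin K) : ℝ :=
  √(Real.log (((d : ℝ) + 1) * K * A.T) / (pulls h k : ℝ))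

/-- The confidence bounds after seeing `h`, given those of the preceding epoch. The radius of an arm
that was never chosen is infinite, so that its bounds do not change. -/
def updateBounds (A : Learner d K Obs) (b : Bounds d K) (h : Hist K Obs) : Bounds d K where
  Urew k := if pulls h k = 0 then b.Urew k
    else min ((A.estRew h k + A.radRew k * A.radius h k : ℝ) : EReal) (b.Urew k)
  Lrew k := if pulls h k = 0 then b.Lrew k
    else max (A.estRew h k - A.radRew k * A.radius h k) (b.Lrew k)
  Ucost i k := if pulls h k = 0 then b.Ucost i k
    else min ((A.estCost h i k + A.radCost i * A.radius h k : ℝ) : EReal) (b.Ucost i k)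
  Lcost i k := if pulls h k = 0 then b.Lcost i k
    else max (A.estCost h i k - A.radCost i * A.radius h k) (b.Lcost i k)

/-- Feasible set of the first-stage pessimistic LP (with `∞ · 0 = 0`). -/
def pesFeasible (A : Learner d K Obs) (b : Bounds d K) : Set (Fin K → ℝ) :=
  {x | (∀ k, 0 ≤ x k) ∧ ∑ k, x k ≤ A.T ∧
    ∀ i, ∑ k, b.Ucost i k * (x k : EReal) ≤ (A.B i : EReal)}

/-- Optimal value of the first-stage pessimistic LP. -/
def Jpes (A : Learner d K Obs) (b : Bounds d K) : ℝ :=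
  sSup ((fun x => ∑ k, b.Lrew k * x k) '' A.pesFeasible b)

/-- Feasible set of the second-stage exploration LPs (with `∞ · 0 = 0`). -/
def expFeasible (A : Learner d K Obs) (b : Bounds d K) : Set (Fin K → ℝ) :=
  {x | (∀ k, 0 ≤ x k) ∧ ∑ k, x k ≤ A.T ∧
    (A.Jpes b : EReal) ≤ ∑ k, b.Urew k * (x k : EReal) ∧
    ∀ i, ∑ k, b.Lcost i k * x k ≤ A.B i}

/-- `x` is an optimal solution of the `j`-th second-stage exploration LP. -/
def IsExploreOpt (A : Learner d K Obs) (b : Bounds d K) (j : Fin K) (x : Fin K → ℝ) : Prop :=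
  x ∈ A.expFeasible b ∧ ∀ y ∈ A.expFeasible b, y j ≤ x j

/-- Feasible set of the empirical deterministic LP of the last epoch. -/
def finFeasible (A : Learner d K Obs) (h : Hist K Obs) : Set (Fin K → ℝ) :=
  {x | (∀ k, 0 ≤ x k) ∧ ∑ k, x k ≤ A.T ∧ ∀ i, ∑ k, A.estCost h i k * x k ≤ A.B i}

/-- `x` is an optimal solution of the empirical deterministic LP of the last epoch. -/
def IsFinalOpt (A : Learner d K Obs) (h : Hist K Obs) (x : Fin K → ℝ) : Prop :=
  x ∈ A.finFeasible h ∧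
    ∀ y ∈ A.finFeasible h, ∑ k, A.estRew h k * y k ≤ ∑ k, A.estRew h k * x k

/-- `x` is an optimal solution of the LP of the last epoch with the least number of non-zero
components. -/
def IsSparseFinalOpt (A : Learner d K Obs) (h : Hist K Obs) (x : Fin K → ℝ) : Prop :=
  A.IsFinalOpt h x ∧ ∀ y, A.IsFinalOpt h y → l0norm x ≤ l0norm y

/-- The index `ν(s,d)`. -/
def ν (A : Learner d K Obs) : ℕ := nu A.s d K

/-- Length of epoch `l` relative to the horizon, `(t_l - t_{l-1}) / T`, with `l` shifted by one. -/
def frac (A : Learner d K Obs) (l : ℕ) : ℝ :=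
  ((tpt K A.T A.ν (l + 1) : ℝ) - (tpt K A.T A.ν l : ℝ)) / (A.T : ℝ)

/-- Number of periods `γ N_k^{l+1}` of arm `k` in epoch `l + 1 ≤ ν`, rounded down (and `0` if it is
negative). -/
def exploreCount (A : Learner d K Obs) (l : ℕ) (x : Fin K → Fin K → ℝ) (k : Fin K) : ℕ :=
  ⌊A.gamma * (A.frac l * ∑ j, 1 / (K : ℝ) * x j k)⌋₊

/-- Number of periods `γ N_k^{ν+1}` of arm `k` in the last epoch, rounded down (and `0` if it is
negative). -/
def finalCount (A : Learner d K Obs) (x : Fin K → ℝ) (k : Fin K) : ℕ :=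
  ⌊A.gamma * (A.frac A.ν * x k)⌋₊

/-- The actions planned for the epochs finished so far (so that its length is the last period
`T_l` of the last of them) and the confidence bounds used in that epoch. -/
structure State (d K : ℕ) where
  plan : List (Fin K)
  bounds : Bounds d K

/-- The last action planned so far, or `z₀` if there is none. -/
def lastAction (C : Choices K Obs) (u : Seed) (p : List (Fin K)) : Fin K :=
  p.getLast?.getD (C.z0 u)

/-- The state after `l` epochs. The plan of epoch `l + 1` uses only the observations in `h` of the
periods up to the end `T_l` of epoch `l`. -/
def state (A : Learner d K Obs) (C : Choices K Obs) (u : Seed) (h : Hist K Obs) : ℕ → State d K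
  | 0 => ⟨[], initBounds d K⟩
  | l + 1 =>
    let st := state A C u h l
    let data := h.take st.plan.length
    ⟨st.plan ++ block (C.order u (l + 1) data (lastAction C u st.plan))
        (A.exploreCount l (C.explore u (l + 1) data)),
      A.updateBounds st.bounds data⟩

/-- All actions planned, including those of the last epoch. -/
def fullPlan (A : Learner d K Obs) (C : Choices K Obs) (u : Seed) (h : Hist K Obs) :
    List (Fin K) :=
  let st := A.state C u h A.ν
  let data := h.take st.plan.length
  st.plan ++ block (C.order u (A.ν + 1) data (lastAction C u st.plan))
    (A.finalCount (C.final u data))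

/-- The choices conform to the description of the algorithm: the `x^{l,j}` are optimal solutions of
the exploration LPs whenever these have one, the solution used in the last epoch is an optimal one
with the least number of non-zero components, and each epoch goes through all arms, starting with
the last action of the preceding epoch. -/
structure Valid (A : Learner d K Obs) (C : Choices K Obs) : Prop where
  explore_opt : ∀ (u : Seed) (h : Hist K Obs) (l : ℕ), l < A.ν → ∀ j : Fin K,
    (∃ y, A.IsExploreOpt (A.state C u h (l + 1)).bounds j y) →
      A.IsExploreOpt (A.state C u h (l + 1)).bounds j
        (C.explore u (l + 1) (h.take (A.state C u h l).plan.length) j)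
  final_opt : ∀ (u : Seed) (h : Hist K Obs), A.IsSparseFinalOpt h (C.final u h)
  order_perm : ∀ (u : Seed) (l : ℕ) (h : Hist K Obs) (z : Fin K),
    (C.order u l h z).Perm (List.finRange K)
  order_head : ∀ (u : Seed) (l : ℕ) (h : Hist K Obs) (z : Fin K),
    (C.order u l h z).head? = some z

/-- `φ` is an LS-2SLP policy: in the period following the history `h` it chooses the action planned
for that period from the data in `h`, and it ends when the plan has been carried out. -/
def IsLS2SLP [MeasurableSpace Obs] (A : Learner d K Obs) (φ : Policy K Obs) : Prop :=
  ∃ C : Choices K Obs, A.Valid C ∧ ∀ u h, φ.act u h = (A.fullPlan C u h)[h.length]?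

end Learner

/-! ### Blind network revenue management -/

/-- A blind network revenue management problem with `d` resources, `K` price vectors and `n`
products: `p j k` is the price of product `j` in price vector `k`, and `a i j` is the amount of
resource `i` that one unit of product `j` uses. -/
structure BNRM (d K n : ℕ) where
  T : ℕ
  B : Fin d → ℝ
  p : Fin n → Fin K → ℝ
  a : Fin d → Fin n → ℝ

namespace BNRM

variable {d K n : ℕ}

/-- The observation in a period is the vector of the demands for the products. -/
def env (P : BNRM d K n) : Env d K (Fin n → ℝ) where
  T := P.T
  B := P.B
  rew k q := ∑ j, P.p j k * q j
  cost i _ q := ∑ j, P.a i j * q j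

/-- The possible demand distributions: under price vector `k`, the demand for product `j` has some
distribution `Q j k` on `[0,1]`, and the demands for the products are independent. -/
def dists (K n : ℕ) : Set (Fin K → Measure (Fin n → ℝ)) :=
  {D | ∃ Q : Fin n → Fin K → Measure ℝ,
    (∀ j k, IsProbabilityMeasure (Q j k) ∧ ∀ᵐ q ∂(Q j k), q ∈ Set.Icc (0 : ℝ) 1) ∧
    D = fun k => Measure.pi fun j => Q j k}

/-- The largest entry of the consumption matrix. -/
def aMax (P : BNRM d K n) : ℝ := ⨆ i, ⨆ j, P.a i j

/-- The smallest initial inventory. -/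
def Bmin (P : BNRM d K n) : ℝ := ⨅ i, P.B i

/-- Empirical mean demand for product `j` under price vector `k`. -/
def qbar (h : Hist K (Fin n → ℝ)) (j : Fin n) (k : Fin K) : ℝ := empMean (fun q => q j) h k

/-- The LS-2SLP algorithm for blind network revenue management with switching budget `s`. -/
def learner (P : BNRM d K n) (s : ℕ) : Learner d K (Fin n → ℝ) where
  T := P.T
  B := P.B
  s := s
  gamma := 1 - 3 * (P.aMax * √((d : ℝ) * n * Real.log ((d : ℝ) * K * P.T)) * Real.log P.T / P.Bmin)
    * (tpt K P.T (nu s d K) 1 : ℝ)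
  estRew h k := ∑ j, P.p j k * qbar h j k
  estCost h i k := ∑ j, P.a i j * qbar h j k
  radRew k := √(∑ j, P.p j k ^ 2)
  radCost i := √(∑ j, P.a i j ^ 2)

end BNRM

/-! ### Bandits with knapsacks -/

/-- A bandits with knapsacks problem with `d` resources and `K` arms; `Rmax` and `Cmax` bound the
rewards and the costs. -/
structure BwK (d K : ℕ) where
  T : ℕ
  B : Fin d → ℝ
  Rmax : ℝ
  Cmax : ℝ

namespace BwK

variable {d K : ℕ}

/-- The observation in a period is the reward together with the cost vector. -/
def env (P : BwK d K) : Env d K (ℝ × (Fin d → ℝ)) where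
  T := P.T
  B := P.B
  rew _ o := o.1
  cost i _ o := o.2 i

/-- The possible distributions: for each arm, an arbitrary joint distribution of the reward in
`[0, Rmax]` and of the cost vector in `[0, Cmax]^d`. -/
def dists (P : BwK d K) : Set (Fin K → Measure (ℝ × (Fin d → ℝ))) :=
  {D | ∀ k, IsProbabilityMeasure (D k) ∧
    ∀ᵐ o ∂(D k), o.1 ∈ Set.Icc 0 P.Rmax ∧ ∀ i, o.2 i ∈ Set.Icc 0 P.Cmax}

/-- The smallest initial capacity. -/
def Bmin (P : BwK d K) : ℝ := ⨅ i, P.B i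

/-- The LS-2SLP algorithm for bandits with knapsacks with switching budget `s`. -/
def learner (P : BwK d K) (s : ℕ) : Learner d K (ℝ × (Fin d → ℝ)) where
  T := P.T
  B := P.B
  s := s
  gamma := 1 - 3 * (P.Cmax * √((d : ℝ) * Real.log ((d : ℝ) * K * P.T)) * Real.log P.T / P.Bmin)
    * (tpt K P.T (nu s d K) 1 : ℝ)
  estRew h k := empMean (fun o => o.1) h k
  estCost h i k := empMean (fun o => o.2 i) h k
  radRew _ := P.Rmax
  radCost _ := P.Cmax

end BwK

/-- The upper bound on the regret. -/
def regretBound (c : ℝ) (T K d s : ℕ) : ℝ :=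
  (c * √((d : ℝ) * Real.log ((d : ℝ) * K * T)) *
      (K : ℝ) ^ (1 - 1 / (2 - (1 / 2 : ℝ) ^ nu s d K)) * Real.log T) *
    (T : ℝ) ^ (1 / (2 - (1 / 2 : ℝ) ^ nu s d K))

end LimitedSwitch

end

noncomputable section

namespace LimitedSwitch

/-! ### Sparse solutions of linear programs -/

/-! The benchmark is the deterministic linear program: maximize the mean reward over allocations of
at most `T` periods whose mean costs respect the capacities. By Wald's identity the expected pull
counts of any policy are feasible for it, up to the one period in which a capacity is exceeded, so
no policy earns more than its value plus a constant (`Env.Rev_le`). It remains to show that LS-2SLP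
earns this value up to the rate `√(d log (dKT)) · log T · τ₀`, where `τ₀` is `t_1` before rounding.

Switches. Every epoch starts with the arm that ended the preceding one, so an exploration epoch adds
at most `K - 1` switches. An optimal solution of the last program with least support has at most `d
+ 1` nonzero entries, because a larger support allows a move that keeps all constraints and empties
a coordinate (`exists_sparse`). The definition of `ν` makes the total at most `s`.

Statistics. Exponential supermartingales and Ville's inequality show that, outside an event of
probability at most `6 / √((d+1)KT)`, every empirical mean is within its radius of the true mean and
also of every later empirical mean. The second property puts the optimum of the last, empirical
program into all earlier exploration polytopes, next to the true optimum.

Exploration. These polytopes decrease from epoch to epoch. If `M k` is the largest weight of arm `k`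
in the current one, then averaging the `K` exploration solutions gives the arm about `t_l M k /
(TK)` pulls so far. For `x` in the polytope the radii therefore add up to about `√(TK log / t_l) · ∑
x k / √(M k)`. Sparsifying `x` inside the polytope bounds the last sum by `√((d+2)T)`, independently
of `K` (`sum_div_sqrt_le`, `Run.sum_radius_le`). Hence each allocation of the next epoch overspends
and loses at most a multiple of `T √(d log · K / t_l)` (`Run.alloc_loss`).

Summation. The time points make `t_{l+1} √(K / t_l)` of order `τ₀` in every epoch. As `ν` is not
bounded in terms of `T`, the epochs are not simply counted: slow growth telescopes, and only `O(√log
T)` epochs grow fast (`sum_epoch_le`). The discount `γ` frees capacity of order `log T · √(d log) ·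
t_1`, which for large `T` pays for the first epoch, for the overspending and for the noise, so the
whole plan is carried out within budget (`Model.budget`, `Run.withinBudget_and_revenue_ge`). If the
rate is not small compared with `T`, the bound is trivial for a large enough constant. -/

theorem l0norm_eq_card {K : ℕ} (x : Fin K → ℝ) :
    l0norm x = (Finset.univ.filter fun k => x k ≠ 0).card := by
  rw [l0norm, Set.ncard_eq_toFinset_card']
  congr 1
  ext k; simp

/-- A nonzero direction supported on more than `m + 1` coordinates that is annihilated by `m`
functionals and by the sum of the coordinates. -/
theorem exists_direction {K m : ℕ} (F : Fin m → Fin K → ℝ) (S : Finset (Fin K))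
    (hS : m + 1 < S.card) :
    ∃ v : Fin K → ℝ, (∃ k, v k ≠ 0) ∧ (∀ k, k ∉ S → v k = 0) ∧ ∑ k, v k = 0 ∧
      ∀ i, ∑ k, F i k * v k = 0 := by
  classical
  let ext : (S → ℝ) → Fin K → ℝ := fun w k => if h : k ∈ S then w ⟨k, h⟩ else 0
  let Φ : (S → ℝ) →ₗ[ℝ] (Option (Fin m) → ℝ) :=
    LinearMap.pi fun o => match o with
      | none => ∑ k : S, LinearMap.proj k
      | some i => ∑ k : S, F i k • LinearMap.proj k
  have hlt : Module.finrank ℝ (Option (Fin m) → ℝ) < Module.finrank ℝ (S → ℝ) := by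
    simp only [Module.finrank_fintype_fun_eq_card, Fintype.card_option, Fintype.card_fin,
      Fintype.card_coe]
    exact hS
  obtain ⟨w, hw, hw0⟩ := (Submodule.ne_bot_iff _).1 (LinearMap.ker_ne_bot_of_finrank_lt (f := Φ) hlt)
  have hsum : ∀ f : Fin K → ℝ, ∑ k, f k * ext w k = ∑ k : S, f k * w k := by
    intro f
    rw [← Finset.sum_subset (Finset.subset_univ S), ← Finset.sum_coe_sort S]
    · refine Finset.sum_congr rfl fun k _ => ?_
      simp [ext]
    · intro k _ hk
      simp [ext, hk]
  refine ⟨ext w, ?_, fun k hk => by simp [ext, hk], ?_, fun i => ?_⟩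
  · by_contra! h
    apply hw0
    funext k
    have := h k
    simpa [ext] using this
  · have h1 := congrFun (LinearMap.mem_ker.1 hw) none
    have h2 := hsum (fun _ => 1)
    simp only [one_mul] at h2
    rw [h2]
    simpa [Φ] using h1
  · have h1 := congrFun (LinearMap.mem_ker.1 hw) (some i)
    rw [hsum]
    simpa [Φ] using h1

/-- Orient a direction from `exists_direction` so that `g` does not decrease along it. Its entries
sum to zero, so one of them is negative; moving until the first coordinate vanishes shrinks the
support. Induction on the support size finishes. -/
theorem exists_sparse {K m : ℕ} (F : Fin m → Fin K → ℝ) (g : Fin K → ℝ) :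
    ∀ x : Fin K → ℝ, (∀ k, 0 ≤ x k) →
    ∃ y : Fin K → ℝ, (∀ k, 0 ≤ y k) ∧ ∑ k, y k = ∑ k, x k ∧
      (∀ i, ∑ k, F i k * y k = ∑ k, F i k * x k) ∧ ∑ k, g k * x k ≤ ∑ k, g k * y k ∧
      l0norm y ≤ m + 1 := by
  suffices h : ∀ N : ℕ, ∀ x : Fin K → ℝ, l0norm x ≤ N → (∀ k, 0 ≤ x k) →
    ∃ y : Fin K → ℝ, (∀ k, 0 ≤ y k) ∧ ∑ k, y k = ∑ k, x k ∧
      (∀ i, ∑ k, F i k * y k = ∑ k, F i k * x k) ∧ ∑ k, g k * x k ≤ ∑ k, g k * y k ∧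
      l0norm y ≤ m + 1 from fun x => h _ x le_rfl
  intro N
  induction N with
  | zero => exact fun x hx hx0 => ⟨x, hx0, rfl, fun _ => rfl, le_rfl, by omega⟩
  | succ N ih =>
    intro x hxN hx0
    by_cases hle : l0norm x ≤ m + 1
    · exact ⟨x, hx0, rfl, fun _ => rfl, le_rfl, hle⟩
    obtain ⟨v, ⟨hv0, hvS, hvs, hvF⟩, hvg⟩ : ∃ v : Fin K → ℝ, ((∃ k, v k ≠ 0) ∧
        (∀ k, x k = 0 → v k = 0) ∧ ∑ k, v k = 0 ∧ ∀ i, ∑ k, F i k * v k = 0) ∧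
        0 ≤ ∑ k, g k * v k := by
      obtain ⟨v, h1, h2, h3, h4⟩ := exists_direction F (Finset.univ.filter fun k => x k ≠ 0)
        (by rw [← l0norm_eq_card]; omega)
      have h2' : ∀ k, x k = 0 → v k = 0 := fun k hk => h2 k (by simp [hk])
      rcases le_total 0 (∑ k, g k * v k) with h | h
      · exact ⟨v, ⟨h1, h2', h3, h4⟩, h⟩
      · refine ⟨-v, ⟨?_, fun k hk => by simp [h2' k hk], by simp [h3], fun i => ?_⟩, ?_⟩
        · obtain ⟨k, hk⟩ := h1
          exact ⟨k, by simpa using hk⟩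
        · simp [h4 i]
        · simpa using h
    have hneg : (Finset.univ.filter fun k => v k < 0).Nonempty := by
      by_contra hne
      rw [Finset.not_nonempty_iff_eq_empty] at hne
      have hnn : ∀ k, 0 ≤ v k := by
        intro k
        by_contra hk
        have : k ∈ Finset.univ.filter fun k => v k < 0 := by simpa using hk
        rw [hne] at this
        simp at this
      obtain ⟨k, hk⟩ := hv0
      exact hk ((Finset.sum_eq_zero_iff_of_nonneg fun k _ => hnn k).1 hvs k (Finset.mem_univ k))
    -- Ratio test: the least `x k / (-v k)` over the decreasing coordinates is the longest step that
    -- keeps all coordinates nonnegative.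
    obtain ⟨k₀, hk₀, hmin⟩ := Finset.exists_min_image _ (fun k => x k / (-v k)) hneg
    have hk₀' : v k₀ < 0 := by simpa using hk₀
    set t := x k₀ / (-v k₀) with ht
    have ht0 : 0 ≤ t := div_nonneg (hx0 _) (by linarith)
    have hy0 : ∀ k, 0 ≤ x k + t * v k := by
      intro k
      rcases le_or_gt 0 (v k) with h | h
      · have := hx0 k; positivity
      · have := hmin k (by simpa using h)
        rw [le_div_iff₀ (by linarith)] at this
        linarith
    have hyk : x k₀ + t * v k₀ = 0 := by
      rw [ht, div_mul_eq_mul_div, div_neg, mul_div_cancel_right₀ _ hk₀'.ne]; ring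
    have hlt : l0norm (fun k => x k + t * v k) < l0norm x := by
      rw [l0norm_eq_card, l0norm_eq_card]
      apply Finset.card_lt_card
      rw [Finset.ssubset_iff_of_subset]
      · refine ⟨k₀, ?_, by simp [hyk]⟩
        simp only [Finset.mem_filter, Finset.mem_univ, true_and]
        intro h
        exact hk₀'.ne (hvS _ h)
      · intro k
        simp only [Finset.mem_filter, Finset.mem_univ, true_and]
        intro h h'
        apply h
        rw [h', hvS k h']; simp
    obtain ⟨y, hy1, hy2, hy3, hy4, hy5⟩ := ih (fun k => x k + t * v k) (by omega) hy0
    refine ⟨y, hy1, ?_, fun i => ?_, le_trans ?_ hy4, hy5⟩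
    · rw [hy2, Finset.sum_add_distrib, ← Finset.mul_sum, hvs]; simp
    · rw [hy3]
      have : ∀ k, F i k * (x k + t * v k) = F i k * x k + t * (F i k * v k) := fun k => by ring
      simp only [this, Finset.sum_add_distrib, ← Finset.mul_sum, hvF]
      simp
    · have : ∀ k, g k * (x k + t * v k) = g k * x k + t * (g k * v k) := fun k => by ring
      simp only [this, Finset.sum_add_distrib, ← Finset.mul_sum]
      have := mul_nonneg ht0 hvg
      linarith

namespace Learner

variable {d K : ℕ} {Obs : Type}

theorem l0norm_le_of_isSparseFinalOpt (A : Learner d K Obs) {h : Hist K Obs} {x : Fin K → ℝ}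
    (hx : A.IsSparseFinalOpt h x) : l0norm x ≤ d + 1 := by
  obtain ⟨⟨⟨hx0, hxs, hxc⟩, hxo⟩, hmin⟩ := hx
  obtain ⟨y, hy0, hys, hyc, hyg, hyn⟩ := exists_sparse (A.estCost h) (A.estRew h) x hx0
  refine (hmin y ⟨⟨hy0, by rwa [hys], fun i => by rw [hyc]; exact hxc i⟩, fun z hz => ?_⟩).trans hyn
  exact (hxo z hz).trans hyg

end Learner

/-! ### Linear programs with confidence bounds -/

/-- The confidence bounds contain the given rewards and costs. -/
structure Bounds.Contains {d K : ℕ} (b : Bounds d K) (r : Fin K → ℝ) (c : Fin d → Fin K → ℝ) :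
    Prop where
  Lrew_le : ∀ k, b.Lrew k ≤ r k
  le_Urew : ∀ k, (r k : EReal) ≤ b.Urew k
  Lcost_le : ∀ i k, b.Lcost i k ≤ c i k
  le_Ucost : ∀ i k, (c i k : EReal) ≤ b.Ucost i k

/-- `x` solves the linear program with horizon `T`, capacities `B`, rewards `r` and costs `c`. -/
structure IsLPOpt {d K : ℕ} (T : ℝ) (B : Fin d → ℝ) (r : Fin K → ℝ) (c : Fin d → Fin K → ℝ)
    (x : Fin K → ℝ) : Prop where
  nonneg : ∀ k, 0 ≤ x k
  sum_le : ∑ k, x k ≤ T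
  cost_le : ∀ i, ∑ k, c i k * x k ≤ B i
  opt : ∀ y : Fin K → ℝ, (∀ k, 0 ≤ y k) → ∑ k, y k ≤ T → (∀ i, ∑ k, c i k * y k ≤ B i) →
    ∑ k, r k * y k ≤ ∑ k, r k * x k

theorem coe_sum_mul {K : ℕ} (f x : Fin K → ℝ) :
    ((∑ k, f k * x k : ℝ) : EReal) = ∑ k, (f k : EReal) * (x k : EReal) := by
  simp only [← EReal.coe_mul]
  exact map_sum (⟨⟨fun x : ℝ => (x : EReal), EReal.coe_zero⟩, EReal.coe_add⟩ : ℝ →+ EReal) _ _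

theorem sum_coe_mul_le {K : ℕ} {f g : Fin K → EReal} {x : Fin K → ℝ} (hx : ∀ k, 0 ≤ x k)
    (h : ∀ k, f k ≤ g k) : ∑ k, f k * (x k : EReal) ≤ ∑ k, g k * (x k : EReal) :=
  Finset.sum_le_sum fun k _ => mul_le_mul_of_nonneg_right (h k) (by exact_mod_cast hx k)

namespace Learner

variable {d K : ℕ} {Obs : Type}

theorem zero_mem_pesFeasible (A : Learner d K Obs) (b : Bounds d K) (hB : ∀ i, 0 ≤ A.B i) :
    (0 : Fin K → ℝ) ∈ A.pesFeasible b := by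
  refine ⟨fun k => le_rfl, by simp, fun i => ?_⟩
  simpa using hB i

theorem bddAbove_pes (A : Learner d K Obs) (b : Bounds d K) :
    BddAbove ((fun x => ∑ k, b.Lrew k * x k) '' A.pesFeasible b) := by
  refine ⟨∑ k, |b.Lrew k| * A.T, ?_⟩
  rintro _ ⟨x, ⟨hx0, hxs, -⟩, rfl⟩
  refine Finset.sum_le_sum fun k _ => ?_
  have h1 : x k ≤ A.T := (Finset.single_le_sum (fun k _ => hx0 k) (Finset.mem_univ k)).trans hxs
  calc b.Lrew k * x k ≤ |b.Lrew k| * x k := mul_le_mul_of_nonneg_right (le_abs_self _) (hx0 k)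
    _ ≤ _ := mul_le_mul_of_nonneg_left h1 (abs_nonneg _)

theorem le_Jpes (A : Learner d K Obs) {b : Bounds d K} {x : Fin K → ℝ}
    (hx : x ∈ A.pesFeasible b) : ∑ k, b.Lrew k * x k ≤ A.Jpes b :=
  le_csSup (A.bddAbove_pes b) ⟨x, hx, rfl⟩

theorem Jpes_le (A : Learner d K Obs) {b : Bounds d K} (hB : ∀ i, 0 ≤ A.B i) {J : ℝ}
    (h : ∀ x ∈ A.pesFeasible b, ∑ k, b.Lrew k * x k ≤ J) : A.Jpes b ≤ J := by
  refine csSup_le ⟨_, _, A.zero_mem_pesFeasible b hB, rfl⟩ ?_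
  rintro _ ⟨x, hx, rfl⟩
  exact h x hx

/-- Pessimistic data cannot raise the optimal value above that of `(r, c)`, and optimistic data keep
`x` feasible with at least its value. The pair `(r, c)` need not be the true one: the lemma is also
used for empirical means lying within the bounds. -/
theorem mem_expFeasible_of_isLPOpt (A : Learner d K Obs) {b : Bounds d K} (hB : ∀ i, 0 ≤ A.B i)
    {r : Fin K → ℝ} {c : Fin d → Fin K → ℝ} (hb : b.Contains r c) {x : Fin K → ℝ}
    (hx : IsLPOpt A.T A.B r c x) : x ∈ A.expFeasible b := by
  refine ⟨hx.nonneg, hx.sum_le, ?_, fun i => ?_⟩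
  · have h1 : A.Jpes b ≤ ∑ k, r k * x k := by
      refine A.Jpes_le hB fun y ⟨hy0, hys, hyc⟩ => ?_
      refine le_trans (Finset.sum_le_sum fun k _ =>
        mul_le_mul_of_nonneg_right (hb.Lrew_le k) (hy0 k)) (hx.opt y hy0 hys fun i => ?_)
      have := (sum_coe_mul_le hy0 (hb.le_Ucost i)).trans (hyc i)
      rw [← coe_sum_mul] at this
      exact_mod_cast this
    refine le_trans (EReal.coe_le_coe_iff.2 h1) ?_
    rw [coe_sum_mul]
    exact sum_coe_mul_le hx.nonneg hb.le_Urew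
  · exact (Finset.sum_le_sum fun k _ =>
      mul_le_mul_of_nonneg_right (hb.Lcost_le i k) (hx.nonneg k)).trans (hx.cost_le i)

/-- Tighter bounds raise the pessimistic value, lower the optimistic rewards and raise the
optimistic costs. The running minima and maxima in the update exist for this: they make the
polytopes of successive epochs nested. -/
theorem expFeasible_updateBounds_subset (A : Learner d K Obs) (b : Bounds d K) (h : Hist K Obs)
    (hB : ∀ i, 0 ≤ A.B i) : A.expFeasible (A.updateBounds b h) ⊆ A.expFeasible b := by
  have hU : ∀ k, (A.updateBounds b h).Urew k ≤ b.Urew k := fun k => by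
    simp only [updateBounds]; split_ifs <;> simp
  have hL : ∀ k, b.Lrew k ≤ (A.updateBounds b h).Lrew k := fun k => by
    simp only [updateBounds]; split_ifs <;> simp
  have hU' : ∀ i k, (A.updateBounds b h).Ucost i k ≤ b.Ucost i k := fun i k => by
    simp only [updateBounds]; split_ifs <;> simp
  have hL' : ∀ i k, b.Lcost i k ≤ (A.updateBounds b h).Lcost i k := fun i k => by
    simp only [updateBounds]; split_ifs <;> simp
  rintro x ⟨hx0, hxs, hxr, hxc⟩
  refine ⟨hx0, hxs, ?_, fun i => ?_⟩
  · refine le_trans ?_ (hxr.trans (sum_coe_mul_le hx0 hU))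
    rw [EReal.coe_le_coe_iff]
    refine A.Jpes_le hB fun y ⟨hy0, hys, hyc⟩ => ?_
    refine le_trans (Finset.sum_le_sum fun k _ => mul_le_mul_of_nonneg_right (hL k) (hy0 k)) ?_
    exact A.le_Jpes ⟨hy0, hys, fun i => (sum_coe_mul_le hy0 (hU' i)).trans (hyc i)⟩
  · exact (Finset.sum_le_sum fun k _ =>
      mul_le_mul_of_nonneg_right (hL' i k) (hx0 k)).trans (hxc i)

theorem mem_expFeasible_iff_of_finite (A : Learner d K Obs) {b : Bounds d K} {u : Fin K → ℝ}
    (hu : ∀ k, b.Urew k = (u k : EReal)) (x : Fin K → ℝ) :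
    x ∈ A.expFeasible b ↔ (∀ k, 0 ≤ x k) ∧ ∑ k, x k ≤ A.T ∧ A.Jpes b ≤ ∑ k, u k * x k ∧
      ∀ i, ∑ k, b.Lcost i k * x k ≤ A.B i := by
  simp only [expFeasible, Set.mem_ofPred_eq, hu, ← coe_sum_mul, EReal.coe_le_coe_iff]

theorem exists_isExploreOpt (A : Learner d K Obs) {b : Bounds d K} {u : Fin K → ℝ}
    (hu : ∀ k, b.Urew k = (u k : EReal)) (hne : (A.expFeasible b).Nonempty) (j : Fin K) :
    ∃ y, A.IsExploreOpt b j y := by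
  have hset : A.expFeasible b = {x : Fin K → ℝ | (∀ k, 0 ≤ x k) ∧ ∑ k, x k ≤ A.T ∧
      A.Jpes b ≤ ∑ k, u k * x k ∧ ∀ i, ∑ k, b.Lcost i k * x k ≤ A.B i} := by
    ext x; exact A.mem_expFeasible_iff_of_finite hu x
  have hcl : IsClosed (A.expFeasible b) := by
    rw [hset]
    simp only [Set.ofPred_and, Set.ofPred_forall]
    refine (isClosed_iInter fun k => isClosed_le (by fun_prop) (by fun_prop)).inter
      ((isClosed_le (by fun_prop) (by fun_prop)).inter
      ((isClosed_le (by fun_prop) (by fun_prop)).inter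
      (isClosed_iInter fun i => isClosed_le (by fun_prop) (by fun_prop))))
  have hcpt : IsCompact (A.expFeasible b) := by
    refine (isCompact_univ_pi fun _ : Fin K => isCompact_Icc (a := (0 : ℝ)) (b := A.T)).of_isClosed_subset
      hcl ?_
    rintro x ⟨hx0, hxs, -⟩ k -
    exact ⟨hx0 k, (Finset.single_le_sum (fun k _ => hx0 k) (Finset.mem_univ k)).trans hxs⟩
  obtain ⟨x, hx, hmax⟩ := hcpt.exists_isMaxOn hne (f := fun x => x j)
    (Continuous.continuousOn (by fun_prop))
  exact ⟨x, hx, fun y hy => hmax hy⟩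

/-- With the trivial bounds, the exploration LPs put all the weight on one arm. -/
theorem isExploreOpt_initBounds (A : Learner d K Obs) (hB : ∀ i, 0 ≤ A.B i) (j : Fin K) :
    A.IsExploreOpt (initBounds d K) j (Pi.single j (A.T : ℝ)) := by
  have h0 : ∀ k, 0 ≤ (Pi.single j (A.T : ℝ) : Fin K → ℝ) k := fun k => by
    by_cases h : k = j
    · subst h; simp
    · simp [h]
  refine ⟨⟨h0, by simp, ?_, fun i => by simpa [initBounds] using hB i⟩, ?_⟩
  · have hJ : A.Jpes (initBounds d K) ≤ 0 :=
      A.Jpes_le hB fun x _ => by simp [initBounds]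
    refine le_trans (EReal.coe_le_coe_iff.2 hJ) ?_
    refine Finset.sum_nonneg fun k _ => mul_nonneg (by simp [initBounds]) ?_
    exact_mod_cast h0 k
  · rintro y ⟨hy0, hys, -⟩
    simpa using (Finset.single_le_sum (fun k _ => hy0 k) (Finset.mem_univ j)).trans hys

end Learner

theorem exists_isLPOpt {d K : ℕ} (T : ℝ) (hT : 0 ≤ T) (B : Fin d → ℝ) (hB : ∀ i, 0 ≤ B i)
    (r : Fin K → ℝ) (c : Fin d → Fin K → ℝ) : ∃ x, IsLPOpt T B r c x := by
  let S : Set (Fin K → ℝ) := {x | (∀ k, 0 ≤ x k) ∧ ∑ k, x k ≤ T ∧ ∀ i, ∑ k, c i k * x k ≤ B i}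
  have hcl : IsClosed S := by
    simp only [S, Set.ofPred_and, Set.ofPred_forall]
    exact (isClosed_iInter fun k => isClosed_le (by fun_prop) (by fun_prop)).inter
      ((isClosed_le (by fun_prop) (by fun_prop)).inter
      (isClosed_iInter fun i => isClosed_le (by fun_prop) (by fun_prop)))
  have hcpt : IsCompact S := by
    refine (isCompact_univ_pi fun _ : Fin K => isCompact_Icc (a := (0 : ℝ)) (b := T)).of_isClosed_subset
      hcl ?_
    rintro x ⟨hx0, hxs, -⟩ k -
    exact ⟨hx0 k, (Finset.single_le_sum (fun k _ => hx0 k) (Finset.mem_univ k)).trans hxs⟩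
  obtain ⟨x, hx, hmax⟩ := hcpt.exists_isMaxOn ⟨0, by simp [S, hT, hB]⟩
    (f := fun x => ∑ k, r k * x k) (Continuous.continuousOn (by fun_prop))
  exact ⟨x, hx.1, hx.2.1, hx.2.2, fun y h1 h2 h3 => hmax ⟨h1, h2, h3⟩⟩

end LimitedSwitch

end

noncomputable section

namespace LimitedSwitch

/-! ### The structure of histories -/

namespace Env

variable {d K : ℕ} {Obs : Type} [MeasurableSpace Obs]

theorem hist_succ_eq (E : Env d K Obs) (φ : Policy K Obs) (u : Seed)
    (ω : Fin E.T → Fin K → Obs) (t : ℕ) :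
    E.hist φ u ω (t + 1) = E.hist φ u ω t ∨ ∃ (ht : t < E.T) (k : Fin K),
      (E.hist φ u ω t).length = t ∧ E.WithinBudget (E.hist φ u ω t) ∧
      φ.act u (E.hist φ u ω t) = some k ∧
      E.hist φ u ω (t + 1) = E.hist φ u ω t ++ [(k, ω ⟨t, ht⟩ k)] := by
  rw [hist]
  split_ifs with h1 h2
  · cases h : φ.act u (E.hist φ u ω t) with
    | none => exact Or.inl rfl
    | some k => exact Or.inr ⟨h1, k, h2.1, h2.2, rfl, rfl⟩
  all_goals exact Or.inl rfl

theorem length_hist_le (E : Env d K Obs) (φ : Policy K Obs) (u : Seed)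
    (ω : Fin E.T → Fin K → Obs) (t : ℕ) : (E.hist φ u ω t).length ≤ t := by
  induction t with
  | zero => simp [hist]
  | succ t ih =>
    rcases E.hist_succ_eq φ u ω t with h | ⟨ht, k, h1, -, -, h⟩ <;> rw [h]
    · omega
    · simp [h1]

/-- Inversion of the recursion. It is stated for prefixes so that it applies to every period and not
only to the last one. -/
theorem hist_append (E : Env d K Obs) (φ : Policy K Obs) (u : Seed)
    (ω : Fin E.T → Fin K → Obs) (t : ℕ) {h : Hist K Obs} {e : Fin K × Obs}
    (he : h ++ [e] <+: E.hist φ u ω t) :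
    φ.act u h = some e.1 ∧ E.WithinBudget h ∧
      ∃ ht : h.length < E.T, e.2 = ω ⟨h.length, ht⟩ e.1 := by
  induction t with
  | zero => simp [hist] at he
  | succ t ih =>
    rcases E.hist_succ_eq φ u ω t with h' | ⟨ht, k, h1, h2, h3, h'⟩ <;> rw [h'] at he
    · exact ih he
    · rcases List.prefix_concat_iff.1 he with h4 | h4
      · obtain ⟨rfl, h6⟩ := List.append_inj' h4 rfl
        simp only [List.cons.injEq, and_true] at h6
        subst h6
        exact ⟨h3, h2, by rw [h1]; exact ht, by simp only [h1]⟩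
      · exact ih h4

theorem hist_end (E : Env d K Obs) (φ : Policy K Obs) (u : Seed)
    (ω : Fin E.T → Fin K → Obs) (t : ℕ) (ht : t ≤ E.T) :
    (E.hist φ u ω t).length = t ∨ ¬ E.WithinBudget (E.hist φ u ω t) ∨
      φ.act u (E.hist φ u ω t) = none := by
  induction t with
  | zero => simp [hist]
  | succ t ih =>
    rw [hist]
    rw [dif_pos (by omega : t < E.T)]
    split_ifs with h2
    · cases h : φ.act u (E.hist φ u ω t) with
      | none => exact Or.inr (Or.inr h)
      | some k => left; simp [h2.1]
    · rcases ih (by omega) with h | h | h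
      · right; left; exact fun h3 => h2 ⟨h, h3⟩
      · exact Or.inr (Or.inl h)
      · exact Or.inr (Or.inr h)

theorem withinBudget_dropLast_hist (E : Env d K Obs) (φ : Policy K Obs) (u : Seed)
    (ω : Fin E.T → Fin K → Obs) (t : ℕ) (hne : E.hist φ u ω t ≠ []) :
    E.WithinBudget (E.hist φ u ω t).dropLast :=
  (E.hist_append φ u ω t (h := (E.hist φ u ω t).dropLast) (e := (E.hist φ u ω t).getLast hne)
    (by rw [List.dropLast_append_getLast])).2.1

theorem exists_of_mem_hist (E : Env d K Obs) (φ : Policy K Obs) (u : Seed)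
    (ω : Fin E.T → Fin K → Obs) (t : ℕ) {e : Fin K × Obs} (he : e ∈ E.hist φ u ω t) :
    ∃ j, e.2 = ω j e.1 := by
  obtain ⟨l₁, l₂, h⟩ := List.append_of_mem he
  obtain ⟨-, -, ht, h'⟩ := E.hist_append φ u ω t (h := l₁) (e := e) (by rw [h]; simp)
  exact ⟨_, h'⟩

end Env

/-! ### Switches -/

theorem switches_cons_cons {K : ℕ} (a b : Fin K) (l : List (Fin K)) :
    switches (a :: b :: l) = switches (b :: l) + if a ≠ b then 1 else 0 := by
  simp [switches, List.countP_cons]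

theorem switches_take_le {K : ℕ} (l : List (Fin K)) (n : ℕ) : switches (l.take n) ≤ switches l := by
  induction l generalizing n with
  | nil => simp
  | cons a l ih =>
    cases n with
    | zero => simp [switches]
    | succ n =>
      cases l with
      | nil => simp
      | cons b l =>
        cases n with
        | zero => simp [switches]
        | succ n =>
          have := ih (n + 1)
          simp only [List.take_succ_cons] at this ⊢
          rw [switches_cons_cons, switches_cons_cons]
          omega

theorem switches_concat {K : ℕ} (l : List (Fin K)) (k : Fin K) :
    switches (l ++ [k]) = switches l + if l.getLast?.getD k ≠ k then 1 else 0 := by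
  induction l with
  | nil => simp [switches]
  | cons a l ih =>
    cases l with
    | nil => by_cases h : a = k <;> simp [switches, h]
    | cons b l =>
      simp only [List.cons_append] at ih ⊢
      rw [switches_cons_cons, ih, switches_cons_cons]
      simp [List.getLast?_cons_cons]
      omega

theorem switches_append_replicate_of_getLast {K : ℕ} (l : List (Fin K)) (k : Fin K) (m : ℕ)
    (h : l.getLast?.getD k = k) : switches (l ++ List.replicate m k) = switches l := by
  induction m with
  | zero => simp
  | succ m ih =>
    rw [List.replicate_succ', ← List.append_assoc, switches_concat, ih]
    cases m <;> simp [h, List.replicate_succ']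

theorem switches_append_replicate_le {K : ℕ} (l : List (Fin K)) (k : Fin K) (m : ℕ) :
    switches (l ++ List.replicate m k) ≤ switches l + if 0 < m then 1 else 0 := by
  cases m with
  | zero => simp
  | succ m =>
    rw [List.replicate_succ, List.append_cons, switches_append_replicate_of_getLast]
    · rw [switches_concat]
      split_ifs <;> simp_all
    · simp

theorem switches_append_block_le {K : ℕ} (order : List (Fin K)) (m : Fin K → ℕ) :
    ∀ l : List (Fin K),
      switches (l ++ block order m) ≤ switches l + order.countP fun k => decide (0 < m k) := by
  induction order with
  | nil => intro l; simp [block]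
  | cons k order ih =>
    intro l
    have h1 := ih (l ++ List.replicate (m k) k)
    have h2 := switches_append_replicate_le l k (m k)
    rw [List.countP_cons]
    simp only [block, List.flatMap_cons, List.append_assoc, decide_eq_true_eq] at h1 ⊢
    omega

/-- The first run of the block continues the arm that ended `l`, so only the other arms of the order
can cause a switch. For empty `l` the default value makes the hypothesis `hl` automatic. -/
theorem switches_append_block_of_head {K : ℕ} {order : List (Fin K)} {z : Fin K} (m : Fin K → ℕ)
    (l : List (Fin K)) (hz : order.head? = some z) (hl : l.getLast?.getD z = z) :
    switches (l ++ block order m) ≤ switches l + order.tail.countP fun k => decide (0 < m k) := by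
  cases order with
  | nil => simp at hz
  | cons a rest =>
    simp only [List.head?_cons, Option.some.injEq] at hz
    subst hz
    have h1 := switches_append_block_le rest m (l ++ List.replicate (m a) a)
    rw [switches_append_replicate_of_getLast _ _ _ hl] at h1
    simpa [block] using h1

theorem count_block {K : ℕ} {order : List (Fin K)} (h : order.Perm (List.finRange K))
    (m : Fin K → ℕ) (k : Fin K) : (block order m).count k = m k := by
  have h1 : (block order m).Perm (block (List.finRange K) m) := h.flatMap_right _
  rw [h1.count_eq, block, List.count_flatMap]
  simp only [Function.comp_def, List.count_replicate]
  rw [← Fin.sum_univ_def]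
  simp

theorem length_eq_sum_count {K : ℕ} (l : List (Fin K)) : l.length = ∑ k, l.count k := by
  induction l with
  | nil => simp
  | cons a l ih =>
    simp only [List.length_cons, List.count_cons, Finset.sum_add_distrib, ih]
    simp

/-! ### The plan of the algorithm -/

namespace Learner

variable {d K : ℕ} {Obs : Type} (A : Learner d K Obs) (C : Choices K Obs) (u : Seed)

theorem plan_prefix_succ (h : Hist K Obs) (l : ℕ) :
    (A.state C u h l).plan <+: (A.state C u h (l + 1)).plan := by
  rw [state]
  exact List.prefix_append _ _

theorem plan_prefix (h : Hist K Obs) {l l' : ℕ} (hl : l ≤ l') :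
    (A.state C u h l).plan <+: (A.state C u h l').plan := by
  induction hl with
  | refl => exact List.prefix_rfl
  | step _ ih => exact ih.trans (A.plan_prefix_succ C u h _)

theorem plan_prefix_fullPlan (h : Hist K Obs) {l : ℕ} (hl : l ≤ A.ν) :
    (A.state C u h l).plan <+: A.fullPlan C u h :=
  (A.plan_prefix C u h hl).trans (List.prefix_append _ _)

theorem take_eq_of_prefix {α : Type*} {h h' : List α} (hh : h <+: h') {n : ℕ} (hn : n ≤ h.length) :
    h'.take n = h.take n := by
  obtain ⟨r, rfl⟩ := hh
  rw [List.take_append_of_le_length hn]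

/-- The state after `l + 1` epochs reads only the observations up to the end of epoch `l`, so it is
settled one epoch ahead of the data. -/
theorem state_eq_of_prefix {h h' : Hist K Obs} (hh : h <+: h') (l : ℕ)
    (hl : (A.state C u h l).plan.length ≤ h.length) :
    A.state C u h' l = A.state C u h l ∧ A.state C u h' (l + 1) = A.state C u h (l + 1) := by
  induction l with
  | zero => simp [state]
  | succ l ih =>
    have h1 := (ih (((A.plan_prefix_succ C u h l).length_le).trans hl)).2
    refine ⟨h1, ?_⟩
    rw [state, h1, take_eq_of_prefix hh hl]
    rfl

/-- Non-anticipation. On a short history, `fullPlan` fills later epochs from incomplete data and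
these entries mean nothing; but the entry at position `h.length` lies in an epoch whose data are all
contained in `h`. -/
theorem getElem?_fullPlan_of_prefix {h h' : Hist K Obs} (hh : h <+: h') :
    (A.fullPlan C u h')[h.length]? = (A.fullPlan C u h)[h.length]? := by
  by_cases hν : (A.state C u h A.ν).plan.length ≤ h.length
  · have h1 := (A.state_eq_of_prefix C u hh _ hν).1
    rw [fullPlan, fullPlan, h1]
    simp only [take_eq_of_prefix hh hν]
  · push Not at hν
    obtain ⟨l, hl, h1, h2⟩ : ∃ l < A.ν, (A.state C u h l).plan.length ≤ h.length ∧
        h.length < (A.state C u h (l + 1)).plan.length := by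
      generalize A.ν = N at hν
      induction N with
      | zero => simp [state] at hν
      | succ N ih =>
        by_cases h3 : h.length < (A.state C u h N).plan.length
        · obtain ⟨l, hl, h4⟩ := ih h3
          exact ⟨l, by omega, h4⟩
        · exact ⟨N, by omega, by omega, hν⟩
    have h3 := (A.state_eq_of_prefix C u hh _ h1).2
    obtain ⟨r, hr⟩ := A.plan_prefix_fullPlan C u h (l := l + 1) hl
    obtain ⟨r', hr'⟩ := A.plan_prefix_fullPlan C u h' (l := l + 1) hl
    rw [← hr, ← hr', h3, List.getElem?_append_left h2, List.getElem?_append_left h2]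

/-- Thanks to non-anticipation, the decisions taken along the way can all be read off the one plan
computed from the final history. The later analysis deals with that plan only. -/
theorem map_fst_hist [MeasurableSpace Obs] (E : Env d K Obs) (φ : Policy K Obs)
    (hφ : ∀ u h, φ.act u h = (A.fullPlan C u h)[h.length]?) (ω : Fin E.T → Fin K → Obs) (t : ℕ) :
    (E.hist φ u ω t).map Prod.fst =
      (A.fullPlan C u (E.hist φ u ω t)).take (E.hist φ u ω t).length := by
  set H := E.hist φ u ω t with hH
  apply List.ext_getElem?
  intro i
  by_cases hi : i < H.length
  · have h1 := E.hist_append φ u ω t (h := H.take i) (e := H[i])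
      (by rw [List.take_append_getElem]; exact List.take_prefix _ _)
    have h2 := h1.1
    rw [hφ, ← A.getElem?_fullPlan_of_prefix C u (List.take_prefix i H)] at h2
    simp only [List.length_take, min_eq_left hi.le] at h2
    rw [List.getElem?_take_of_lt hi, h2]
    simp [hi]
  · push Not at hi
    rw [List.getElem?_eq_none (by simpa using hi),
      List.getElem?_eq_none ((List.length_take_le _ _).trans hi)]

theorem getLast_lastAction (p : List (Fin K)) :
    p.getLast?.getD (lastAction C u p) = lastAction C u p := by
  rw [lastAction]
  cases p.getLast? <;> rfl

theorem countP_tail_le (hC : A.Valid C) (l : ℕ) (h : Hist K Obs) (z : Fin K) (m : Fin K → ℕ) :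
    ((C.order u l h z).tail.countP fun k => decide (0 < m k)) ≤ K - 1 := by
  refine List.countP_le_length.trans ?_
  rw [List.length_tail, (hC.order_perm u l h z).length_eq, List.length_finRange]

theorem switches_plan_le (hC : A.Valid C) (h : Hist K Obs) (l : ℕ) :
    switches (A.state C u h l).plan ≤ l * (K - 1) := by
  induction l with
  | zero => simp [state, switches]
  | succ l ih =>
    rw [state]
    refine (switches_append_block_of_head _ _ (hC.order_head _ _ _ _)
      (getLast_lastAction C u _)).trans ?_
    have := A.countP_tail_le C u hC (l + 1) (h.take (A.state C u h l).plan.length)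
      (lastAction C u (A.state C u h l).plan)
      (A.exploreCount l (C.explore u (l + 1) (h.take (A.state C u h l).plan.length)))
    rw [Nat.succ_mul]
    omega

/-- An arm outside the support of the last solution is planned `⌊0⌋ = 0` times, so the last epoch
adds at most one switch per nonzero component. -/
theorem switches_fullPlan_le_add (hC : A.Valid C) (h : Hist K Obs) :
    switches (A.fullPlan C u h) ≤ A.ν * (K - 1) +
      l0norm (C.final u (h.take (A.state C u h A.ν).plan.length)) := by
  rw [fullPlan]
  refine (switches_append_block_of_head _ _ (hC.order_head _ _ _ _)
    (getLast_lastAction C u _)).trans (add_le_add (A.switches_plan_le C u hC h _) ?_)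
  set data := h.take (A.state C u h A.ν).plan.length
  have hp := hC.order_perm u (A.ν + 1) data (lastAction C u (A.state C u h A.ν).plan)
  refine (List.Sublist.countP_le (List.tail_sublist _)).trans ?_
  rw [hp.countP_eq, l0norm_eq_card, ← Multiset.coe_countP, Multiset.countP_eq_card_filter]
  refine Finset.card_le_card (s := ⟨Multiset.filter (fun k => 0 < A.finalCount (C.final u data) k)
    (List.finRange K : Multiset (Fin K)), ?_⟩) ?_ |>.trans_eq' ?_
  · exact (Multiset.coe_nodup.2 (List.nodup_finRange K)).filter _
  · intro k hk
    simp only [Finset.mem_mk, Multiset.mem_filter] at hk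
    simp only [Finset.mem_filter, Finset.mem_univ, true_and]
    intro h0
    have := hk.2
    simp [finalCount, h0] at this
  · simp [Finset.card]

theorem switches_fullPlan_le (hC : A.Valid C) (hest : ∀ k, A.estRew [] k = 0) (hd : d + 1 < K)
    (hB : ∀ i, 0 ≤ A.B i) (h : Hist K Obs) : switches (A.fullPlan C u h) ≤ A.s := by
  have hK : (0 : ℝ) < (K : ℝ) - 1 := by
    have : (1 : ℝ) < K := by exact_mod_cast (by omega : 1 < K)
    linarith
  refine (A.switches_fullPlan_le_add C u hC h).trans ?_
  have hs := A.l0norm_le_of_isSparseFinalOpt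
    (hC.final_opt u (h.take (A.state C u h A.ν).plan.length))
  by_cases hsd : d + 1 ≤ A.s
  · have hν : (A.ν : ℝ) ≤ ((A.s : ℝ) - d - 1) / ((K : ℝ) - 1) := by
      refine Nat.floor_le (div_nonneg ?_ hK.le)
      have : ((d + 1 : ℕ) : ℝ) ≤ A.s := by exact_mod_cast hsd
      push_cast at this
      linarith
    rw [le_div_iff₀ hK] at hν
    have h2 : ((A.ν * (K - 1) + (d + 1) : ℕ) : ℝ) ≤ A.s := by
      push_cast [Nat.cast_sub (by omega : 1 ≤ K)]
      linarith
    have h3 : A.ν * (K - 1) + (d + 1) ≤ A.s := by exact_mod_cast h2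
    omega
  -- With `s < d + 1` there is no exploration and all empirical rewards are `0`. Then the zero
  -- vector is optimal, so the sparsest solution is zero and nothing is played.
  · have hν : A.ν = 0 := by
      rw [ν, nu, Nat.floor_eq_zero]
      refine lt_of_le_of_lt (div_nonpos_of_nonpos_of_nonneg ?_ hK.le) zero_lt_one
      have : (A.s : ℝ) ≤ ((d + 1 : ℕ) : ℝ) := by exact_mod_cast (by omega)
      push_cast at this
      linarith
    rw [hν]
    have h0 := (hC.final_opt u []).2 0 ⟨⟨fun k => le_rfl, by simp, fun i => by simpa using hB i⟩,
      fun y _ => by simp [hest]⟩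
    have h1 : l0norm (0 : Fin K → ℝ) = 0 := by simp [l0norm]
    simp only [state, List.length_nil, List.take_zero]
    omega

end Learner

end LimitedSwitch

end

noncomputable section

namespace LimitedSwitch

open scoped ENNReal

/-! ### Measurability of functions of the history -/

theorem measurable_of_countable_cases {ι Y β : Type*} [Countable ι] [MeasurableSpace Y]
    [MeasurableSpace β] {a : Y → ι} (ha : ∀ o, MeasurableSet (a ⁻¹' {o})) {G : ι → Y → β}
    (hG : ∀ o, Measurable (G o)) : Measurable fun y => G (a y) y := by
  intro s hs
  have : (fun y => G (a y) y) ⁻¹' s = ⋃ o, a ⁻¹' {o} ∩ G o ⁻¹' s := by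
    ext y; simp
  rw [this]
  exact MeasurableSet.iUnion fun o => (ha o).inter (hG o hs)

theorem measurable_list_sum_ofFn {α : Type*} [MeasurableSpace α] {f : α → ℝ}
    (hf : Measurable f) (t : ℕ) :
    Measurable fun p : Fin t → α => ((List.ofFn p).map f).sum := by
  simp only [List.map_ofFn, List.sum_ofFn]
  exact Finset.measurable_sum _ fun i _ => hf.comp (measurable_pi_apply i)

theorem measurable_uncurry_fin {K : ℕ} {Obs β : Type*} [MeasurableSpace Obs] [MeasurableSpace β]
    {f : Fin K → Obs → β} (hf : ∀ k, Measurable (f k)) :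
    Measurable fun e : Fin K × Obs => f e.1 e.2 :=
  measurable_of_countable_cases (a := Prod.fst) (G := fun k (e : Fin K × Obs) => f k e.2)
    (fun k => measurable_fst (measurableSet_singleton k)) fun k => (hf k).comp measurable_snd

theorem measurable_foldl_take_ofFn {α σ : Type*} [MeasurableSpace α] [MeasurableSpace σ]
    {g : σ → α → σ} (hg : Measurable fun p : σ × α => g p.1 p.2) (s : σ) (t i : ℕ) :
    Measurable fun p : Fin t → α => ((List.ofFn p).take i).foldl g s := by
  induction i with
  | zero => simp
  | succ i ih =>
    by_cases hi : i < t
    · have : (fun p : Fin t → α => ((List.ofFn p).take (i + 1)).foldl g s) =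
          fun p => g (((List.ofFn p).take i).foldl g s) (p ⟨i, hi⟩) := by
        funext p
        rw [List.take_add_one, List.getElem?_ofFn]
        simp [hi]
      rw [this]
      exact hg.comp (ih.prodMk (measurable_pi_apply _))
    · have : (fun p : Fin t → α => ((List.ofFn p).take (i + 1)).foldl g s) =
          fun p => ((List.ofFn p).take i).foldl g s := by
        funext p
        rw [List.take_of_length_le (by simp; omega), List.take_of_length_le (by simp; omega)]
      rw [this]
      exact ih

/-- Measurability of a function of a point and a history. -/
def MeasurableHist {K : ℕ} {Obs : Type} [MeasurableSpace Obs] {X β : Type*} [MeasurableSpace X]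
    [MeasurableSpace β] (F : X → Hist K Obs → β) : Prop :=
  ∀ t, Measurable fun p : X × (Fin t → Fin K × Obs) => F p.1 (List.ofFn p.2)

theorem MeasurableHist.const {K : ℕ} {Obs : Type} [MeasurableSpace Obs] {X β : Type*}
    [MeasurableSpace X] [MeasurableSpace β] {F : Hist K Obs → β}
    (hF : ∀ t, Measurable fun p : Fin t → Fin K × Obs => F (List.ofFn p)) :
    MeasurableHist fun _ : X => F :=
  fun t => (hF t).comp measurable_snd

theorem ofFn_snoc {α : Type*} {t : ℕ} (p : Fin t → α) (a : α) :
    List.ofFn (Fin.snoc p a : Fin (t + 1) → α) = List.ofFn p ++ [a] := by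
  rw [List.ofFn_succ', List.concat_eq_append]
  simp

theorem measurable_snoc {α X : Type*} [MeasurableSpace α] [MeasurableSpace X] {t : ℕ}
    {f : X → Fin t → α} {g : X → α} (hf : Measurable f) (hg : Measurable g) :
    Measurable fun x => (Fin.snoc (f x) (g x) : Fin (t + 1) → α) := by
  rw [measurable_pi_iff]
  intro i
  refine Fin.lastCases ?_ (fun i => ?_) i
  · simpa using hg
  · simpa [Function.comp_def] using (measurable_pi_apply i).comp hf

theorem MeasurableHist.append {K : ℕ} {Obs : Type} [MeasurableSpace Obs] {X β : Type*}
    [MeasurableSpace X] [MeasurableSpace β] {F : X → Hist K Obs → β} (hF : MeasurableHist F)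
    {g : X → Fin K × Obs} (hg : Measurable g) : MeasurableHist fun x h => F x (h ++ [g x]) := by
  intro t
  simp only [← ofFn_snoc]
  exact (hF (t + 1)).comp
    (measurable_fst.prodMk (measurable_snoc measurable_snd (hg.comp measurable_fst)))

namespace Env

variable {d K : ℕ} {Obs : Type} [MeasurableSpace Obs] (E : Env d K Obs)

theorem measurableSet_withinBudget (hE : ∀ i k, Measurable (E.cost i k)) (t : ℕ) :
    MeasurableSet {p : Fin t → Fin K × Obs | E.WithinBudget (List.ofFn p)} := by
  have : {p : Fin t → Fin K × Obs | E.WithinBudget (List.ofFn p)} =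
      ⋂ i, {p | ((List.ofFn p).map fun e => E.cost i e.1 e.2).sum ≤ E.B i} := by
    ext p; simp [WithinBudget]
  rw [this]
  exact MeasurableSet.iInter fun i => measurableSet_le
    (measurable_list_sum_ofFn (measurable_uncurry_fin (hE i)) t) measurable_const

theorem measurableSet_act (φ : Policy K Obs) (t : ℕ) (o : Option (Fin K)) :
    MeasurableSet {p : Seed × (Fin t → Fin K × Obs) | φ.act p.1 (List.ofFn p.2) = o} := by
  cases o with
  | some k => exact φ.measurable_act t k
  | none =>
    have : {p : Seed × (Fin t → Fin K × Obs) | φ.act p.1 (List.ofFn p.2) = none} =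
        (⋃ k, {p | φ.act p.1 (List.ofFn p.2) = some k})ᶜ := by
      ext p
      simp [Option.eq_none_iff_forall_ne_some]
    rw [this]
    exact (MeasurableSet.iUnion fun k => φ.measurable_act t k).compl

open Classical in
/-- The value of `F` after one more period that starts with the history `h`, if the arm `k` is then
evaluated by `G k h`. -/
def stepVal {β : Type*} (φ : Policy K Obs) (t : ℕ) (F : Hist K Obs → β)
    (G : Fin K → Hist K Obs → β) (u : Seed) (h : Hist K Obs) : β :=
  if h.length = t ∧ E.WithinBudget h then
    match φ.act u h with
    | some k => G k h
    | none => F h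
  else F h

theorem measurableHist_stepVal (hE : ∀ i k, Measurable (E.cost i k)) (φ : Policy K Obs) (t : ℕ)
    {X β : Type*} [MeasurableSpace X] [MeasurableSpace β] {F : X → Hist K Obs → β}
    {G : X → Fin K → Hist K Obs → β} (hF : MeasurableHist F)
    (hG : ∀ k, MeasurableHist fun x => G x k) {u : X → Seed} (hu : Measurable u) :
    MeasurableHist fun x => E.stepVal φ t (F x) (G x) (u x) := by
  intro j
  by_cases hj : j = t
  · subst hj
    simp only [stepVal, List.length_ofFn, true_and]
    refine Measurable.ite ?_ ?_ (hF j)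
    · simpa [Set.preimage] using measurable_snd (α := X) (E.measurableSet_withinBudget hE j)
    · refine measurable_of_countable_cases
        (a := fun p : X × (Fin j → Fin K × Obs) => φ.act (u p.1) (List.ofFn p.2))
        (G := fun o p => match o with
          | some k => G p.1 k (List.ofFn p.2)
          | none => F p.1 (List.ofFn p.2)) ?_ ?_
      · intro o
        exact ((hu.comp measurable_fst).prodMk measurable_snd) (measurableSet_act φ j o)
      · intro o
        cases o with
        | some k => exact hG k j
        | none => exact hF j
  · simp only [stepVal, List.length_ofFn, hj, false_and, if_false]
    exact hF j

theorem apply_hist_succ (φ : Policy K Obs) {t : ℕ} (ht : t < E.T) {β : Type*}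
    (F : Hist K Obs → β) (u : Seed) (ω : Fin E.T → Fin K → Obs) :
    F (E.hist φ u ω (t + 1)) =
      E.stepVal φ t F (fun k h => F (h ++ [(k, ω ⟨t, ht⟩ k)])) u (E.hist φ u ω t) := by
  rw [hist, stepVal, dif_pos ht]
  split_ifs
  · cases φ.act u (E.hist φ u ω t) <;> rfl
  · rfl

/-- Histories are lists of varying length, so measurability is expressed through functionals that
are measurable on each fixed length. `F` may depend on the whole sample point because the induction
peels off the last period and moves its outcome into `F`. -/
theorem measurable_hist (hE : ∀ i k, Measurable (E.cost i k)) (φ : Policy K Obs) {β : Type*}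
    [MeasurableSpace β] (t : ℕ) :
    ∀ {F : Seed × (Fin E.T → Fin K → Obs) → Hist K Obs → β}, MeasurableHist F →
      Measurable fun x => F x (E.hist φ x.1 x.2 t) := by
  induction t with
  | zero =>
    intro F hF
    simp only [hist]
    have := (hF 0).comp (measurable_id.prodMk (measurable_const (a := Fin.elim0)))
    simpa [Function.comp_def] using this
  | succ t ih =>
    intro F hF
    by_cases ht : t < E.T
    · simp only [E.apply_hist_succ φ ht]
      refine ih (F := fun x => E.stepVal φ t (F x) (fun k h => F x (h ++ [(k, x.2 ⟨t, ht⟩ k)])) x.1)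
        (E.measurableHist_stepVal hE φ t hF (fun k => ?_) measurable_fst)
      exact hF.append (by fun_prop)
    · have : ∀ x : Seed × (Fin E.T → Fin K → Obs),
          E.hist φ x.1 x.2 (t + 1) = E.hist φ x.1 x.2 t := by
        intro x
        rw [hist, dif_neg ht]
      simp only [this]
      exact ih hF

theorem hist_update (φ : Policy K Obs) (u : Seed) (ω : Fin E.T → Fin K → Obs) (j : Fin E.T)
    (y : Fin K → Obs) (t : ℕ) (ht : t ≤ j) :
    E.hist φ u (Function.update ω j y) t = E.hist φ u ω t := by
  induction t with
  | zero => rfl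
  | succ t ih =>
    have hne : (⟨t, by omega⟩ : Fin E.T) ≠ j := by
      intro h
      have := congrArg Fin.val h
      simp at this; omega
    have htT : t < E.T := by omega
    have h1 := E.apply_hist_succ φ htT id u (Function.update ω j y)
    have h2 := E.apply_hist_succ φ htT id u ω
    simp only [id] at h1 h2
    rw [h1, h2, ih (by omega)]
    simp [Function.update_of_ne hne]

end Env

/-! ### The law of the process -/

/-- Resampling one coordinate of an i.i.d. family does not change its law. Together with
`hist_update` this replaces conditioning on the past. -/
theorem measurePreserving_update {ι α : Type*} [Fintype ι] [DecidableEq ι] [MeasurableSpace α]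
    (μ : Measure α) [IsProbabilityMeasure μ] (j : ι) :
    MeasurePreserving (fun p : (ι → α) × α => Function.update p.1 j p.2)
      ((Measure.pi fun _ => μ).prod μ) (Measure.pi fun _ => μ) := by
  have hm : Measurable fun p : (ι → α) × α => Function.update p.1 j p.2 := by
    rw [measurable_pi_iff]
    intro i
    by_cases h : i = j
    · subst h; simpa using measurable_snd
    · simp only [Function.update_of_ne h]
      fun_prop
  refine ⟨hm, (Measure.pi_eq fun s hs => ?_).symm⟩
  rw [Measure.map_apply hm (MeasurableSet.univ_pi hs)]
  have : (fun p : (ι → α) × α => Function.update p.1 j p.2) ⁻¹' Set.univ.pi s =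
      (Set.univ.pi (Function.update s j Set.univ)) ×ˢ s j := by
    ext p
    simp only [Set.mem_preimage, Set.mem_pi, Set.mem_univ, true_imp_iff, Set.mem_prod]
    constructor
    · intro h
      refine ⟨fun i => ?_, by simpa using h j⟩
      by_cases hi : i = j
      · subst hi; simp
      · simpa [hi] using h i
    · rintro ⟨h1, h2⟩ i
      by_cases hi : i = j
      · subst hi; simpa using h2
      · simpa [hi] using h1 i
  rw [this, Measure.prod_prod, Measure.pi_pi]
  have h2 : ∀ i, μ (Function.update s j Set.univ i) = Function.update (fun i => μ (s i)) j 1 i := by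
    intro i
    by_cases hi : i = j
    · subst hi; simp
    · simp [hi]
  simp only [h2]
  rw [Finset.prod_update_of_mem (Finset.mem_univ j), one_mul, ← Finset.erase_eq,
    Finset.prod_erase_mul _ _ (Finset.mem_univ j)]

namespace Env

variable {d K : ℕ} {Obs : Type} [MeasurableSpace Obs] (E : Env d K Obs)
  (D : Fin K → Measure Obs) [∀ k, IsProbabilityMeasure (D k)]

instance : IsProbabilityMeasure (E.law D) := by
  unfold law; infer_instance

/-- The expectation of a function of the history can be computed by averaging over the outcome of
the last period first. -/
theorem lintegral_hist_succ (hE : ∀ i k, Measurable (E.cost i k)) (φ : Policy K Obs) {t : ℕ}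
    (ht : t < E.T) {F : Hist K Obs → ℝ≥0∞}
    (hF : ∀ t, Measurable fun p : Fin t → Fin K × Obs => F (List.ofFn p)) :
    ∫⁻ x, F (E.hist φ x.1 x.2 (t + 1)) ∂E.law D =
      ∫⁻ x, E.stepVal φ t F (fun k h => ∫⁻ o, F (h ++ [(k, o)]) ∂D k) x.1
        (E.hist φ x.1 x.2 t) ∂E.law D := by
  have hm1 := E.measurable_hist hE φ (t + 1) (MeasurableHist.const hF)
  have hF1 : ∀ h k, Measurable fun o => F (h ++ [(k, o)]) := by
    intro h k
    have := (MeasurableHist.const (X := Obs) hF).append (g := fun o => (k, o)) (by fun_prop)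
      h.length
    have := this.comp (measurable_id.prodMk (measurable_const (a := h.get)))
    simpa [Function.comp_def] using this
  have hF2 : ∀ k, MeasurableHist (X := Seed × (Fin E.T → Fin K → Obs))
      fun _ h => ∫⁻ o, F (h ++ [(k, o)]) ∂D k := by
    intro k
    refine MeasurableHist.const fun j => ?_
    refine Measurable.lintegral_prod_right' (f := fun p : (Fin j → Fin K × Obs) × Obs =>
      F (List.ofFn p.1 ++ [(k, p.2)])) ?_
    have := (MeasurableHist.const (X := Obs) hF).append (g := fun o => (k, o)) (by fun_prop) j
    exact this.comp measurable_swap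
  have hm2 := E.measurable_hist hE φ t (E.measurableHist_stepVal hE φ t
    (MeasurableHist.const hF) hF2 measurable_fst)
  rw [law, lintegral_prod _ hm1.aemeasurable, lintegral_prod _ hm2.aemeasurable]
  refine lintegral_congr fun u => ?_
  have hm3 : Measurable fun ω => F (E.hist φ u ω (t + 1)) := hm1.comp measurable_prodMk_left
  dsimp only
  have hmp := measurePreserving_update (Measure.pi D) (⟨t, ht⟩ : Fin E.T)
  have hm4 : AEMeasurable (fun p : (Fin E.T → Fin K → Obs) × (Fin K → Obs) =>
      F (E.hist φ u (Function.update p.1 ⟨t, ht⟩ p.2) (t + 1)))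
      ((Measure.pi fun _ => Measure.pi D).prod (Measure.pi D)) :=
    (hm3.comp hmp.measurable).aemeasurable
  rw [← hmp.lintegral_comp hm3, lintegral_prod _ hm4]
  refine lintegral_congr fun ω => ?_
  have hupd : ∀ y, F (E.hist φ u (Function.update ω ⟨t, ht⟩ y) (t + 1)) =
      E.stepVal φ t F (fun k h => F (h ++ [(k, y k)])) u (E.hist φ u ω t) := by
    intro y
    rw [E.apply_hist_succ φ ht F, E.hist_update φ u ω ⟨t, ht⟩ _ t le_rfl]
    simp only [Function.update_self]
  simp only [hupd, stepVal]
  split_ifs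
  · cases φ.act u (E.hist φ u ω t) with
    | none => simp
    | some k =>
      exact (measurePreserving_eval D k).lintegral_comp (hF1 _ k)
  · simp

/-- A supermartingale inequality that holds for each fixed history and arm survives an adaptive and
randomized choice of the arm; periods after the end leave `F` unchanged. -/
theorem lintegral_hist_le (hE : ∀ i k, Measurable (E.cost i k)) (φ : Policy K Obs) {t : ℕ}
    (ht : t ≤ E.T) {F : Hist K Obs → ℝ≥0∞}
    (hF : ∀ t, Measurable fun p : Fin t → Fin K × Obs => F (List.ofFn p))
    (hstep : ∀ h k, ∫⁻ o, F (h ++ [(k, o)]) ∂D k ≤ F h) :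
    ∫⁻ x, F (E.hist φ x.1 x.2 t) ∂E.law D ≤ F [] := by
  induction t with
  | zero => simp [hist]
  | succ t ih =>
    rw [E.lintegral_hist_succ D hE φ ht hF]
    refine (lintegral_mono fun x => ?_).trans (ih (by omega))
    rw [stepVal]
    split_ifs
    · cases φ.act x.1 (E.hist φ x.1 x.2 t) with
      | none => exact le_rfl
      | some k => exact hstep _ k
    · exact le_rfl

theorem measurable_ennreal_sum {f : Fin K → Obs → ℝ≥0∞} (hf : ∀ k, Measurable (f k)) (t : ℕ) :
    Measurable fun p : Fin t → Fin K × Obs => ((List.ofFn p).map fun e => f e.1 e.2).sum := by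
  simp only [List.map_ofFn, List.sum_ofFn]
  exact Finset.measurable_sum _ fun i _ =>
    (measurable_uncurry_fin hf).comp (measurable_pi_apply i)

/-- Wald's identity. -/
theorem lintegral_sum_hist (hE : ∀ i k, Measurable (E.cost i k)) (φ : Policy K Obs) {t : ℕ}
    (ht : t ≤ E.T) {f : Fin K → Obs → ℝ≥0∞} (hf : ∀ k, Measurable (f k)) :
    ∫⁻ x, ((E.hist φ x.1 x.2 t).map fun e => f e.1 e.2).sum ∂E.law D =
      ∫⁻ x, ((E.hist φ x.1 x.2 t).map fun e => ∫⁻ o, f e.1 o ∂D e.1).sum ∂E.law D := by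
  -- The increment contributed by period `t` involves `g` only through its mean under `D k`, so `f`
  -- and its mean function have equal increments.
  have key : ∀ g : Fin K → Obs → ℝ≥0∞, (∀ k, Measurable (g k)) → ∀ t < E.T,
      ∫⁻ x, ((E.hist φ x.1 x.2 (t + 1)).map fun e => g e.1 e.2).sum ∂E.law D =
      ∫⁻ x, ((E.hist φ x.1 x.2 t).map fun e => g e.1 e.2).sum ∂E.law D +
      ∫⁻ x, E.stepVal φ t (fun _ => 0) (fun k _ => ∫⁻ o, g k o ∂D k) x.1
        (E.hist φ x.1 x.2 t) ∂E.law D := by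
    intro g hg t ht
    have hm := E.measurable_hist hE φ t (MeasurableHist.const
      (F := fun h => (h.map fun e => g e.1 e.2).sum) (measurable_ennreal_sum hg))
    rw [E.lintegral_hist_succ D hE φ ht (F := fun h => (h.map fun e => g e.1 e.2).sum)
      (measurable_ennreal_sum hg), ← lintegral_add_left hm]
    refine lintegral_congr fun x => ?_
    simp only [stepVal]
    split_ifs
    · cases φ.act x.1 (E.hist φ x.1 x.2 t) with
      | none => simp
      | some k =>
        simp only [List.map_append, List.map_cons, List.map_nil, List.sum_append, List.sum_cons,
          List.sum_nil, add_zero]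
        rw [lintegral_add_left measurable_const]
        simp
    · simp
  induction t with
  | zero => simp [hist]
  | succ t ih =>
    rw [key f hf t ht, key (fun k _ => ∫⁻ o, f k o ∂D k) (fun k => measurable_const) t ht,
      ih (by omega)]
    simp

end Env

/-! ### Exponential supermartingales and concentration -/

section Bet

variable {K : ℕ} {Obs : Type}

/-- One step of the logarithm of the exponential supermartingale that bets `lam i` on the
observation of `Y` in the `i`-th pull of arm `k`. -/
def betStep (k : Fin K) (lam : ℕ → ℝ) (Y : Obs → ℝ) (s : ℕ × ℝ) (e : Fin K × Obs) : ℕ × ℝ :=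
  if e.1 = k then (s.1 + 1, s.2 + (lam s.1 * Y e.2 - lam s.1 ^ 2 / 8)) else s

/-- The logarithm of the exponential supermartingale. -/
def bet (k : Fin K) (lam : ℕ → ℝ) (Y : Obs → ℝ) (h : Hist K Obs) : ℝ :=
  (h.foldl (betStep k lam Y) (0, 0)).2

theorem measurable_betStep [MeasurableSpace Obs] (k : Fin K) (lam : ℕ → ℝ) {Y : Obs → ℝ}
    (hY : Measurable Y) :
    Measurable fun p : (ℕ × ℝ) × (Fin K × Obs) => betStep k lam Y p.1 p.2 := by
  unfold betStep
  refine Measurable.ite ?_ ?_ measurable_fst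
  · exact (measurable_fst.comp measurable_snd) (measurableSet_singleton k)
  · have : Measurable lam := measurable_of_countable _
    fun_prop

theorem measurable_bet_take [MeasurableSpace Obs] (k : Fin K) (lam : ℕ → ℝ) {Y : Obs → ℝ}
    (hY : Measurable Y) (t i : ℕ) :
    Measurable fun p : Fin t → Fin K × Obs => bet k lam Y ((List.ofFn p).take i) :=
  measurable_snd.comp (measurable_foldl_take_ofFn (measurable_betStep k lam hY) _ t i)

/-- Some prefix of the history has a bet of at least `c`. -/
def BetReaches (k : Fin K) (lam : ℕ → ℝ) (Y : Obs → ℝ) (c : ℝ) (h : Hist K Obs) : Prop :=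
  ∃ i ≤ h.length, c ≤ bet k lam Y (h.take i)

theorem measurableSet_betReaches [MeasurableSpace Obs] (k : Fin K) (lam : ℕ → ℝ) {Y : Obs → ℝ}
    (hY : Measurable Y) (c : ℝ) (t : ℕ) :
    MeasurableSet {p : Fin t → Fin K × Obs | BetReaches k lam Y c (List.ofFn p)} := by
  have : {p : Fin t → Fin K × Obs | BetReaches k lam Y c (List.ofFn p)} =
      ⋃ i ∈ Set.Iic t, {p | c ≤ bet k lam Y ((List.ofFn p).take i)} := by
    ext p; simp [BetReaches]
  rw [this]
  exact MeasurableSet.biUnion (Set.to_countable _) fun i _ =>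
    measurableSet_le measurable_const (measurable_bet_take k lam hY t i)

end Bet

namespace Env

variable {d K : ℕ} {Obs : Type} [MeasurableSpace Obs] (E : Env d K Obs)
  (D : Fin K → Measure Obs) [∀ k, IsProbabilityMeasure (D k)]

theorem measurableSet_hist_betReaches (hE : ∀ i k, Measurable (E.cost i k)) (φ : Policy K Obs)
    (k : Fin K) (lam : ℕ → ℝ) {Y : Obs → ℝ} (hY : Measurable Y) (c : ℝ) :
    MeasurableSet {x : Seed × (Fin E.T → Fin K → Obs) |
      BetReaches k lam Y c (E.hist φ x.1 x.2 E.T)} := by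
  have := E.measurable_hist hE φ E.T (β := Prop) (F := fun _ => BetReaches k lam Y c)
    (MeasurableHist.const fun t => measurableSet_setOfPred.1 (measurableSet_betReaches k lam hY c t))
  exact measurableSet_setOfPred.2 this

/-- Ville's inequality. -/
theorem law_betReaches_le (hE : ∀ i k, Measurable (E.cost i k)) (φ : Policy K Obs)
    (k : Fin K) (lam : ℕ → ℝ) {Y : Obs → ℝ} (hY : Measurable Y)
    (hmgf : ∀ a : ℝ, ∫⁻ o, ENNReal.ofReal (Real.exp (a * Y o)) ∂D k ≤
      ENNReal.ofReal (Real.exp (a ^ 2 / 8))) {c : ℝ} (hc : 0 < c) :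
    E.law D {x | BetReaches k lam Y c (E.hist φ x.1 x.2 E.T)} ≤
      ENNReal.ofReal (Real.exp (-c)) := by
  classical
  -- The exponential of the bet, frozen at `exp c` as soon as a prefix reaches `c`. Freezing can
  -- only lower it, so it remains a supermartingale, and Markov's inequality for its final value
  -- controls all prefixes at once.
  let F : Hist K Obs → ℝ≥0∞ := fun h => if BetReaches k lam Y c h then ENNReal.ofReal (Real.exp c)
    else ENNReal.ofReal (Real.exp (bet k lam Y h))
  have hbet0 : ∀ t, Measurable fun p : Fin t → Fin K × Obs => bet k lam Y (List.ofFn p) := by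
    intro t
    have := measurable_bet_take k lam hY t t
    simpa [List.take_of_length_le] using this
  have hF : ∀ t, Measurable fun p : Fin t → Fin K × Obs => F (List.ofFn p) := by
    intro t
    exact Measurable.ite (measurableSet_betReaches k lam hY c t) measurable_const
      (Real.measurable_exp.comp (hbet0 t)).ennreal_ofReal
  have hstep : ∀ h k', ∫⁻ o, F (h ++ [(k', o)]) ∂D k' ≤ F h := by
    intro h k'
    by_cases hr : BetReaches k lam Y c h
    · have : ∀ o, F (h ++ [(k', o)]) ≤ F h := by
        intro o
        obtain ⟨i, hi, hci⟩ := hr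
        have h2 : BetReaches k lam Y c (h ++ [(k', o)]) := by
          refine ⟨i, by simp; omega, ?_⟩
          rwa [List.take_append_of_le_length hi]
        have h3 : BetReaches k lam Y c h := ⟨i, hi, hci⟩
        simp only [F, h2, h3, if_true, le_refl]
      refine (lintegral_mono this).trans ?_
      simp
    · have h1 : ∀ o, F (h ++ [(k', o)]) ≤
          ENNReal.ofReal (Real.exp (bet k lam Y (h ++ [(k', o)]))) := by
        intro o
        simp only [F]
        split_ifs with h2
        · obtain ⟨i, hi, hci⟩ := h2
          have : ¬ i ≤ h.length := by
            intro hle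
            rw [List.take_append_of_le_length hle] at hci
            exact hr ⟨i, hle, hci⟩
          rw [List.take_of_length_le (by simp; omega)] at hci
          exact ENNReal.ofReal_le_ofReal (Real.exp_le_exp.2 hci)
        · exact le_rfl
      refine (lintegral_mono h1).trans ?_
      simp only [F, hr, if_false]
      by_cases hk : k' = k
      · subst hk
        set a := lam (h.foldl (betStep k' lam Y) (0, 0)).1 with ha
        have h2 : ∀ o, ENNReal.ofReal (Real.exp (bet k' lam Y (h ++ [(k', o)]))) =
            ENNReal.ofReal (Real.exp (bet k' lam Y h - a ^ 2 / 8)) *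
              ENNReal.ofReal (Real.exp (a * Y o)) := by
          intro o
          rw [← ENNReal.ofReal_mul (Real.exp_nonneg _), ← Real.exp_add]
          congr 2
          simp only [bet, List.foldl_append, List.foldl_cons, List.foldl_nil, betStep, if_true]
          ring
        simp only [h2]
        rw [lintegral_const_mul _ (by fun_prop)]
        refine (mul_le_mul_right (hmgf a) _).trans ?_
        rw [← ENNReal.ofReal_mul (Real.exp_nonneg _), ← Real.exp_add]
        simp
      · have h2 : ∀ o, bet k lam Y (h ++ [(k', o)]) = bet k lam Y h := by
          intro o
          simp [bet, betStep, hk]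
        simp [h2]
  have hle := E.lintegral_hist_le D hE φ le_rfl hF hstep
  have h0 : F [] = 1 := by
    have : ¬ BetReaches k lam Y c ([] : Hist K Obs) := by
      rintro ⟨i, -, hi⟩
      simp [bet] at hi
      linarith
    simp [F, this, bet]
  rw [h0] at hle
  have hmk := mul_meas_ge_le_lintegral₀ (μ := E.law D)
    (E.measurable_hist hE φ E.T (MeasurableHist.const hF)).aemeasurable
    (ENNReal.ofReal (Real.exp c))
  have hsub : {x : Seed × (Fin E.T → Fin K → Obs) |
      BetReaches k lam Y c (E.hist φ x.1 x.2 E.T)} ⊆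
      {x | ENNReal.ofReal (Real.exp c) ≤ F (E.hist φ x.1 x.2 E.T)} := by
    intro x hx
    have hx' : BetReaches k lam Y c (E.hist φ x.1 x.2 E.T) := hx
    show _ ≤ F _
    simp only [F, hx', if_true, le_refl]
  refine (measure_mono hsub).trans ?_
  have h3 := hmk.trans hle
  rw [mul_comm, ← ENNReal.le_div_iff_mul_le (by simp [Real.exp_pos]) (by simp)] at h3
  refine h3.trans (le_of_eq ?_)
  rw [Real.exp_neg, ENNReal.ofReal_inv_of_pos (Real.exp_pos _), one_div]

end Env

end LimitedSwitch

end

/-! ### Uniform deviations of empirical means -/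

noncomputable section

namespace LimitedSwitch

open scoped ENNReal

section Samples

variable {K : ℕ} {Obs : Type}

/-- The values of `f` observed in the pulls of arm `k`. -/
def samples (f : Obs → ℝ) (h : Hist K Obs) (k : Fin K) : List ℝ :=
  (h.filter (fun e => decide (e.1 = k))).map (fun e => f e.2)

theorem length_samples (f : Obs → ℝ) (h : Hist K Obs) (k : Fin K) :
    (samples f h k).length = pulls h k := by
  rw [samples, List.length_map, pulls, List.countP_eq_length_filter]

theorem empMean_eq (f : Obs → ℝ) (h : Hist K Obs) (k : Fin K) :
    empMean f h k = (samples f h k).sum / pulls h k := rfl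

theorem samples_prefix (f : Obs → ℝ) {h h' : Hist K Obs} (hh : h <+: h') (k : Fin K) :
    samples f h k <+: samples f h' k :=
  (hh.filter _).map _

theorem pulls_mono {h h' : Hist K Obs} (hh : h <+: h') (k : Fin K) : pulls h k ≤ pulls h' k :=
  hh.sublist.countP_le

theorem pulls_le_length (h : Hist K Obs) (k : Fin K) : pulls h k ≤ h.length :=
  List.countP_le_length

theorem samples_concat (f : Obs → ℝ) (h : Hist K Obs) (e : Fin K × Obs) (k : Fin K) :
    samples f (h ++ [e]) k = samples f h k ++ if e.1 = k then [f e.2] else [] := by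
  by_cases he : e.1 = k <;> simp [samples, List.filter_append, he]

/-- Bet `a` on the first `m` pulls and `b` on the later ones. -/
def twoBets (m : ℕ) (a b : ℝ) (i : ℕ) : ℝ := if i < m then a else b

theorem foldl_betStep_twoBets (k : Fin K) (m : ℕ) (a b : ℝ) (Y : Obs → ℝ) (h : Hist K Obs) :
    h.foldl (betStep k (twoBets m a b) Y) (0, 0) = (pulls h k,
      (a * ((samples Y h k).take m).sum - a ^ 2 / 8 * ((samples Y h k).take m).length) +
      (b * ((samples Y h k).drop m).sum - b ^ 2 / 8 * ((samples Y h k).drop m).length)) := by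
  induction h using List.reverseRecOn with
  | nil => simp [samples, pulls]
  | append_singleton h e ih =>
    rw [List.foldl_append, ih, samples_concat, ← length_samples Y, ← length_samples Y,
      samples_concat]
    simp only [List.foldl_cons, List.foldl_nil, betStep]
    by_cases he : e.1 = k
    · simp only [he, if_true, List.length_append, List.length_singleton, twoBets]
      refine Prod.ext rfl ?_
      by_cases hm : (samples Y h k).length < m
      · rw [List.take_of_length_le (l := samples Y h k) hm.le,
          List.take_of_length_le (l := samples Y h k ++ _) (by simp; omega),
          List.drop_of_length_le (l := samples Y h k) hm.le,
          List.drop_of_length_le (l := samples Y h k ++ _) (by simp; omega)]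
        simp only [hm, if_true, List.sum_append, List.length_append, List.sum_singleton,
          List.length_singleton]
        push_cast
        ring
      · push Not at hm
        rw [List.take_append_of_le_length hm, List.drop_append_of_le_length hm]
        simp only [hm.not_gt, if_false, List.sum_append, List.length_append, List.sum_singleton,
          List.length_singleton]
        push_cast
        ring
    · simp [he]

theorem bet_twoBets (k : Fin K) (m : ℕ) (a b : ℝ) (Y : Obs → ℝ) (h : Hist K Obs) :
    bet k (twoBets m a b) Y h =
      (a * ((samples Y h k).take m).sum - a ^ 2 / 8 * ((samples Y h k).take m).length) +
      (b * ((samples Y h k).drop m).sum - b ^ 2 / 8 * ((samples Y h k).drop m).length) := by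
  rw [bet, foldl_betStep_twoBets]

theorem bet_lt_of_not_betReaches {k : Fin K} {lam : ℕ → ℝ} {Y : Obs → ℝ} {c : ℝ}
    {h h' : Hist K Obs} (hn : ¬ BetReaches k lam Y c h) (hh : h' <+: h) : bet k lam Y h' < c := by
  by_contra hc
  push Not at hc
  refine hn ⟨h'.length, hh.length_le, ?_⟩
  rwa [← List.prefix_iff_eq_take.1 hh]

/-- The three bets that control the deviations of the empirical means. -/
def devBets (m : ℕ) (ε : ℝ) : Fin 3 → ℕ → ℝ :=
  ![twoBets m (-(7 / 2) * ε) 0, twoBets m 0 (3 / 2 * ε), twoBets m (-(13 / 4) * ε) ε]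

/-- If none of the bets succeeds, the empirical mean after `m` pulls is neither much smaller than
zero nor much smaller than any later one. -/
theorem dev_of_not_betReaches {k : Fin K} {Y : Obs → ℝ} {Λ : ℝ} {H : Hist K Obs} {m : ℕ}
    (hΛ : 0 < Λ) (hm : 0 < m)
    (hn : ∀ j, ¬ BetReaches k (devBets m √(Λ / m) j) Y (3 / 2 * Λ) H)
    {h₁ h₂ : Hist K Obs} (h12 : h₁ <+: h₂) (h2 : h₂ <+: H) (hp : pulls h₁ k = m) :
    -empMean Y h₁ k ≤ √(Λ / m) ∧ empMean Y h₂ k - empMean Y h₁ k ≤ √(Λ / m) := by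
  obtain ⟨zs, hzs⟩ := samples_prefix Y h12 k
  have hl1 : (samples Y h₁ k).length = m := by rw [length_samples, hp]
  have hl2 : (samples Y h₂ k).length = m + zs.length := by rw [← hzs, List.length_append, hl1]
  have hm' : (0 : ℝ) < m := by exact_mod_cast hm
  set ε := √(Λ / m) with hε
  have hε0 : 0 < ε := Real.sqrt_pos.2 (by positivity)
  have hεΛ : m * ε ^ 2 = Λ := by
    rw [hε, Real.sq_sqrt (by positivity)]; field_simp
  have hbet : ∀ a b, bet k (twoBets m a b) Y h₂ =
      (a * (samples Y h₁ k).sum - a ^ 2 / 8 * m) + (b * zs.sum - b ^ 2 / 8 * zs.length) := by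
    intro a b
    rw [bet_twoBets, ← hzs, ← hl1]
    simp
  have e1 := bet_lt_of_not_betReaches (hn 0) h2
  have e2 := bet_lt_of_not_betReaches (hn 1) h2
  have e3 := bet_lt_of_not_betReaches (hn 2) h2
  simp only [devBets, Matrix.cons_val, hbet] at e1 e2 e3
  set S := (samples Y h₁ k).sum with hS
  set R := zs.sum with hR
  set q : ℝ := ((zs.length : ℕ) : ℝ) with hq
  have hq0 : 0 ≤ q := by positivity
  rw [empMean_eq, empMean_eq, hp, ← length_samples Y h₂ k, hl2, ← hzs, List.sum_append, ← hS, ← hR]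
  push_cast
  rw [← hq]
  -- the deviation in units of the radius
  obtain ⟨y, hy⟩ : ∃ y, S = -(y * (m * ε)) := ⟨-(S / (m * ε)), by field_simp⟩
  -- Since `m * ε ^ 2 = Λ`, failure of the first bet means `7/2 * y - 49/32 < 3/2`, that is `y <
  -- 97/112`.
  have hy1 : y ≤ 7 / 8 := by
    rw [hy] at e1
    have h1 : -(7 / 2) * ε * -(y * (m * ε)) - (-(7 / 2) * ε) ^ 2 / 8 * m =
        7 / 2 * y * (m * ε ^ 2) - 49 / 32 * (m * ε ^ 2) := by ring
    rw [h1, hεΛ] at e1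
    have h2 : 7 / 2 * y * Λ < (97 / 32) * Λ := by linarith
    have := lt_of_mul_lt_mul_right h2 hΛ.le
    linarith
  have hSm : S / m = -(y * ε) := by rw [hy]; field_simp
  rw [hSm]
  constructor
  · nlinarith
  · by_contra hcon
    push Not at hcon
    have h3 : (1 - y) * ε < (S + R) / (m + q) := by linarith
    rw [lt_div_iff₀ (by positivity), hy] at h3
    have h4 : m * ε + q * ((1 - y) * ε) < R := by linarith
    -- The later samples sum to more than `m * ε + q * (1 - y) * ε`. If `y ≤ 13/16`, then `1 - y ≥
    -- 3/16` and the second bet gains `3/2 * Λ + 9/32 * q * ε ^ 2` against a cost of `9/32 * q * ε ^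
    -- 2`. If `y > 13/16`, the third bet exploits both blocks: it nets at least `169/128 * Λ` on the
    -- first and, as `1 - y ≥ 1/8`, at least `Λ` on the second. In either case it reaches `3/2 * Λ`.
    rcases le_or_gt y (13 / 16) with h5 | h5
    · have h6 : q * (3 / 16 * ε) ≤ q * ((1 - y) * ε) := by
        gcongr; linarith
      have h7 : 3 / 2 * ε * (m * ε + q * (3 / 16 * ε)) ≤ 3 / 2 * ε * R := by
        gcongr; linarith
      nlinarith
    · have h6 : q * (1 / 8 * ε) ≤ q * ((1 - y) * ε) := by
        gcongr; linarith
      have h7 : ε * (m * ε + q * (1 / 8 * ε)) ≤ ε * R := by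
        gcongr; linarith
      rw [hy] at e3
      have h1 : -(13 / 4) * ε * -(y * (m * ε)) - (-(13 / 4) * ε) ^ 2 / 8 * m =
          13 / 4 * y * (m * ε ^ 2) - 169 / 128 * (m * ε ^ 2) := by ring
      rw [h1, hεΛ] at e3
      have h8 : 13 / 4 * (13 / 16) * Λ ≤ 13 / 4 * y * Λ := by gcongr
      nlinarith

/-- All empirical means of `Y` are within the confidence radius of zero and of all later ones. -/
def CleanFor (Λ : ℝ) (Y : Fin K → Obs → ℝ) (H : Hist K Obs) : Prop :=
  ∀ k h₁ h₂, h₁ <+: h₂ → h₂ <+: H → 0 < pulls h₁ k →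
    |empMean (Y k) h₁ k| ≤ √(Λ / pulls h₁ k) ∧
    |empMean (Y k) h₂ k - empMean (Y k) h₁ k| ≤ √(Λ / pulls h₁ k)

theorem empMean_neg (Y : Obs → ℝ) (h : Hist K Obs) (k : Fin K) :
    empMean (fun o => -Y o) h k = -empMean Y h k := by
  simp only [empMean]
  rw [← neg_div, List.sum_neg, List.map_map]
  rfl

end Samples

namespace Env

variable {d K : ℕ} {Obs : Type} [MeasurableSpace Obs] (E : Env d K Obs)
  (D : Fin K → Measure Obs) [∀ k, IsProbabilityMeasure (D k)]

/-- A union bound over the estimated quantity, the arm, the number of pulls, the sign and the three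
bets. The later time of comparison adds nothing to the union, because Ville's inequality covers all
prefixes simultaneously. -/
theorem exists_clean_event (hE : ∀ i k, Measurable (E.cost i k)) (φ : Policy K Obs)
    {ι : Type*} [Fintype ι] {Y : ι → Fin K → Obs → ℝ} (hY : ∀ o k, Measurable (Y o k))
    (hmgf : ∀ o k (a : ℝ), ∫⁻ x, ENNReal.ofReal (Real.exp (a * Y o k x)) ∂D k ≤
      ENNReal.ofReal (Real.exp (a ^ 2 / 8))) {Λ : ℝ} (hΛ : 0 < Λ) :
    ∃ S : Set (Seed × (Fin E.T → Fin K → Obs)), MeasurableSet S ∧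
      (E.law D).real S ≤ 6 * Fintype.card ι * K * E.T * Real.exp (-(3 / 2 * Λ)) ∧
      ∀ x, x ∉ S → ∀ o, CleanFor Λ (Y o) (E.hist φ x.1 x.2 E.T) := by
  let I := ι × Fin K × Fin E.T × Bool × Fin 3
  let Z : I → Obs → ℝ := fun a x => if a.2.2.2.1 then Y a.1 a.2.1 x else -Y a.1 a.2.1 x
  let G : I → Set (Seed × (Fin E.T → Fin K → Obs)) := fun a =>
    {x | BetReaches a.2.1 (devBets (a.2.2.1 + 1) √(Λ / ((a.2.2.1 + 1 : ℕ) : ℝ)) a.2.2.2.2) (Z a)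
      (3 / 2 * Λ) (E.hist φ x.1 x.2 E.T)}
  have hZ : ∀ a, Measurable (Z a) := by
    rintro ⟨o, k, m, s, j⟩
    cases s
    · exact (hY o k).neg
    · exact hY o k
  have hZmgf : ∀ a (t : ℝ), ∫⁻ x, ENNReal.ofReal (Real.exp (t * Z a x)) ∂D a.2.1 ≤
      ENNReal.ofReal (Real.exp (t ^ 2 / 8)) := by
    rintro ⟨o, k, m, s, j⟩ t
    cases s
    · simpa [Z] using hmgf o k (-t)
    · simpa [Z] using hmgf o k t
  refine ⟨⋃ a, G a, MeasurableSet.iUnion fun a =>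
    E.measurableSet_hist_betReaches hE φ _ _ (hZ a) _, ?_, ?_⟩
  · have h1 : ∀ a, (E.law D).real (G a) ≤ Real.exp (-(3 / 2 * Λ)) := fun a =>
      ENNReal.toReal_le_of_le_ofReal (Real.exp_nonneg _)
        (E.law_betReaches_le D hE φ a.2.1 _ (hZ a) (hZmgf a) (by positivity))
    refine (measureReal_iUnion_fintype_le _).trans ((Finset.sum_le_sum fun a _ => h1 a).trans ?_)
    rw [Finset.sum_const, nsmul_eq_mul]
    refine mul_le_mul_of_nonneg_right (le_of_eq ?_) (Real.exp_nonneg _)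
    simp only [I, Finset.card_univ, Fintype.card_prod, Fintype.card_fin, Fintype.card_bool]
    push_cast
    ring
  · intro x hx o k h₁ h₂ h12 h2 hp
    have hx' : ∀ a, x ∉ G a := fun a ha => hx (Set.mem_iUnion.2 ⟨a, ha⟩)
    have hle : pulls h₁ k ≤ E.T := (pulls_le_length h₁ k).trans
      ((h12.trans h2).length_le.trans (E.length_hist_le φ x.1 x.2 E.T))
    have hm : pulls h₁ k - 1 + 1 = pulls h₁ k := by omega
    have key : ∀ s : Bool, ∀ j, ¬ BetReaches k (devBets (pulls h₁ k) √(Λ / (pulls h₁ k : ℝ)) j)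
        (Z (o, k, ⟨pulls h₁ k - 1, by omega⟩, s, 0)) (3 / 2 * Λ) (E.hist φ x.1 x.2 E.T) := by
      intro s j
      have := hx' (o, k, ⟨pulls h₁ k - 1, by omega⟩, s, j)
      simp only [G, hm] at this
      exact this
    have p1 := dev_of_not_betReaches hΛ hp (key true) h12 h2 rfl
    have p2 := dev_of_not_betReaches hΛ hp (key false) h12 h2 rfl
    simp only [Z, if_true, Bool.false_eq_true, if_false, empMean_neg] at p1 p2
    exact ⟨abs_le.2 ⟨by linarith [p1.1], by linarith [p2.1]⟩,
      abs_le.2 ⟨by linarith [p2.2], by linarith [p1.2]⟩⟩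

end Env

end LimitedSwitch

end

noncomputable section

namespace LimitedSwitch

/-! ### The time points -/

/-- The exponent of `T` in the time point `t_{i+1}`. -/
def timeExp (ν i : ℕ) : ℝ := (2 - (1 / 2 : ℝ) ^ i) / (2 - (1 / 2 : ℝ) ^ ν)

/-- The time point `t_{i+1}` before rounding. -/
def tau (K T ν i : ℕ) : ℝ := (K : ℝ) ^ (1 - timeExp ν i) * (T : ℝ) ^ timeExp ν i

theorem tpt_succ (K T ν i : ℕ) : tpt K T ν (i + 1) = ⌊tau K T ν i⌋₊ := by
  simp [tpt, tau, timeExp]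

theorem half_pow_le_one (i : ℕ) : (1 / 2 : ℝ) ^ i ≤ 1 := pow_le_one₀ (by norm_num) (by norm_num)

theorem timeExp_mono (ν : ℕ) {i j : ℕ} (hij : i ≤ j) : timeExp ν i ≤ timeExp ν j := by
  have h1 := half_pow_le_one ν
  have h2 : (1 / 2 : ℝ) ^ j ≤ (1 / 2) ^ i := pow_le_pow_of_le_one (by norm_num) (by norm_num) hij
  unfold timeExp
  gcongr
  linarith

theorem timeExp_self (ν : ℕ) : timeExp ν ν = 1 := by
  have h1 := half_pow_le_one ν
  exact div_self (by linarith)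

theorem timeExp_zero (ν : ℕ) : timeExp ν 0 = 1 / (2 - (1 / 2 : ℝ) ^ ν) := by
  norm_num [timeExp]

theorem half_le_timeExp_zero (ν : ℕ) : 1 / 2 ≤ timeExp ν 0 := by
  have h1 := half_pow_le_one ν
  have h2 : (0 : ℝ) < (1 / 2) ^ ν := by positivity
  rw [timeExp_zero]
  exact one_div_le_one_div_of_le (by linarith) (by linarith)

theorem timeExp_zero_le (ν : ℕ) : timeExp ν 0 ≤ 1 := by
  rw [← timeExp_self ν]
  exact timeExp_mono ν (Nat.zero_le _)

theorem timeExp_succ_sub (ν i : ℕ) :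
    timeExp ν (i + 1) - timeExp ν i = (1 / 2) ^ (i + 1) * timeExp ν 0 := by
  rw [timeExp_zero, timeExp, timeExp, pow_succ]
  ring

theorem timeExp_succ (ν i : ℕ) : timeExp ν (i + 1) = timeExp ν i / 2 + timeExp ν 0 := by
  rw [timeExp_zero, timeExp, timeExp, pow_succ]
  ring

theorem one_sub_timeExp_le {ν i : ℕ} (hi : i ≤ ν) : 1 - timeExp ν i ≤ (1 / 2) ^ i := by
  have h1 := half_pow_le_one ν
  have h2 : (0 : ℝ) < (1 / 2) ^ ν := by positivity
  have h3 : (1 / 2 : ℝ) ^ ν ≤ (1 / 2) ^ i := pow_le_pow_of_le_one (by norm_num) (by norm_num) hi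
  have h4 : 1 - timeExp ν i = ((1 / 2) ^ i - (1 / 2) ^ ν) / (2 - (1 / 2 : ℝ) ^ ν) := by
    rw [timeExp, eq_div_iff (by linarith), sub_mul, div_mul_cancel₀ _ (by linarith)]
    ring
  rw [h4, div_le_iff₀ (by linarith)]
  nlinarith [pow_pos (by norm_num : (0 : ℝ) < 1 / 2) i]

section

variable {K T ν : ℕ}

theorem cast_pos_of_le (hK : 1 ≤ K) (hKT : K ≤ T) :
    (0 : ℝ) < K ∧ (0 : ℝ) < T ∧ (1 : ℝ) ≤ K ∧ (K : ℝ) ≤ T := by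
  have h1 : (1 : ℝ) ≤ K := by exact_mod_cast hK
  have h2 : (K : ℝ) ≤ T := by exact_mod_cast hKT
  exact ⟨by linarith, by linarith, h1, h2⟩

theorem tau_eq (hK : 1 ≤ K) (hKT : K ≤ T) (i : ℕ) :
    tau K T ν i = K * ((T : ℝ) / K) ^ timeExp ν i := by
  obtain ⟨h1, h2, h3, h4⟩ := cast_pos_of_le hK hKT
  rw [tau, Real.rpow_sub h1, Real.rpow_one, Real.div_rpow h2.le h1.le]
  ring

theorem tau_mono (hK : 1 ≤ K) (hKT : K ≤ T) {i j : ℕ} (hij : i ≤ j) :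
    tau K T ν i ≤ tau K T ν j := by
  obtain ⟨h1, h2, h3, h4⟩ := cast_pos_of_le hK hKT
  rw [tau_eq hK hKT, tau_eq hK hKT]
  gcongr
  · rwa [one_le_div h1]
  · exact timeExp_mono ν hij

theorem tau_self (hK : 1 ≤ K) (hKT : K ≤ T) : tau K T ν ν = T := by
  obtain ⟨h1, h2, h3, h4⟩ := cast_pos_of_le hK hKT
  simp [tau, timeExp_self]

theorem sqrt_le_tau_zero (hK : 1 ≤ K) (hKT : K ≤ T) : √((K : ℝ) * T) ≤ tau K T ν 0 := by
  obtain ⟨h1, h2, h3, h4⟩ := cast_pos_of_le hK hKT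
  rw [tau_eq hK hKT]
  have h5 : √((K : ℝ) * T) = K * ((T : ℝ) / K) ^ (1 / 2 : ℝ) := by
    rw [← Real.sqrt_eq_rpow, Real.sqrt_eq_iff_mul_self_eq (by positivity) (by positivity), eq_comm]
    have := Real.mul_self_sqrt (show 0 ≤ (T : ℝ) / K by positivity)
    calc (K * √((T : ℝ) / K)) * (K * √((T : ℝ) / K)) = K ^ 2 * (√((T : ℝ) / K) * √((T : ℝ) / K)) := by
          ring
      _ = K * T := by rw [this]; field_simp
  rw [h5]
  gcongr
  · rwa [one_le_div h1]
  · exact half_le_timeExp_zero ν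

theorem one_le_tau (hK : 1 ≤ K) (hKT : K ≤ T) (i : ℕ) : 1 ≤ tau K T ν i := by
  obtain ⟨h1, h2, h3, h4⟩ := cast_pos_of_le hK hKT
  refine le_trans ?_ (tau_mono hK hKT (Nat.zero_le i))
  refine le_trans ?_ (sqrt_le_tau_zero hK hKT)
  rw [Real.one_le_sqrt]
  nlinarith

/-- The balance for which the time points are designed: `τ_{i+1} √(K / τ_i) = τ_0`, so that playing
an epoch with the accuracy reached before it costs the same in every epoch. -/
theorem tau_succ_sq (hK : 1 ≤ K) (hKT : K ≤ T) (i : ℕ) :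
    tau K T ν (i + 1) ^ 2 * K = tau K T ν 0 ^ 2 * tau K T ν i := by
  obtain ⟨h1, h2, h3, h4⟩ := cast_pos_of_le hK hKT
  have h5 : (0 : ℝ) < T / K := by positivity
  simp only [tau_eq hK hKT]
  rw [timeExp_succ, Real.rpow_add h5]
  have h6 : ((T : ℝ) / K) ^ timeExp ν i = (((T : ℝ) / K) ^ (timeExp ν i / 2)) ^ 2 := by
    rw [← Real.rpow_natCast, ← Real.rpow_mul h5.le]
    norm_num
  rw [h6]
  ring

theorem tpt_le_tau (hK : 1 ≤ K) (hKT : K ≤ T) (i : ℕ) : (tpt K T ν (i + 1) : ℝ) ≤ tau K T ν i := by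
  rw [tpt_succ]
  exact Nat.floor_le (by linarith [one_le_tau hK hKT (ν := ν) i])

theorem tau_le_two_mul_tpt (hK : 1 ≤ K) (hKT : K ≤ T) (i : ℕ) :
    tau K T ν i ≤ 2 * tpt K T ν (i + 1) := by
  have h1 := one_le_tau hK hKT (ν := ν) i
  have h2 : 1 ≤ tpt K T ν (i + 1) := by
    rw [tpt_succ]
    exact Nat.le_floor (by exact_mod_cast h1)
  have h3 : tau K T ν i < tpt K T ν (i + 1) + 1 := by
    rw [tpt_succ]
    exact Nat.lt_floor_add_one _
  have h4 : (1 : ℝ) ≤ tpt K T ν (i + 1) := by exact_mod_cast h2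
  linarith

theorem tpt_pos (hK : 1 ≤ K) (hKT : K ≤ T) (i : ℕ) : (1 : ℝ) ≤ tpt K T ν (i + 1) := by
  rw [tpt_succ]
  exact_mod_cast Nat.le_floor (α := ℝ) (n := 1) (by exact_mod_cast one_le_tau hK hKT (ν := ν) i)

theorem tpt_mono (hK : 1 ≤ K) (hKT : K ≤ T) : Monotone (tpt K T ν) := by
  refine monotone_nat_of_le_succ fun l => ?_
  cases l with
  | zero => simp [tpt]
  | succ l =>
    rw [tpt_succ, tpt_succ]
    exact Nat.floor_le_floor (tau_mono hK hKT (Nat.le_succ l))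

theorem tpt_last (hK : 1 ≤ K) (hKT : K ≤ T) : tpt K T ν (ν + 1) = T := by
  rw [tpt_succ, tau_self hK hKT, Nat.floor_natCast]

/-- The exponents of consecutive time points differ by at most `2^{-(i+1)}`. Doubling thus forces
`T^{2^{-(i+1)}} > 2`, and `log 2 > 1/2`. -/
theorem two_pow_lt_of_tau_lt (hK : 1 ≤ K) (hKT : K ≤ T) (hT : 2 ≤ T) {i : ℕ}
    (h : 2 * tau K T ν i < tau K T ν (i + 1)) :
    (2 : ℝ) ^ (i + 1) < 2 * Real.log T := by
  obtain ⟨h1, h2, h3, h4⟩ := cast_pos_of_le hK hKT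
  have h5 : (0 : ℝ) < T / K := by positivity
  have h5' : (1 : ℝ) ≤ T / K := by rwa [one_le_div h1]
  have hlT : 0 < Real.log T := Real.log_pos (by exact_mod_cast (by omega : 1 < T))
  have h6 : timeExp ν (i + 1) = timeExp ν i + (1 / 2) ^ (i + 1) * timeExp ν 0 := by
    rw [← timeExp_succ_sub]; ring
  rw [tau_eq hK hKT, tau_eq hK hKT, h6, Real.rpow_add h5] at h
  have h7 : (0 : ℝ) < K * ((T : ℝ) / K) ^ timeExp ν i := by positivity
  have h8 : 2 < ((T : ℝ) / K) ^ ((1 / 2) ^ (i + 1) * timeExp ν 0) := by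
    have : K * ((T : ℝ) / K) ^ timeExp ν i * 2 <
        K * ((T : ℝ) / K) ^ timeExp ν i * ((T : ℝ) / K) ^ ((1 / 2) ^ (i + 1) * timeExp ν 0) := by
      nlinarith
    exact lt_of_mul_lt_mul_left this h7.le
  have h9 := Real.log_lt_log (by norm_num) h8
  rw [Real.log_rpow h5] at h9
  have h10 : Real.log ((T : ℝ) / K) ≤ Real.log T :=
    Real.log_le_log h5 (div_le_self h2.le h3)
  have h11 : 0 ≤ Real.log ((T : ℝ) / K) := Real.log_nonneg h5'
  have h12 := Real.log_two_gt_d9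
  have hp : (0 : ℝ) < (1 / 2) ^ (i + 1) := by positivity
  have h13 : (1 / 2 : ℝ) ^ (i + 1) * timeExp ν 0 * Real.log ((T : ℝ) / K) ≤
      (1 / 2) ^ (i + 1) * 1 * Real.log T := by
    have := timeExp_zero_le ν
    gcongr
  have h14 : 1 / 2 < (1 / 2 : ℝ) ^ (i + 1) * Real.log T := by linarith
  rw [one_div_pow, one_div_mul_eq_div, lt_div_iff₀ (by positivity)] at h14
  linarith

/-- The exponent of `T` is then within `T^{-2}` of `1`, and `T^{1 - T^{-2}} ≥ T (1 - T^{-2} log T) ≥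
T - 1`. -/
theorem tau_ge_sub_one (hK : 1 ≤ K) (hKT : K ≤ T) (hT : 2 ≤ T) {i : ℕ} (hi : i ≤ ν)
    (h : (T : ℝ) ^ 2 ≤ 2 ^ i) :
    (T : ℝ) - 1 ≤ tau K T ν i := by
  obtain ⟨h1, h2, h3, h4⟩ := cast_pos_of_le hK hKT
  have hq : timeExp ν i ≤ 1 := by
    rw [← timeExp_self ν]; exact timeExp_mono ν hi
  have hlT : 0 < Real.log T := Real.log_pos (by exact_mod_cast (by omega : 1 < T))
  have h5 : (T : ℝ) ^ timeExp ν i ≤ tau K T ν i := by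
    rw [tau]
    exact le_mul_of_one_le_left (by positivity) (Real.one_le_rpow h3 (by linarith))
  refine le_trans ?_ h5
  have h6 : (T : ℝ) ^ timeExp ν i = T * Real.exp (-((1 - timeExp ν i) * Real.log T)) := by
    rw [Real.rpow_def_of_pos h2]
    nth_rewrite 2 [← Real.exp_log h2]
    rw [← Real.exp_add]
    congr 1; ring
  rw [h6]
  have h7 := Real.add_one_le_exp (-((1 - timeExp ν i) * Real.log T))
  have h8 : (1 - timeExp ν i) * Real.log T ≤ 1 / T := by
    have h9 : 1 - timeExp ν i ≤ 1 / (T : ℝ) ^ 2 := by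
      refine (one_sub_timeExp_le hi).trans ?_
      rw [one_div_pow]
      exact one_div_le_one_div_of_le (by positivity) h
    have h10 : Real.log T ≤ T := (Real.log_le_sub_one_of_pos h2).trans (by linarith)
    calc (1 - timeExp ν i) * Real.log T ≤ 1 / (T : ℝ) ^ 2 * T := by gcongr
      _ = 1 / T := by field_simp
  have h11 : T * (1 - 1 / (T : ℝ)) = T - 1 := by field_simp
  rw [← h11]
  gcongr
  linarith

theorem sum_min_le {K T ν : ℕ} (N p : ℕ) (hp : p ≤ N) :
    ∑ l ∈ Finset.range N, min 1 ((tpt K T ν (l + 1) : ℝ) - tpt K T ν l) ≤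
      p + ((tpt K T ν N : ℝ) - tpt K T ν p) := by
  induction N, hp using Nat.le_induction with
  | base =>
    rw [sub_self, add_zero]
    refine (Finset.sum_le_sum fun l _ => min_le_left _ _).trans ?_
    simp
  | succ N _ ih =>
    rw [Finset.sum_range_succ]
    have := min_le_right 1 ((tpt K T ν (N + 1) : ℝ) - tpt K T ν N)
    linarith

/-- Rounding losses cannot be counted as one per epoch, because `ν` may be far larger than `log T`.
But after `clog 2 (T²) + 1` epochs the time points have reached `T - 1`, and the lengths of all
remaining epochs add up to at most `1`. -/
theorem sum_min_le_log (hK : 1 ≤ K) (hKT : K ≤ T) (hT : 1 ≤ Real.log T) :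
    ∑ l ∈ Finset.range (ν + 1), min 1 ((tpt K T ν (l + 1) : ℝ) - tpt K T ν l) ≤
      6 * Real.log T := by
  obtain ⟨h1, h2, h3, h4⟩ := cast_pos_of_le hK hKT
  have hT2 : 2 ≤ T := by
    by_contra h
    have : T = 0 ∨ T = 1 := by omega
    rcases this with rfl | rfl <;> norm_num at hT
  have hb : (Nat.clog 2 (T ^ 2) : ℝ) + 2 ≤ 6 * Real.log T := by
    have h5 : 2 ^ (Nat.clog 2 (T ^ 2) - 1) < T ^ 2 :=
      Nat.pow_pred_clog_lt_self (by norm_num) (by nlinarith)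
    have h6 : ((2 : ℝ) ^ (Nat.clog 2 (T ^ 2) - 1)) < (T : ℝ) ^ 2 := by exact_mod_cast h5
    have h7 := Real.log_lt_log (by positivity) h6
    rw [Real.log_pow, Real.log_pow] at h7
    have h8 := Real.log_two_gt_d9
    have h9 : (Nat.clog 2 (T ^ 2) : ℝ) - 1 ≤ ((Nat.clog 2 (T ^ 2) - 1 : ℕ) : ℝ) := by
      have : Nat.clog 2 (T ^ 2) ≤ (Nat.clog 2 (T ^ 2) - 1) + 1 := by omega
      have : (Nat.clog 2 (T ^ 2) : ℝ) ≤ ((Nat.clog 2 (T ^ 2) - 1 : ℕ) : ℝ) + 1 := by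
        exact_mod_cast this
      linarith
    push_cast at h7
    have h10 : ((Nat.clog 2 (T ^ 2) - 1 : ℕ) : ℝ) * (2 / 3) ≤ 2 * Real.log T := by
      refine le_trans ?_ h7.le
      gcongr
      linarith
    linarith
  refine le_trans ?_ hb
  by_cases hν : Nat.clog 2 (T ^ 2) ≤ ν
  · refine (sum_min_le (ν + 1) (Nat.clog 2 (T ^ 2) + 1) (by omega)).trans ?_
    have h5 : (T : ℝ) ^ 2 ≤ 2 ^ Nat.clog 2 (T ^ 2) := by
      exact_mod_cast Nat.le_pow_clog (by norm_num) (T ^ 2)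
    have h6 := tau_ge_sub_one hK hKT hT2 hν h5
    have h7 : T - 1 ≤ tpt K T ν (Nat.clog 2 (T ^ 2) + 1) := by
      rw [tpt_succ]
      apply Nat.le_floor
      push_cast [Nat.cast_sub (by omega : 1 ≤ T)]
      exact h6
    have h8 : (T : ℝ) ≤ tpt K T ν (Nat.clog 2 (T ^ 2) + 1) + 1 := by
      exact_mod_cast (by omega : T ≤ tpt K T ν (Nat.clog 2 (T ^ 2) + 1) + 1)
    rw [tpt_last hK hKT]
    push_cast
    linarith
  · refine (sum_min_le (ν + 1) (ν + 1) le_rfl).trans ?_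
    have : (ν : ℝ) + 1 ≤ Nat.clog 2 (T ^ 2) := by
      exact_mod_cast (by omega : ν + 1 ≤ Nat.clog 2 (T ^ 2))
    push_cast
    linarith

theorem sq_le_two_pow (n : ℕ) : n ^ 2 ≤ 2 ^ (n + 1) := by
  induction n with
  | zero => norm_num
  | succ n ih =>
    rcases Nat.lt_or_ge n 3 with h | h
    · interval_cases n <;> norm_num
    · rw [pow_succ 2 (n + 1)]
      nlinarith

/-- If `b ≤ 4a`, then `b - a = (√b - √a)(√b + √a) ≤ 3√a (√b - √a)`, which telescopes. Otherwise the
unrounded points more than double, rounding having cost at most a factor `2`; this happens only for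
small `i`, and by `tau_succ_sq` the term is at most `√2 · τ_0`. -/
theorem epoch_term_le (hK : 1 ≤ K) (hKT : K ≤ T) (hT : 2 ≤ T) (i : ℕ) :
    ((tpt K T ν (i + 2) : ℝ) - tpt K T ν (i + 1)) * √(K / tpt K T ν (i + 1)) ≤
      3 * √K * (√(tpt K T ν (i + 2)) - √(tpt K T ν (i + 1))) +
        if ((i : ℝ) + 1) < 2 * √(Real.log T) then 3 / 2 * tau K T ν 0 else 0 := by
  obtain ⟨h1, h2, h3, h4⟩ := cast_pos_of_le hK hKT
  have hτ0 := one_le_tau hK hKT (ν := ν) 0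
  have hτi := one_le_tau hK hKT (ν := ν) i
  have hτi' := one_le_tau hK hKT (ν := ν) (i + 1)
  have ha := tpt_pos hK hKT (ν := ν) i
  have hmono : (tpt K T ν (i + 1) : ℝ) ≤ tpt K T ν (i + 2) := by
    exact_mod_cast tpt_mono hK hKT (ν := ν) (by omega : i + 1 ≤ i + 2)
  have hbτ := tpt_le_tau hK hKT (ν := ν) (i + 1)
  have haτ := tau_le_two_mul_tpt hK hKT (ν := ν) i
  set a : ℝ := (tpt K T ν (i + 1) : ℝ) with ha_def
  set b : ℝ := (tpt K T ν (i + 2) : ℝ) with hb_def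
  have hsa : 0 < √a := Real.sqrt_pos.2 (by linarith)
  have hsab : √a ≤ √b := Real.sqrt_le_sqrt hmono
  rcases le_or_gt b (4 * a) with hba | hba
  · have h5 : (b - a) * √(K / a) ≤ 3 * √K * (√b - √a) := by
      have h6 : √b ≤ 2 * √a := by
        have : √(4 * a) = 2 * √a := by
          rw [Real.sqrt_mul (by norm_num), show (4 : ℝ) = 2 ^ 2 by norm_num,
            Real.sqrt_sq (by norm_num)]
        rw [← this]
        exact Real.sqrt_le_sqrt hba
      have h7 : b - a = (√b - √a) * (√b + √a) := by
        have e1 := Real.mul_self_sqrt (show 0 ≤ a by linarith)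
        have e2 := Real.mul_self_sqrt (show 0 ≤ b by linarith)
        nlinarith
      rw [Real.sqrt_div h1.le, h7, mul_div_assoc', div_le_iff₀ hsa]
      have h8 : (√b - √a) * (√b + √a) ≤ (√b - √a) * (3 * √a) :=
        mul_le_mul_of_nonneg_left (by linarith) (by linarith)
      nlinarith [Real.sqrt_nonneg (K : ℝ)]
    split_ifs <;> linarith
  · have h5 := two_pow_lt_of_tau_lt hK hKT hT (ν := ν) (i := i) (by linarith)
    have h6 : ((i : ℝ) + 1) < 2 * √(Real.log T) := by
      have h7 : ((i + 1 : ℕ) : ℝ) ^ 2 ≤ 2 ^ (i + 1 + 1) := by exact_mod_cast sq_le_two_pow (i + 1)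
      rw [pow_succ 2 (i + 1)] at h7
      have h8 : ((i : ℝ) + 1) ^ 2 < 4 * Real.log T := by push_cast at h7; linarith
      have h9 : √(4 * Real.log T) = 2 * √(Real.log T) := by
        rw [Real.sqrt_mul (by norm_num), show (4 : ℝ) = 2 ^ 2 by norm_num,
          Real.sqrt_sq (by norm_num)]
      rw [← h9]
      exact Real.lt_sqrt_of_sq_lt h8
    rw [if_pos h6]
    have h10 : (b - a) * √(K / a) ≤ 3 / 2 * tau K T ν 0 := by
      have h11 : (b - a) * √(K / a) ≤ tau K T ν (i + 1) * √(2 * K / tau K T ν i) := by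
        apply mul_le_mul (by linarith) _ (by positivity) (by positivity)
        apply Real.sqrt_le_sqrt
        rw [div_le_div_iff₀ (by linarith) (by linarith)]
        nlinarith
      refine h11.trans ?_
      refine (pow_le_pow_iff_left₀ (by positivity) (by positivity) two_ne_zero).1 ?_
      rw [mul_pow, Real.sq_sqrt (by positivity), mul_div_assoc', div_le_iff₀ (by linarith)]
      have := tau_succ_sq hK hKT (ν := ν) i
      have h12 : 0 ≤ tau K T ν 0 ^ 2 * tau K T ν i := by positivity
      nlinarith
    have h13 : 0 ≤ 3 * √(K : ℝ) * (√b - √a) :=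
      mul_nonneg (by positivity) (by linarith)
    linarith

/-- The telescoping part is at most `3√(KT) ≤ 3τ_0`, and at most `2√(log T)` epochs contribute an
extra `3/2 · τ_0`. -/
theorem sum_epoch_le (hK : 1 ≤ K) (hKT : K ≤ T) (hT : 2 ≤ T) :
    ∑ i ∈ Finset.range ν, ((tpt K T ν (i + 2) : ℝ) - tpt K T ν (i + 1)) *
      √(K / tpt K T ν (i + 1)) ≤ 3 * (1 + √(Real.log T)) * tau K T ν 0 := by
  obtain ⟨h1, h2, h3, h4⟩ := cast_pos_of_le hK hKT
  have hτ0 := one_le_tau hK hKT (ν := ν) 0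
  refine (Finset.sum_le_sum fun i _ => epoch_term_le hK hKT hT i).trans ?_
  rw [Finset.sum_add_distrib, ← Finset.mul_sum,
    Finset.sum_range_sub (fun i => √(tpt K T ν (i + 1))), ← Finset.sum_filter, Finset.sum_const,
    nsmul_eq_mul, tpt_last hK hKT]
  have h5 : √(K : ℝ) * √(T : ℝ) ≤ tau K T ν 0 := by
    rw [← Real.sqrt_mul h1.le]
    exact sqrt_le_tau_zero hK hKT
  have h6 : ((Finset.filter (fun i : ℕ => (i : ℝ) + 1 < 2 * √(Real.log T))
      (Finset.range ν)).card : ℝ) ≤ 2 * √(Real.log T) := by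
    have hsub : Finset.filter (fun i : ℕ => (i : ℝ) + 1 < 2 * √(Real.log T)) (Finset.range ν) ⊆
        Finset.range ⌊2 * √(Real.log T)⌋₊ := by
      intro i hi
      simp only [Finset.mem_filter, Finset.mem_range] at hi ⊢
      have : i + 1 ≤ ⌊2 * √(Real.log T)⌋₊ := Nat.le_floor (by push_cast; exact hi.2.le)
      omega
    have hc := Finset.card_le_card hsub
    rw [Finset.card_range] at hc
    exact (Nat.cast_le.2 hc).trans (Nat.floor_le (by positivity))
  have h7 : 3 * √(K : ℝ) * (√(T : ℝ) - √(tpt K T ν (0 + 1) : ℝ)) ≤ 3 * tau K T ν 0 := by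
    have := mul_nonneg (Real.sqrt_nonneg (K : ℝ)) (Real.sqrt_nonneg (tpt K T ν (0 + 1) : ℝ))
    nlinarith
  have h8 := mul_le_mul_of_nonneg_right h6 (by positivity : 0 ≤ 3 / 2 * tau K T ν 0)
  linarith

end

end LimitedSwitch

end

/-! ### Sparsification and scaling estimates for linear programs -/

noncomputable section

namespace LimitedSwitch

theorem sum_sqrt_le {ι : Type*} (S : Finset ι) {y : ι → ℝ} (hy : ∀ k, 0 ≤ y k) :
    ∑ k ∈ S, √(y k) ≤ √(S.card * ∑ k ∈ S, y k) := by
  apply Real.le_sqrt_of_sq_le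
  refine (sq_sum_le_card_mul_sum_sq).trans (le_of_eq ?_)
  congr 1
  exact Finset.sum_congr rfl fun k _ => Real.sq_sqrt (hy k)

/-- A linear program with few constraints whose solutions are dominated by `M` cannot put weight on
many small entries of `M`. -/
theorem sum_div_sqrt_le {K m : ℕ} (F : Fin m → Fin K → ℝ) {M x : Fin K → ℝ} {T : ℝ}
    (hx : ∀ k, 0 ≤ x k) (hxT : ∑ k, x k ≤ T)
    (hM : ∀ y : Fin K → ℝ, (∀ k, 0 ≤ y k) → ∑ k, y k = ∑ k, x k →
      (∀ i, ∑ k, F i k * y k = ∑ k, F i k * x k) → ∀ k, y k ≤ M k) :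
    ∑ k, x k / √(M k) ≤ √((m + 1) * T) := by
  -- Sparsifying with the objective `1 / √M` does not lower the left-hand side. The result `y` is
  -- still dominated by `M`, so its terms are at most `√(y k)`, and Cauchy–Schwarz applies to at
  -- most `m + 1` of them.
  obtain ⟨y, hy0, hys, hyF, hyg, hyn⟩ := exists_sparse F (fun k => 1 / √(M k)) x hx
  have hyM := hM y hy0 hys hyF
  calc ∑ k, x k / √(M k) = ∑ k, 1 / √(M k) * x k :=
        Finset.sum_congr rfl fun k _ => by ring
    _ ≤ ∑ k, 1 / √(M k) * y k := hyg
    _ = ∑ k ∈ Finset.univ.filter (fun k => y k ≠ 0), 1 / √(M k) * y k := by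
        rw [Finset.sum_filter_of_ne]
        intro k _ h h0
        exact h (by simp [h0])
    _ ≤ ∑ k ∈ Finset.univ.filter (fun k => y k ≠ 0), √(y k) := by
        refine Finset.sum_le_sum fun k hk => ?_
        have hk0 : y k ≠ 0 := by simpa using hk
        have hpos : 0 < y k := lt_of_le_of_ne (hy0 k) hk0.symm
        have h1 : √(y k) ≤ √(M k) := Real.sqrt_le_sqrt (hyM k)
        have h2 : 0 < √(y k) := Real.sqrt_pos.2 hpos
        rw [one_div, inv_mul_le_iff₀ (by linarith)]
        nlinarith [Real.mul_self_sqrt (hy0 k)]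
    _ ≤ √((Finset.univ.filter fun k => y k ≠ 0).card *
          ∑ k ∈ Finset.univ.filter (fun k => y k ≠ 0), y k) := sum_sqrt_le _ hy0
    _ ≤ √((m + 1) * T) := by
        apply Real.sqrt_le_sqrt
        have h1 : ((Finset.univ.filter fun k => y k ≠ 0).card : ℝ) ≤ m + 1 := by
          rw [← l0norm_eq_card]
          exact_mod_cast hyn
        have h2 : ∑ k ∈ Finset.univ.filter (fun k => y k ≠ 0), y k ≤ T := by
          refine (Finset.sum_le_sum_of_subset_of_nonneg (Finset.filter_subset _ _)
            fun k _ _ => hy0 k).trans ?_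
          rwa [hys]
        have h3 : 0 ≤ ∑ k ∈ Finset.univ.filter (fun k => y k ≠ 0), y k :=
          Finset.sum_nonneg fun k _ => hy0 k
        gcongr

/-- Scaling a solution makes it feasible for perturbed costs at a small loss. -/
theorem exists_scaled {d K : ℕ} {T β V W R Rm : ℝ} {B : Fin d → ℝ} {r r' ρ x : Fin K → ℝ}
    {c c' : Fin d → Fin K → ℝ} (hT : 0 < T) (hβ : 0 < β) (hV : 0 ≤ V) (hW : 0 ≤ W) (hR : 0 ≤ R)
    (hB : ∀ i, β * T ≤ B i) (hr : ∀ k, r k ≤ Rm) (hRm : 0 ≤ Rm)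
    (hx : ∀ k, 0 ≤ x k) (hxT : ∑ k, x k ≤ T) (hxc : ∀ i, ∑ k, c i k * x k ≤ B i)
    (hρ : ∑ k, ρ k * x k ≤ R) (hc' : ∀ i k, c' i k ≤ c i k + V * ρ k)
    (hr' : ∀ k, r k - W * ρ k ≤ r' k) :
    ∃ y : Fin K → ℝ, (∀ k, 0 ≤ y k) ∧ ∑ k, y k ≤ T ∧ (∀ i, ∑ k, c' i k * y k ≤ B i) ∧
      ∑ k, r k * x k - (W + V * Rm / β) * R ≤ ∑ k, r' k * y k := by
  have hVR : 0 ≤ V * R := mul_nonneg hV hR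
  have hβT : 0 < β * T := mul_pos hβ hT
  -- `V * R` bounds the extra cost of `x` under `c'`. Shrinking by `θ` recovers it: `θ (B i + V R) ≤
  -- B i`, because every capacity is at least `β * T`.
  set θ := β * T / (β * T + V * R) with hθ
  have hθ0 : 0 ≤ θ := by positivity
  have hθ1 : θ ≤ 1 := by
    rw [hθ, div_le_one (by positivity)]; linarith
  have hθeq : θ * (V * R) = (1 - θ) * (β * T) := by
    rw [hθ]; field_simp; ring
  have hθle : 1 - θ ≤ V * R / (β * T) := by
    rw [le_div_iff₀ hβT, ← hθeq]
    nlinarith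
  have hswap : ∀ f : Fin K → ℝ, ∑ k, f k * (θ * x k) = θ * ∑ k, f k * x k := by
    intro f
    rw [Finset.mul_sum]
    exact Finset.sum_congr rfl fun k _ => by ring
  have hJ : ∑ k, r k * x k ≤ Rm * T := by
    refine (Finset.sum_le_sum fun k _ => mul_le_mul_of_nonneg_right (hr k) (hx k)).trans ?_
    rw [← Finset.mul_sum]
    gcongr
  refine ⟨fun k => θ * x k, fun k => mul_nonneg hθ0 (hx k), ?_, fun i => ?_, ?_⟩
  · rw [← Finset.mul_sum]
    have : 0 ≤ ∑ k, x k := Finset.sum_nonneg fun k _ => hx k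
    nlinarith
  · rw [hswap]
    have h1 : ∑ k, c' i k * x k ≤ B i + V * R := by
      refine (Finset.sum_le_sum fun k _ => mul_le_mul_of_nonneg_right (hc' i k) (hx k)).trans ?_
      have : ∀ k, (c i k + V * ρ k) * x k = c i k * x k + V * (ρ k * x k) := fun k => by ring
      simp only [this, Finset.sum_add_distrib, ← Finset.mul_sum]
      exact add_le_add (hxc i) (mul_le_mul_of_nonneg_left hρ hV)
    have h2 := mul_le_mul_of_nonneg_left h1 hθ0
    have h3 := mul_le_mul_of_nonneg_left (hB i) (sub_nonneg.2 hθ1)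
    nlinarith
  · rw [hswap]
    have h1 : ∑ k, r k * x k - W * R ≤ ∑ k, r' k * x k := by
      refine le_trans ?_ (Finset.sum_le_sum fun k _ => mul_le_mul_of_nonneg_right (hr' k) (hx k))
      have : ∀ k, (r k - W * ρ k) * x k = r k * x k - W * (ρ k * x k) := fun k => by ring
      simp only [this, Finset.sum_sub_distrib, ← Finset.mul_sum]
      have := mul_le_mul_of_nonneg_left hρ hW
      linarith
    have h2 := mul_le_mul_of_nonneg_left h1 hθ0
    have h3 : (1 - θ) * ∑ k, r k * x k ≤ V * Rm / β * R := by
      calc (1 - θ) * ∑ k, r k * x k ≤ (1 - θ) * (Rm * T) :=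
            mul_le_mul_of_nonneg_left hJ (sub_nonneg.2 hθ1)
        _ ≤ V * R / (β * T) * (Rm * T) := by gcongr
        _ = V * Rm / β * R := by field_simp
    have h4 : θ * (W * R) ≤ W * R := mul_le_of_le_one_left (by positivity) hθ1
    nlinarith

namespace Learner

variable {d K : ℕ} {Obs : Type} (A : Learner d K Obs)

theorem contains_initBounds {r : Fin K → ℝ} {c : Fin d → Fin K → ℝ} (hr : ∀ k, 0 ≤ r k)
    (hc : ∀ i k, 0 ≤ c i k) : (initBounds d K).Contains r c :=
  ⟨hr, fun _ => le_top, hc, fun _ _ => le_top⟩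

theorem contains_updateBounds {b : Bounds d K} {r : Fin K → ℝ} {c : Fin d → Fin K → ℝ}
    (hb : b.Contains r c) {h : Hist K Obs}
    (hr : ∀ k, 0 < pulls h k → |r k - A.estRew h k| ≤ A.radRew k * A.radius h k)
    (hc : ∀ i k, 0 < pulls h k → |c i k - A.estCost h i k| ≤ A.radCost i * A.radius h k) :
    (A.updateBounds b h).Contains r c := by
  constructor
  · intro k
    simp only [updateBounds]
    split_ifs with h0
    · exact hb.Lrew_le k
    · have := abs_le.1 (hr k (Nat.pos_of_ne_zero h0))
      exact max_le (by linarith [this.1]) (hb.Lrew_le k)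
  · intro k
    simp only [updateBounds]
    split_ifs with h0
    · exact hb.le_Urew k
    · have := abs_le.1 (hr k (Nat.pos_of_ne_zero h0))
      exact le_min (EReal.coe_le_coe_iff.2 (by linarith [this.2])) (hb.le_Urew k)
  · intro i k
    simp only [updateBounds]
    split_ifs with h0
    · exact hb.Lcost_le i k
    · have := abs_le.1 (hc i k (Nat.pos_of_ne_zero h0))
      exact max_le (by linarith [this.1]) (hb.Lcost_le i k)
  · intro i k
    simp only [updateBounds]
    split_ifs with h0
    · exact hb.le_Ucost i k
    · have := abs_le.1 (hc i k (Nat.pos_of_ne_zero h0))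
      exact le_min (EReal.coe_le_coe_iff.2 (by linarith [this.2])) (hb.le_Ucost i k)

theorem updateBounds_nil (b : Bounds d K) : A.updateBounds b [] = b := by
  simp [updateBounds, pulls]

end Learner

end LimitedSwitch

end

/-! ### Clean runs: how often each arm is explored -/

noncomputable section

namespace LimitedSwitch

/-- A history `H` of the algorithm on which all confidence bounds are correct, in the regime in
which the regret bound is nontrivial. -/
structure Run {d K : ℕ} {Obs : Type} (A : Learner d K Obs) (C : Choices K Obs) (u : Seed)
    (H : Hist K Obs) (r : Fin K → ℝ) (c : Fin d → Fin K → ℝ) (β V W Rm Cm : ℝ) : Prop where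
  valid : A.Valid C
  arms : H.map Prod.fst = (A.fullPlan C u H).take H.length
  rew_true : ∀ h₁, h₁ <+: H → ∀ k, 0 < pulls h₁ k →
    |r k - A.estRew h₁ k| ≤ A.radRew k * A.radius h₁ k
  rew_later : ∀ h₁ h₂, h₁ <+: h₂ → h₂ <+: H → ∀ k, 0 < pulls h₁ k →
    |A.estRew h₂ k - A.estRew h₁ k| ≤ A.radRew k * A.radius h₁ k
  cost_true : ∀ h₁, h₁ <+: H → ∀ i k, 0 < pulls h₁ k →
    |c i k - A.estCost h₁ i k| ≤ A.radCost i * A.radius h₁ k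
  cost_later : ∀ h₁ h₂, h₁ <+: h₂ → h₂ <+: H → ∀ i k, 0 < pulls h₁ k →
    |A.estCost h₂ i k - A.estCost h₁ i k| ≤ A.radCost i * A.radius h₁ k
  estRew_nonneg : ∀ h₁, h₁ <+: H → ∀ k, 0 ≤ A.estRew h₁ k
  estCost_nonneg : ∀ h₁, h₁ <+: H → ∀ i k, 0 ≤ A.estCost h₁ i k
  r_nonneg : ∀ k, 0 ≤ r k
  r_le : ∀ k, r k ≤ Rm
  c_nonneg : ∀ i k, 0 ≤ c i k
  c_le : ∀ i k, c i k ≤ Cm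
  radRew_le : ∀ k, A.radRew k ≤ W
  radCost_le : ∀ i, A.radCost i ≤ V
  W_nonneg : 0 ≤ W
  V_nonneg : 0 ≤ V
  β_pos : 0 < β
  B_ge : ∀ i, β * A.T ≤ A.B i
  one_le_K : 1 ≤ K
  K_le_T : K ≤ A.T
  one_le_log : 1 ≤ Real.log A.T
  half_le_gamma : 1 / 2 ≤ A.gamma
  gamma_le_one : A.gamma ≤ 1
  one_le_ν : 1 ≤ A.ν
  first_epoch : 6 * Real.log A.T + 1 ≤ tpt K A.T A.ν 1 / (2 * K)

namespace Learner

variable {d K : ℕ} {Obs : Type} (A : Learner d K Obs) (C : Choices K Obs) (u : Seed)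
  (H : Hist K Obs)

/-- The observations available after `l` epochs. -/
def data (l : ℕ) : Hist K Obs := H.take (A.state C u H l).plan.length

/-- The optimal solutions of the exploration LPs used in epoch `l + 1`. -/
def explo (l : ℕ) (j k : Fin K) : ℝ := C.explore u (l + 1) (A.data C u H l) j k

/-- The allocation that the algorithm follows in epoch `l + 1`. -/
def alloc (l : ℕ) (k : Fin K) : ℝ :=
  if l < A.ν then ∑ j, 1 / (K : ℝ) * A.explo C u H l j k else C.final u (A.data C u H l) k

/-- The number of times arm `k` is planned in epoch `l + 1`. -/
def cnt (l : ℕ) (k : Fin K) : ℕ := ⌊A.gamma * (A.frac l * A.alloc C u H l k)⌋₊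

/-- The data of the first `l` epochs are complete. -/
def Avail (l : ℕ) : Prop := (A.state C u H l).plan.length ≤ H.length

/-- The time points as real numbers. -/
def tp (l : ℕ) : ℝ := tpt K A.T A.ν l

/-- The logarithmic factor of the confidence radii. -/
def lam : ℝ := Real.log (((d : ℝ) + 1) * K * A.T)

/-- The bound on the accumulated confidence radii after epoch `l`. -/
def rad (l : ℕ) : ℝ := 2 * A.T * √(A.lam * (d + 2) * (K / A.tp l))

theorem data_prefix (l : ℕ) : A.data C u H l <+: H := List.take_prefix _ _

theorem data_mono {l l' : ℕ} (hl : l ≤ l') : A.data C u H l <+: A.data C u H l' :=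
  List.take_prefix_take_left (A.plan_prefix C u H hl).length_le

variable {A C u H}

theorem Avail.mono {l l' : ℕ} (h : A.Avail C u H l') (hl : l ≤ l') : A.Avail C u H l :=
  (A.plan_prefix C u H hl).length_le.trans h

theorem count_plan (hC : A.Valid C) (k : Fin K) {l : ℕ} (hl : l ≤ A.ν) :
    (A.state C u H l).plan.count k = ∑ l' ∈ Finset.range l, A.cnt C u H l' k := by
  induction l with
  | zero => simp [state]
  | succ l ih =>
    rw [Finset.sum_range_succ, ← ih (by omega), state, List.count_append,
      count_block (hC.order_perm _ _ _ _)]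
    congr 1
    rw [exploreCount, cnt, alloc, if_pos (by omega)]
    rfl

theorem count_fullPlan (hC : A.Valid C) (k : Fin K) :
    (A.fullPlan C u H).count k = ∑ l' ∈ Finset.range (A.ν + 1), A.cnt C u H l' k := by
  rw [Finset.sum_range_succ, ← count_plan hC k le_rfl, fullPlan, List.count_append,
    count_block (hC.order_perm _ _ _ _)]
  congr 1
  rw [finalCount, cnt, alloc, if_neg (lt_irrefl _)]
  rfl

end Learner

theorem pulls_eq_count {K : ℕ} {Obs : Type} (h : Hist K Obs) (k : Fin K) :
    pulls h k = (h.map Prod.fst).count k := by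
  rw [pulls, List.count, List.countP_map]
  refine List.countP_congr fun e _ => ?_
  simp

namespace Run

variable {d K : ℕ} {Obs : Type} {A : Learner d K Obs} {C : Choices K Obs} {u : Seed}
  {H : Hist K Obs} {r : Fin K → ℝ} {c : Fin d → Fin K → ℝ} {β V W Rm Cm : ℝ}
  (R : Run A C u H r c β V W Rm Cm)

include R

theorem cast_bounds : (0 : ℝ) < K ∧ (0 : ℝ) < A.T ∧ (1 : ℝ) ≤ K ∧ (K : ℝ) ≤ A.T :=
  cast_pos_of_le R.one_le_K R.K_le_T

theorem tp_mono {l l' : ℕ} (h : l ≤ l') : A.tp l ≤ A.tp l' := by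
  unfold Learner.tp
  exact_mod_cast tpt_mono R.one_le_K R.K_le_T h

theorem tp_pos {l : ℕ} (h : 1 ≤ l) : 1 ≤ A.tp l := by
  obtain ⟨l, rfl⟩ := Nat.exists_eq_add_of_le' h
  exact tpt_pos R.one_le_K R.K_le_T l

theorem tp_last : A.tp (A.ν + 1) = A.T := by
  rw [Learner.tp, tpt_last R.one_le_K R.K_le_T]

omit R in
theorem frac_eq (l : ℕ) : A.frac l = (A.tp (l + 1) - A.tp l) / A.T := rfl

theorem frac_nonneg (l : ℕ) : 0 ≤ A.frac l := by
  have := R.tp_mono (Nat.le_succ l)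
  rw [frac_eq]
  exact div_nonneg (sub_nonneg.2 this) (by positivity)

theorem gamma_pos : 0 < A.gamma := by linarith [R.half_le_gamma]

theorem B_nonneg (i : Fin d) : 0 ≤ A.B i :=
  le_trans (mul_nonneg R.β_pos.le (by positivity)) (R.B_ge i)

theorem Rm_nonneg : 0 ≤ Rm :=
  (R.r_nonneg ⟨0, R.one_le_K⟩).trans (R.r_le ⟨0, R.one_le_K⟩)

theorem lam_nonneg : 0 ≤ A.lam := by
  obtain ⟨h1, h2, h3, h4⟩ := R.cast_bounds
  apply Real.log_nonneg
  have h5 : (1 : ℝ) ≤ (d : ℝ) + 1 := by linarith [(Nat.cast_nonneg d : (0 : ℝ) ≤ d)]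
  have h6 : (1 : ℝ) ≤ (d + 1) * K := by nlinarith
  nlinarith

omit R in
theorem rad_nonneg (l : ℕ) : 0 ≤ A.rad l := by unfold Learner.rad; positivity

theorem contains_true (l : ℕ) : (A.state C u H l).bounds.Contains r c := by
  induction l with
  | zero => exact Learner.contains_initBounds R.r_nonneg R.c_nonneg
  | succ l ih =>
    exact A.contains_updateBounds ih (fun k hk => R.rew_true _ (A.data_prefix C u H l) k hk)
      fun i k hk => R.cost_true _ (A.data_prefix C u H l) i k hk

/-- Estimates from a later epoch lie within all earlier bounds; this is where the comparison with
later empirical means is needed. It makes the optimum of the last empirical program a point of the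
earlier exploration polytopes. -/
theorem contains_est {l l' : ℕ} (hl : l ≤ l') : (A.state C u H l).bounds.Contains
    (A.estRew (A.data C u H l')) (A.estCost (A.data C u H l')) := by
  induction l with
  | zero =>
    exact Learner.contains_initBounds (R.estRew_nonneg _ (A.data_prefix C u H l'))
      (R.estCost_nonneg _ (A.data_prefix C u H l'))
  | succ l ih =>
    have h1 := A.data_mono C u H (by omega : l ≤ l')
    exact A.contains_updateBounds (ih (by omega))
      (fun k hk => R.rew_later _ _ h1 (A.data_prefix C u H l') k hk)
      fun i k hk => R.cost_later _ _ h1 (A.data_prefix C u H l') i k hk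

omit R in
theorem expFeasible_antitone (hB : ∀ i, 0 ≤ A.B i) {l l' : ℕ} (h : l ≤ l') :
    A.expFeasible (A.state C u H l').bounds ⊆ A.expFeasible (A.state C u H l).bounds := by
  induction h with
  | refl => exact subset_rfl
  | step _ ih => exact (A.expFeasible_updateBounds_subset _ _ hB).trans ih

theorem pulls_data {l : ℕ} (hl : l ≤ A.ν) (hav : A.Avail C u H l) (k : Fin K) :
    pulls (A.data C u H l) k = ∑ l' ∈ Finset.range l, A.cnt C u H l' k := by
  rw [← Learner.count_plan R.valid k hl, pulls_eq_count, Learner.data, List.map_take, R.arms,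
    List.take_take, min_eq_left hav, ← List.prefix_iff_eq_take.1 (A.plan_prefix_fullPlan C u H hl)]

omit R in
theorem state_one_bounds : (A.state C u H 1).bounds = Learner.initBounds d K := by
  show A.updateBounds (Learner.initBounds d K) (H.take 0) = _
  rw [List.take_zero, Learner.updateBounds_nil]

/-- The upper reward bounds are still infinite, so a maximizer is exhibited explicitly instead of
being obtained from compactness. -/
theorem isExploreOpt_zero (j : Fin K) :
    A.IsExploreOpt (A.state C u H 1).bounds j (A.explo C u H 0 j) := by
  refine R.valid.explore_opt u H 0 R.one_le_ν j ⟨Pi.single j (A.T : ℝ), ?_⟩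
  rw [state_one_bounds]
  exact A.isExploreOpt_initBounds R.B_nonneg j

theorem le_explo_zero (k : Fin K) : (A.T : ℝ) ≤ A.explo C u H 0 k k := by
  have h := (R.isExploreOpt_zero k).2 (Pi.single k (A.T : ℝ)) ?_
  · simpa using h
  · rw [state_one_bounds]
    exact (A.isExploreOpt_initBounds R.B_nonneg k).1

/-- The `k`-th solution in the first epoch puts weight `T` on arm `k`, so the arm gets about `γ t_1
/ K` pulls. This reserve pays for all rounding losses in `pulls_ge`. -/
theorem first_count (k : Fin K) : 6 * Real.log A.T ≤ A.cnt C u H 0 k := by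
  obtain ⟨h1, h2, h3, h4⟩ := R.cast_bounds
  have h5 : A.gamma * (A.frac 0 * A.alloc C u H 0 k) < A.cnt C u H 0 k + 1 := Nat.lt_floor_add_one _
  have h6 : (A.T : ℝ) / K ≤ A.alloc C u H 0 k := by
    rw [Learner.alloc, if_pos (show 0 < A.ν from R.one_le_ν)]
    have := Finset.single_le_sum (f := fun j => 1 / (K : ℝ) * A.explo C u H 0 j k)
      (fun j _ => mul_nonneg (by positivity) ((R.isExploreOpt_zero j).1.1 k)) (Finset.mem_univ k)
    refine le_trans ?_ this
    have h7 := R.le_explo_zero k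
    rw [div_eq_mul_one_div, mul_comm]
    gcongr
  have h7 : A.frac 0 = A.tp 1 / A.T := by
    rw [frac_eq]; simp [Learner.tp, tpt]
  have h8 : 1 / 2 * (A.tp 1 / A.T * (A.T / K)) ≤ A.gamma * (A.frac 0 * A.alloc C u H 0 k) := by
    have := R.half_le_gamma
    have := R.tp_pos le_rfl
    rw [h7]
    gcongr
  have h9 : 1 / 2 * (A.tp 1 / A.T * (A.T / K)) = tpt K A.T A.ν 1 / (2 * K) := by
    rw [Learner.tp]; field_simp
  linarith [R.first_epoch]

theorem first_count_le_pulls {l : ℕ} (hl : l + 1 ≤ A.ν) (hav : A.Avail C u H (l + 1)) (k : Fin K) :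
    6 * Real.log A.T ≤ pulls (A.data C u H (l + 1)) k := by
  rw [R.pulls_data hl hav]
  refine (R.first_count k).trans ?_
  exact_mod_cast Finset.single_le_sum (f := fun l' => A.cnt C u H l' k) (fun _ _ => Nat.zero_le _)
    (Finset.mem_range.2 (Nat.succ_pos l))

theorem pulls_pos {l : ℕ} (hl : l + 1 ≤ A.ν) (hav : A.Avail C u H (l + 1)) (k : Fin K) :
    0 < pulls (A.data C u H (l + 1)) k := by
  have h1 := R.first_count_le_pulls hl hav k
  have h2 := R.one_le_log
  exact_mod_cast (by linarith : (0 : ℝ) < pulls (A.data C u H (l + 1)) k)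

/-- After the first epoch every arm has been pulled, which bounds the upper reward bounds from
above; the true rewards bound them from below. -/
theorem exists_Urew {l : ℕ} (hl : l + 1 ≤ A.ν) (hav : A.Avail C u H (l + 1)) :
    ∃ v : Fin K → ℝ, (∀ k, (A.state C u H (l + 2)).bounds.Urew k = (v k : EReal)) ∧
      ∀ k, v k ≤ A.estRew (A.data C u H (l + 1)) k +
        A.radRew k * A.radius (A.data C u H (l + 1)) k := by
  have h0 : ∀ k, (A.state C u H (l + 2)).bounds.Urew k =
      min ((A.estRew (A.data C u H (l + 1)) k +
        A.radRew k * A.radius (A.data C u H (l + 1)) k : ℝ) : EReal)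
        ((A.state C u H (l + 1)).bounds.Urew k) := by
    intro k
    show (A.updateBounds (A.state C u H (l + 1)).bounds (A.data C u H (l + 1))).Urew k = _
    simp only [Learner.updateBounds]
    rw [if_neg (R.pulls_pos hl hav k).ne']
  have h1 : ∀ k, (A.state C u H (l + 2)).bounds.Urew k ≤ ((A.estRew (A.data C u H (l + 1)) k +
        A.radRew k * A.radius (A.data C u H (l + 1)) k : ℝ) : EReal) := fun k => by
    rw [h0]; exact min_le_left _ _
  have h2 := (R.contains_true (l + 2)).le_Urew
  have h3 : ∀ k, (((A.state C u H (l + 2)).bounds.Urew k).toReal : EReal) =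
      (A.state C u H (l + 2)).bounds.Urew k := fun k =>
    EReal.coe_toReal ((h1 k).trans_lt (EReal.coe_lt_top _)).ne
      ((EReal.bot_lt_coe _).trans_le (h2 k)).ne'
  refine ⟨fun k => ((A.state C u H (l + 2)).bounds.Urew k).toReal, fun k => (h3 k).symm, fun k => ?_⟩
  have := h1 k
  rw [← h3 k] at this
  exact EReal.coe_le_coe_iff.1 this

theorem isLPOpt_mem {x : Fin K → ℝ} (hx : IsLPOpt A.T A.B r c x) (l : ℕ) :
    x ∈ A.expFeasible (A.state C u H l).bounds :=
  A.mem_expFeasible_of_isLPOpt R.B_nonneg (R.contains_true l) hx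

theorem isExploreOpt {l : ℕ} (hl : l < A.ν) (hav : A.Avail C u H l) (j : Fin K) :
    A.IsExploreOpt (A.state C u H (l + 1)).bounds j (A.explo C u H l j) := by
  cases l with
  | zero => exact R.isExploreOpt_zero j
  | succ l =>
    refine R.valid.explore_opt u H (l + 1) hl j ?_
    obtain ⟨v, hv, -⟩ := R.exists_Urew hl.le hav
    obtain ⟨x, hx⟩ := exists_isLPOpt A.T (by positivity) A.B R.B_nonneg r c
    exact A.exists_isExploreOpt hv ⟨x, R.isLPOpt_mem hx _⟩ j

theorem isLPOpt_final : IsLPOpt A.T A.B (A.estRew (A.data C u H A.ν))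
    (A.estCost (A.data C u H A.ν)) (C.final u (A.data C u H A.ν)) := by
  obtain ⟨⟨⟨h1, h2, h3⟩, h4⟩, -⟩ := R.valid.final_opt u (A.data C u H A.ν)
  exact ⟨h1, h2, h3, fun y g1 g2 g3 => h4 y ⟨g1, g2, g3⟩⟩

theorem alloc_nonneg {l : ℕ} (hl : l ≤ A.ν) (hav : A.Avail C u H l) (k : Fin K) :
    0 ≤ A.alloc C u H l k := by
  unfold Learner.alloc
  split_ifs with h
  · exact Finset.sum_nonneg fun j _ => mul_nonneg (by positivity) ((R.isExploreOpt h hav j).1.1 k)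
  · obtain rfl : l = A.ν := by omega
    exact R.isLPOpt_final.nonneg k

omit R in
theorem sum_alloc_eq {l : ℕ} (hl : l < A.ν) (f : Fin K → ℝ) :
    ∑ k, f k * A.alloc C u H l k =
      ∑ j, 1 / (K : ℝ) * ∑ k, f k * A.explo C u H l j k := by
  simp only [Learner.alloc, if_pos hl, Finset.mul_sum]
  rw [Finset.sum_comm]
  exact Finset.sum_congr rfl fun _ _ => Finset.sum_congr rfl fun _ _ => by ring

theorem avg_le {f : Fin K → ℝ} {a : ℝ} (h : ∀ j, f j ≤ a) : ∑ j, 1 / (K : ℝ) * f j ≤ a := by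
  obtain ⟨h1, -⟩ := R.cast_bounds
  calc ∑ j, 1 / (K : ℝ) * f j ≤ ∑ _j : Fin K, 1 / (K : ℝ) * a :=
        Finset.sum_le_sum fun j _ => mul_le_mul_of_nonneg_left (h j) (by positivity)
    _ = a := by simp; field_simp

theorem le_avg {f : Fin K → ℝ} {a : ℝ} (h : ∀ j, a ≤ f j) : a ≤ ∑ j, 1 / (K : ℝ) * f j := by
  obtain ⟨h1, -⟩ := R.cast_bounds
  calc a = ∑ _j : Fin K, 1 / (K : ℝ) * a := by simp; field_simp
    _ ≤ ∑ j, 1 / (K : ℝ) * f j :=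
        Finset.sum_le_sum fun j _ => mul_le_mul_of_nonneg_left (h j) (by positivity)

theorem sum_alloc_le {l : ℕ} (hl : l ≤ A.ν) (hav : A.Avail C u H l) :
    ∑ k, A.alloc C u H l k ≤ A.T := by
  by_cases h : l < A.ν
  · have h1 := sum_alloc_eq (C := C) (u := u) (H := H) h fun _ => 1
    simp only [one_mul] at h1
    rw [h1]
    exact R.avg_le fun j => (R.isExploreOpt h hav j).1.2.1
  · obtain rfl : l = A.ν := by omega
    simp only [Learner.alloc, lt_irrefl, if_false]
    exact R.isLPOpt_final.sum_le

theorem planned_nonneg {l : ℕ} (hl : l ≤ A.ν) (hav : A.Avail C u H l) (k : Fin K) :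
    0 ≤ A.gamma * (A.frac l * A.alloc C u H l k) :=
  mul_nonneg R.gamma_pos.le (mul_nonneg (R.frac_nonneg l) (R.alloc_nonneg hl hav k))

theorem cnt_le {l : ℕ} (hl : l ≤ A.ν) (hav : A.Avail C u H l) (k : Fin K) :
    (A.cnt C u H l k : ℝ) ≤ A.gamma * (A.frac l * A.alloc C u H l k) :=
  Nat.floor_le (R.planned_nonneg hl hav k)

/-- Rounding down loses at most `1` and at most the planned amount, which does not exceed the length
of the epoch. -/
theorem le_cnt {l : ℕ} (hl : l ≤ A.ν) (hav : A.Avail C u H l) (k : Fin K) :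
    A.gamma * (A.frac l * A.alloc C u H l k) - min 1 (A.tp (l + 1) - A.tp l) ≤ A.cnt C u H l k := by
  obtain ⟨h1, h2, h3, h4⟩ := R.cast_bounds
  have h5 : A.gamma * (A.frac l * A.alloc C u H l k) < A.cnt C u H l k + 1 := Nat.lt_floor_add_one _
  have h6 : A.alloc C u H l k ≤ A.T :=
    (Finset.single_le_sum (fun k _ => R.alloc_nonneg hl hav k) (Finset.mem_univ k)).trans
      (R.sum_alloc_le hl hav)
  have h7 : A.gamma * (A.frac l * A.alloc C u H l k) ≤ A.tp (l + 1) - A.tp l := by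
    have h8 := R.frac_nonneg l
    calc A.gamma * (A.frac l * A.alloc C u H l k) ≤ 1 * (A.frac l * A.T) := by
          have := R.gamma_le_one
          have := R.alloc_nonneg hl hav k
          gcongr
      _ = A.tp (l + 1) - A.tp l := by rw [frac_eq]; field_simp
  have h9 : (0 : ℝ) ≤ A.cnt C u H l k := by positivity
  rcases min_choice (1 : ℝ) (A.tp (l + 1) - A.tp l) with h | h <;> rw [h] <;> linarith

theorem sum_min : ∑ l ∈ Finset.range (A.ν + 1), min 1 (A.tp (l + 1) - A.tp l) ≤
    6 * Real.log A.T :=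
  sum_min_le_log R.one_le_K R.K_le_T R.one_le_log

/-- By nestedness the maximal weight of arm `k` was at least as large in all earlier epochs, so its
average allocation was at least the present maximum divided by `K`. With `γ ≥ 1/2` this plans twice
the claimed number of pulls, minus `6 log T` for rounding; the first epoch alone guarantees `6 log
T`, and the two bounds average to the claim. -/
theorem pulls_ge {l : ℕ} (hl : l < A.ν) (hav : A.Avail C u H (l + 1)) (k : Fin K) :
    A.tp (l + 1) * A.explo C u H l k k / (4 * A.T * K) ≤ pulls (A.data C u H (l + 1)) k := by
  obtain ⟨h1, h2, h3, h4⟩ := R.cast_bounds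
  have h5 := R.first_count_le_pulls hl hav k
  rw [R.pulls_data hl hav] at h5 ⊢
  push_cast at h5 ⊢
  have hx := (R.isExploreOpt hl (hav.mono (Nat.le_succ l)) k).1
  have h6 : ∀ l' ∈ Finset.range (l + 1), 1 / 2 * (A.frac l' * (A.explo C u H l k k / K)) -
      min 1 (A.tp (l' + 1) - A.tp l') ≤ A.cnt C u H l' k := by
    intro l' hl'
    have hl'' : l' ≤ l := Nat.lt_succ_iff.1 (Finset.mem_range.1 hl')
    have hav' : A.Avail C u H l' := hav.mono (by omega)
    refine le_trans ?_ (R.le_cnt (by omega) hav' k)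
    refine sub_le_sub_right ?_ _
    have h7 : A.explo C u H l k k / K ≤ A.alloc C u H l' k := by
      rw [Learner.alloc, if_pos (by omega)]
      have := Finset.single_le_sum (f := fun j => 1 / (K : ℝ) * A.explo C u H l' j k)
        (fun j _ => mul_nonneg (by positivity) ((R.isExploreOpt (by omega) hav' j).1.1 k))
        (Finset.mem_univ k)
      refine le_trans ?_ this
      have h8 := (R.isExploreOpt (by omega : l' < A.ν) hav' k).2 _
        (expFeasible_antitone R.B_nonneg (by omega : l' + 1 ≤ l + 1) hx)
      rw [div_eq_mul_one_div, mul_comm]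
      gcongr
    have := R.half_le_gamma
    have := R.frac_nonneg l'
    have := hx.1 k
    gcongr
  have h7 := Finset.sum_le_sum h6
  rw [Finset.sum_sub_distrib] at h7
  have h8 : ∑ l' ∈ Finset.range (l + 1), min 1 (A.tp (l' + 1) - A.tp l') ≤ 6 * Real.log A.T := by
    refine le_trans (Finset.sum_le_sum_of_subset_of_nonneg
      (Finset.range_subset_range.2 (by omega : l + 1 ≤ A.ν + 1)) fun l' _ _ => ?_) R.sum_min
    exact le_min zero_le_one (sub_nonneg.2 (R.tp_mono (Nat.le_succ l')))
  have h9 : ∑ l' ∈ Finset.range (l + 1), 1 / 2 * (A.frac l' * (A.explo C u H l k k / K)) =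
      2 * (A.tp (l + 1) * A.explo C u H l k k / (4 * A.T * K)) := by
    rw [← Finset.mul_sum, ← Finset.sum_mul]
    simp only [frac_eq]
    rw [← Finset.sum_div, Finset.sum_range_sub]
    have : A.tp 0 = 0 := by simp [Learner.tp, tpt]
    rw [this]
    field_simp
    ring
  rw [h9] at h7
  linarith

/-- By `pulls_ge`, the radius of arm `k` is at most a constant times `√(TK / (t M k))`, with `M k`
the largest weight in the polytope. The polytope is cut out by the total and by `d + 1` further
functionals, the optimistic reward and costs, so `sum_div_sqrt_le` yields `√((d+2)T)` and no factor
depending on `K`. -/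
theorem sum_radius_le {l : ℕ} (hl : l < A.ν) (hav : A.Avail C u H (l + 1)) {x : Fin K → ℝ}
    (hx : x ∈ A.expFeasible (A.state C u H (l + 1)).bounds) :
    ∑ k, A.radius (A.data C u H (l + 1)) k * x k ≤ A.rad (l + 1) := by
  obtain ⟨h1, h2, h3, h4⟩ := R.cast_bounds
  have hlam := R.lam_nonneg
  have htp := R.tp_pos (by omega : 1 ≤ l + 1)
  have havl : A.Avail C u H l := hav.mono (Nat.le_succ l)
  set M : Fin K → ℝ := fun k => A.explo C u H l k k with hM
  have hM0 : ∀ k, 0 ≤ M k := fun k => (R.isExploreOpt hl havl k).1.1 k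
  have hxM : ∀ y ∈ A.expFeasible (A.state C u H (l + 1)).bounds, ∀ k, y k ≤ M k :=
    fun y hy k => (R.isExploreOpt hl havl k).2 y hy
  have hterm : ∀ k, A.radius (A.data C u H (l + 1)) k * x k ≤
      √(A.lam * (4 * A.T * K / A.tp (l + 1))) * (x k / √(M k)) := by
    intro k
    rcases (hM0 k).eq_or_lt with h0 | h0
    · have : x k = 0 := le_antisymm (by rw [h0]; exact hxM x hx k) (hx.1 k)
      simp [this]
    · have h5 := R.pulls_ge hl hav k
      have h6 : 0 < A.tp (l + 1) * M k / (4 * A.T * K) := by positivity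
      have h7 : A.radius (A.data C u H (l + 1)) k ≤
          √(A.lam * (4 * A.T * K / A.tp (l + 1))) / √(M k) := by
        rw [← Real.sqrt_div' _ (hM0 k)]
        apply Real.sqrt_le_sqrt
        calc A.lam / (pulls (A.data C u H (l + 1)) k : ℝ) ≤
              A.lam / (A.tp (l + 1) * M k / (4 * A.T * K)) := by gcongr
          _ = A.lam * (4 * A.T * K / A.tp (l + 1)) / M k := by field_simp
      calc _ ≤ √(A.lam * (4 * A.T * K / A.tp (l + 1))) / √(M k) * x k :=
            mul_le_mul_of_nonneg_right h7 (hx.1 k)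
        _ = _ := by ring
  have hsum : ∑ k, x k / √(M k) ≤ √((((d + 1 : ℕ) : ℝ) + 1) * A.T) := by
    cases l with
    -- In the first epoch the reward functional is infinite, but `M k ≥ T`, so domination needs only
    -- the total and no functionals.
    | zero =>
      have h5 := sum_div_sqrt_le (m := 0) (fun i _ => i.elim0) (M := M) hx.1 hx.2.1
        (fun y hy0 hys _ k => ?_)
      · refine h5.trans (Real.sqrt_le_sqrt ?_)
        gcongr
        exact Nat.zero_le _
      · refine le_trans ?_ (R.le_explo_zero k)
        refine le_trans ?_ hx.2.1
        rw [← hys]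
        exact Finset.single_le_sum (fun k _ => hy0 k) (Finset.mem_univ k)
    | succ l =>
      obtain ⟨v, hv, -⟩ := R.exists_Urew hl.le havl
      refine sum_div_sqrt_le (m := d + 1)
        (Fin.cons v (A.state C u H (l + 2)).bounds.Lcost) hx.1 hx.2.1 fun y hy0 hys hyF => ?_
      refine hxM y ((A.mem_expFeasible_iff_of_finite hv y).2 ⟨hy0, ?_, ?_, fun i => ?_⟩)
      · rw [hys]; exact hx.2.1
      · have h5 := hyF 0
        simp only [Fin.cons_zero] at h5
        rw [h5]
        exact ((A.mem_expFeasible_iff_of_finite hv x).1 hx).2.2.1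
      · have h5 := hyF i.succ
        simp only [Fin.cons_succ] at h5
        rw [h5]
        exact hx.2.2.2 i
  calc ∑ k, A.radius (A.data C u H (l + 1)) k * x k
      ≤ ∑ k, √(A.lam * (4 * A.T * K / A.tp (l + 1))) * (x k / √(M k)) :=
        Finset.sum_le_sum fun k _ => hterm k
    _ = √(A.lam * (4 * A.T * K / A.tp (l + 1))) * ∑ k, x k / √(M k) := by rw [Finset.mul_sum]
    _ ≤ √(A.lam * (4 * A.T * K / A.tp (l + 1))) * √((((d + 1 : ℕ) : ℝ) + 1) * A.T) := by gcongr
    _ = A.rad (l + 1) := by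
        rw [← Real.sqrt_mul (by positivity), Learner.rad]
        have : A.lam * (4 * A.T * K / A.tp (l + 1)) * ((((d + 1 : ℕ) : ℝ) + 1) * A.T) =
            (2 * A.T) ^ 2 * (A.lam * (d + 2) * (K / A.tp (l + 1))) := by
          push_cast; ring
        rw [this, Real.sqrt_mul (by positivity), Real.sqrt_sq (by positivity)]

end Run

end LimitedSwitch

end

/-! ### Clean runs: budget and revenue -/

noncomputable section

namespace LimitedSwitch

namespace Learner

variable {d K : ℕ} {Obs : Type} (A : Learner d K Obs)

/-- The accumulated confidence radii of all epochs but the first. -/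
def err : ℝ := ∑ l ∈ Finset.range A.ν, A.frac (l + 1) * A.rad (l + 1)

end Learner

namespace Run

variable {d K : ℕ} {Obs : Type} {A : Learner d K Obs} {C : Choices K Obs} {u : Seed}
  {H : Hist K Obs} {r : Fin K → ℝ} {c : Fin d → Fin K → ℝ} {β V W Rm Cm : ℝ}
  (R : Run A C u H r c β V W Rm Cm)

omit R in
theorem radius_nonneg (h : Hist K Obs) (k : Fin K) : 0 ≤ A.radius h k := Real.sqrt_nonneg _

include R

theorem rew_dev {h : Hist K Obs} (hh : h <+: H) {k : Fin K} (hk : 0 < pulls h k) :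
    |r k - A.estRew h k| ≤ W * A.radius h k :=
  (R.rew_true h hh k hk).trans (mul_le_mul_of_nonneg_right (R.radRew_le k) (radius_nonneg _ _))

theorem cost_dev {h : Hist K Obs} (hh : h <+: H) (i : Fin d) {k : Fin K} (hk : 0 < pulls h k) :
    |c i k - A.estCost h i k| ≤ V * A.radius h k :=
  (R.cost_true h hh i k hk).trans (mul_le_mul_of_nonneg_right (R.radCost_le i) (radius_nonneg _ _))

/-- The new bounds are within `2Vρ` and `2Wρ` of the truth. The exploration solution and the true
optimum both lie in the polytope of the preceding epoch, so their radii sum to at most `rad`. The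
reward loses `2W` by replacing optimistic by true rewards, and `2W + 2V Rm / β` in the pessimistic
value, which is tested on a scaled copy of `x`. -/
theorem explo_loss {l : ℕ} (hl : l + 1 < A.ν) (hav : A.Avail C u H (l + 1)) {x : Fin K → ℝ}
    (hx : IsLPOpt A.T A.B r c x) (j : Fin K) :
    (∀ i, ∑ k, c i k * A.explo C u H (l + 1) j k ≤ A.B i + 2 * V * A.rad (l + 1)) ∧
    ∑ k, r k * x k - (4 * W + 2 * V * Rm / β) * A.rad (l + 1) ≤
      ∑ k, r k * A.explo C u H (l + 1) j k := by
  obtain ⟨h1, h2, h3, h4⟩ := R.cast_bounds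
  have hopt := (R.isExploreOpt hl hav j).1
  have hopt' := expFeasible_antitone R.B_nonneg (Nat.le_succ (l + 1)) hopt
  have hrad := R.sum_radius_le (by omega) hav hopt'
  have hradx := R.sum_radius_le (by omega) hav (R.isLPOpt_mem hx (l + 1))
  have hdp := A.data_prefix C u H (l + 1)
  have hpp := R.pulls_pos hl.le hav
  set ρ : Fin K → ℝ := A.radius (A.data C u H (l + 1)) with hρ
  set z := A.explo C u H (l + 1) j with hz
  have hρ0 : ∀ k, 0 ≤ ρ k := radius_nonneg _
  have hb : (A.state C u H (l + 2)).bounds =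
      A.updateBounds (A.state C u H (l + 1)).bounds (A.data C u H (l + 1)) := rfl
  have hLcost : ∀ i k, c i k - 2 * V * ρ k ≤ (A.state C u H (l + 2)).bounds.Lcost i k := by
    intro i k
    rw [hb]
    simp only [Learner.updateBounds]
    rw [if_neg (hpp k).ne']
    have e1 := abs_le.1 (R.cost_dev hdp i (hpp k))
    have e2 := mul_le_mul_of_nonneg_right (R.radCost_le i) (hρ0 k)
    exact le_max_of_le_left (by linarith [e1.2])
  have hUcost : ∀ i k, (A.state C u H (l + 2)).bounds.Ucost i k ≤
      ((c i k + 2 * V * ρ k : ℝ) : EReal) := by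
    intro i k
    rw [hb]
    simp only [Learner.updateBounds]
    rw [if_neg (hpp k).ne']
    have e1 := abs_le.1 (R.cost_dev hdp i (hpp k))
    have e2 := mul_le_mul_of_nonneg_right (R.radCost_le i) (hρ0 k)
    exact min_le_of_left_le (EReal.coe_le_coe_iff.2 (by linarith [e1.1]))
  have hLrew : ∀ k, r k - 2 * W * ρ k ≤ (A.state C u H (l + 2)).bounds.Lrew k := by
    intro k
    rw [hb]
    simp only [Learner.updateBounds]
    rw [if_neg (hpp k).ne']
    have e1 := abs_le.1 (R.rew_dev hdp (hpp k))
    have e2 := mul_le_mul_of_nonneg_right (R.radRew_le k) (hρ0 k)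
    exact le_max_of_le_left (by linarith [e1.2])
  constructor
  · intro i
    have e1 : ∀ k, c i k * z k ≤
        (A.state C u H (l + 2)).bounds.Lcost i k * z k + 2 * V * (ρ k * z k) := by
      intro k
      have := mul_le_mul_of_nonneg_right (hLcost i k) (hopt.1 k)
      linarith
    refine (Finset.sum_le_sum fun k _ => e1 k).trans ?_
    rw [Finset.sum_add_distrib, ← Finset.mul_sum]
    exact add_le_add (hopt.2.2.2 i)
      (mul_le_mul_of_nonneg_left hrad (by linarith [R.V_nonneg]))
  · obtain ⟨v, hv, hvle⟩ := R.exists_Urew (by omega : l + 1 ≤ A.ν) hav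
    obtain ⟨y, hy0, hys, hyc, hyr⟩ := exists_scaled (V := 2 * V) (W := 2 * W) (r' :=
      (A.state C u H (l + 2)).bounds.Lrew) (c' := fun i k => c i k + 2 * V * ρ k) h2 R.β_pos
      (by linarith [R.V_nonneg]) (by linarith [R.W_nonneg]) (rad_nonneg (l + 1)) R.B_ge
      R.r_le R.Rm_nonneg hx.nonneg hx.sum_le hx.cost_le hradx (fun _ _ => le_rfl) hLrew
    have hJ : ∑ k, (A.state C u H (l + 2)).bounds.Lrew k * y k ≤
        A.Jpes (A.state C u H (l + 2)).bounds := by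
      refine A.le_Jpes ⟨hy0, hys, fun i => (sum_coe_mul_le hy0 (hUcost i)).trans ?_⟩
      rw [← coe_sum_mul]
      exact EReal.coe_le_coe_iff.2 (hyc i)
    have hJ2 := ((A.mem_expFeasible_iff_of_finite hv _).1 hopt).2.2.1
    have hJ3 : ∑ k, v k * z k ≤ ∑ k, r k * z k + 2 * W * A.rad (l + 1) := by
      have e1 : ∀ k, v k * z k ≤ r k * z k + 2 * W * (ρ k * z k) := by
        intro k
        have e1 := abs_le.1 (R.rew_dev hdp (hpp k))
        have e2 := mul_le_mul_of_nonneg_right (R.radRew_le k) (hρ0 k)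
        have : v k ≤ r k + 2 * W * ρ k := (hvle k).trans (by linarith [e1.1])
        have := mul_le_mul_of_nonneg_right this (hopt.1 k)
        linarith
      refine (Finset.sum_le_sum fun k _ => e1 k).trans ?_
      rw [Finset.sum_add_distrib, ← Finset.mul_sum]
      have := mul_le_mul_of_nonneg_left hrad (by linarith [R.W_nonneg] : 0 ≤ 2 * W)
      linarith
    have e3 : (4 * W + 2 * V * Rm / β) * A.rad (l + 1) =
        (2 * W + 2 * V * Rm / β) * A.rad (l + 1) + 2 * W * A.rad (l + 1) := by ring
    linarith

/-- The same comparison for the empirical program. Its optimum belongs to the last exploration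
polytope by `contains_est`, and this controls its radii. The constants are not the best ones here;
they are chosen to agree with those of the exploration epochs. -/
theorem final_loss (hav : A.Avail C u H A.ν) {x : Fin K → ℝ}
    (hx : IsLPOpt A.T A.B r c x) :
    (∀ i, ∑ k, c i k * C.final u (A.data C u H A.ν) k ≤ A.B i + 2 * V * A.rad A.ν) ∧
    ∑ k, r k * x k - (4 * W + 2 * V * Rm / β) * A.rad A.ν ≤
      ∑ k, r k * C.final u (A.data C u H A.ν) k := by
  obtain ⟨h1, h2, h3, h4⟩ := R.cast_bounds
  obtain ⟨l, hl⟩ := Nat.exists_eq_add_of_le' R.one_le_ν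
  have hfin := R.isLPOpt_final
  have hmem := A.mem_expFeasible_of_isLPOpt R.B_nonneg
    (R.contains_est (by omega : l + 1 ≤ A.ν)) hfin
  have hdp := A.data_prefix C u H A.ν
  have hrad : ∑ k, A.radius (A.data C u H A.ν) k * C.final u (A.data C u H A.ν) k ≤ A.rad A.ν := by
    have hav' := hav
    rw [hl] at hav'
    have h5 := R.sum_radius_le (by omega : l < A.ν) hav' hmem
    rwa [← hl] at h5
  have hradx : ∑ k, A.radius (A.data C u H A.ν) k * x k ≤ A.rad A.ν := by
    have hav' := hav
    rw [hl] at hav'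
    have h5 := R.sum_radius_le (by omega : l < A.ν) hav' (R.isLPOpt_mem hx (l + 1))
    rwa [← hl] at h5
  have hpp : ∀ k, 0 < pulls (A.data C u H A.ν) k := by
    have hav' := hav
    rw [hl] at hav'
    have h5 := R.pulls_pos (by omega : l + 1 ≤ A.ν) hav'
    rwa [← hl] at h5
  set ρ : Fin K → ℝ := A.radius (A.data C u H A.ν) with hρ
  set z := C.final u (A.data C u H A.ν) with hz
  have hcd := fun i k => abs_le.1 (R.cost_dev hdp i (hpp k))
  have hrd := fun k => abs_le.1 (R.rew_dev hdp (hpp k))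
  have hVr := mul_nonneg R.V_nonneg (rad_nonneg (A := A) A.ν)
  have hWr := mul_nonneg R.W_nonneg (rad_nonneg (A := A) A.ν)
  constructor
  · intro i
    have e1 : ∀ k, c i k * z k ≤ A.estCost (A.data C u H A.ν) i k * z k + V * (ρ k * z k) := by
      intro k
      have : c i k ≤ A.estCost (A.data C u H A.ν) i k + V * ρ k := by linarith [(hcd i k).2]
      have := mul_le_mul_of_nonneg_right this (hfin.nonneg k)
      linarith
    refine (Finset.sum_le_sum fun k _ => e1 k).trans ?_
    rw [Finset.sum_add_distrib, ← Finset.mul_sum]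
    have := mul_le_mul_of_nonneg_left hrad R.V_nonneg
    linarith [hfin.cost_le i]
  · obtain ⟨y, hy0, hys, hyc, hyr⟩ := exists_scaled (r' := A.estRew (A.data C u H A.ν))
      (c' := A.estCost (A.data C u H A.ν)) h2 R.β_pos
      R.V_nonneg R.W_nonneg (rad_nonneg A.ν) R.B_ge
      R.r_le R.Rm_nonneg hx.nonneg hx.sum_le hx.cost_le hradx
      (fun i k => by linarith [(hcd i k).1]) (fun k => by linarith [(hrd k).2])
    have e0 := hfin.opt y hy0 hys hyc
    have e1 : ∀ k, A.estRew (A.data C u H A.ν) k * z k ≤ r k * z k + W * (ρ k * z k) := by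
      intro k
      have : A.estRew (A.data C u H A.ν) k ≤ r k + W * ρ k := by linarith [(hrd k).1]
      have := mul_le_mul_of_nonneg_right this (hfin.nonneg k)
      linarith
    have e2 := Finset.sum_le_sum fun k (_ : k ∈ Finset.univ) => e1 k
    rw [Finset.sum_add_distrib, ← Finset.mul_sum] at e2
    have e3 := mul_le_mul_of_nonneg_left hrad R.W_nonneg
    have e4 : (4 * W + 2 * V * Rm / β) * A.rad A.ν = (W + V * Rm / β) * A.rad A.ν +
        W * A.rad A.ν + 2 * (W * A.rad A.ν) + V * A.rad A.ν * Rm / β := by ring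
    have e5 : 0 ≤ V * A.rad A.ν * Rm / β :=
      div_nonneg (mul_nonneg hVr R.Rm_nonneg) R.β_pos.le
    linarith

theorem alloc_loss {l : ℕ} (hl : l + 1 ≤ A.ν) (hav : A.Avail C u H (l + 1)) {x : Fin K → ℝ}
    (hx : IsLPOpt A.T A.B r c x) :
    (∀ i, ∑ k, c i k * A.alloc C u H (l + 1) k ≤ A.B i + 2 * V * A.rad (l + 1)) ∧
    ∑ k, r k * x k - (4 * W + 2 * V * Rm / β) * A.rad (l + 1) ≤
      ∑ k, r k * A.alloc C u H (l + 1) k := by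
  rcases hl.lt_or_eq with h | h
  · simp only [sum_alloc_eq h]
    exact ⟨fun i => R.avg_le fun j => (R.explo_loss h hav hx j).1 i,
      R.le_avg fun j => (R.explo_loss h hav hx j).2⟩
  · rw [h] at hav ⊢
    simp only [Learner.alloc, lt_irrefl, if_false]
    exact R.final_loss hav hx

omit R in
-- The budget has to be controlled before it is known that the plan is completed, so the analysis
-- first fixes the epoch in which the history ends.
theorem exists_current : ∃ l ≤ A.ν, A.Avail C u H l ∧ (l < A.ν → ¬ A.Avail C u H (l + 1)) := by
  generalize A.ν = N
  induction N with
  | zero => exact ⟨0, le_rfl, by simp [Learner.Avail, Learner.state], by simp⟩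
  | succ N ih =>
    obtain ⟨l, hl, h1, h2⟩ := ih
    rcases hl.lt_or_eq with h | rfl
    · exact ⟨l, by omega, h1, fun _ => h2 h⟩
    · by_cases h3 : A.Avail C u H (l + 1)
      · exact ⟨l + 1, le_rfl, h3, by simp⟩
      · exact ⟨l, by omega, h1, fun _ => h3⟩

theorem pulls_le {l : ℕ} (hl : l ≤ A.ν) (hn : l < A.ν → ¬ A.Avail C u H (l + 1)) (k : Fin K) :
    pulls H k ≤ ∑ l' ∈ Finset.range (l + 1), A.cnt C u H l' k := by
  rw [pulls_eq_count]
  rcases hl.lt_or_eq with h | rfl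
  · rw [← Learner.count_plan R.valid k (by omega : l + 1 ≤ A.ν), R.arms]
    have h1 : H.length < (A.state C u H (l + 1)).plan.length := not_le.1 (hn h)
    exact (List.prefix_of_prefix_length_le (List.take_prefix _ _)
      (A.plan_prefix_fullPlan C u H (by omega : l + 1 ≤ A.ν))
      ((List.length_take_le _ _).trans h1.le)).sublist.count_le k
  · rw [← Learner.count_fullPlan R.valid k, R.arms]
    exact (List.take_sublist _ _).count_le k

omit R in
theorem sum_frac {N : ℕ} : ∑ l ∈ Finset.range N, A.frac l = A.tp N / A.T := by
  simp only [frac_eq]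
  rw [← Finset.sum_div, Finset.sum_range_sub]
  simp [Learner.tp, tpt]

theorem sum_cnt_le {l : ℕ} (hl : l ≤ A.ν) (hav : A.Avail C u H l) :
    ∑ k, ∑ l' ∈ Finset.range (l + 1), A.cnt C u H l' k ≤ A.T := by
  obtain ⟨h1, h2, h3, h4⟩ := R.cast_bounds
  have : (∑ k, ∑ l' ∈ Finset.range (l + 1), (A.cnt C u H l' k : ℝ)) ≤ A.T := by
    rw [Finset.sum_comm]
    calc ∑ l' ∈ Finset.range (l + 1), ∑ k, (A.cnt C u H l' k : ℝ)
        ≤ ∑ l' ∈ Finset.range (l + 1), A.frac l' * A.T := by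
          refine Finset.sum_le_sum fun l' hl' => ?_
          have hl'' : l' ≤ l := Nat.lt_succ_iff.1 (Finset.mem_range.1 hl')
          have hav' := hav.mono hl''
          refine (Finset.sum_le_sum fun k _ => R.cnt_le (by omega) hav' k).trans ?_
          rw [← Finset.mul_sum, ← Finset.mul_sum]
          have e1 := R.sum_alloc_le (by omega) hav'
          have e2 := R.frac_nonneg l'
          have e3 := mul_le_mul_of_nonneg_left e1 e2
          have e4 : 0 ≤ A.frac l' * ∑ k, A.alloc C u H l' k :=
            mul_nonneg e2 (Finset.sum_nonneg fun k _ => R.alloc_nonneg (by omega) hav' k)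
          exact (mul_le_of_le_one_left e4 R.gamma_le_one).trans e3
      _ = A.tp (l + 1) := by
          rw [← Finset.sum_mul, sum_frac]; field_simp
      _ ≤ A.T := by
          rw [← R.tp_last]; exact R.tp_mono (by omega)
  exact_mod_cast this

/-- The first epoch is uninformed and is charged the maximal cost in each of its periods. Later
epochs use `γ B i` in proportion to their length, plus the overspending from `alloc_loss`. -/
theorem sum_planned_cost_le {l : ℕ} (hl : l ≤ A.ν) (hav : A.Avail C u H l) (i : Fin d) :
    ∑ k, c i k * ∑ l' ∈ Finset.range (l + 1), (A.cnt C u H l' k : ℝ) ≤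
      A.gamma * A.B i + A.tp 1 * Cm + 2 * V * A.err := by
  obtain ⟨h1, h2, h3, h4⟩ := R.cast_bounds
  obtain ⟨x, hx⟩ := exists_isLPOpt A.T (by positivity) A.B R.B_nonneg r c
  have hCm : 0 ≤ Cm := (R.c_nonneg i ⟨0, R.one_le_K⟩).trans (R.c_le i ⟨0, R.one_le_K⟩)
  have hterm : ∀ l' ∈ Finset.range (l + 1), ∑ k, c i k * (A.cnt C u H l' k : ℝ) ≤
      A.gamma * A.frac l' * ∑ k, c i k * A.alloc C u H l' k := by
    intro l' hl'
    have hl'' : l' ≤ l := Nat.lt_succ_iff.1 (Finset.mem_range.1 hl')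
    rw [Finset.mul_sum]
    refine Finset.sum_le_sum fun k _ => ?_
    have := mul_le_mul_of_nonneg_left (R.cnt_le (by omega) (hav.mono hl'') k) (R.c_nonneg i k)
    linarith
  have hBi := R.B_nonneg i
  have hγ := R.gamma_pos
  have hfirst : A.gamma * A.frac 0 * ∑ k, c i k * A.alloc C u H 0 k ≤ A.tp 1 * Cm := by
    have e1 : ∑ k, c i k * A.alloc C u H 0 k ≤ Cm * A.T := by
      refine (Finset.sum_le_sum fun k _ => mul_le_mul_of_nonneg_right (R.c_le i k)
        (R.alloc_nonneg (Nat.zero_le _) (hav.mono (Nat.zero_le _)) k)).trans ?_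
      rw [← Finset.mul_sum]
      exact mul_le_mul_of_nonneg_left (R.sum_alloc_le (Nat.zero_le _)
        (hav.mono (Nat.zero_le _))) hCm
    have e2 : A.frac 0 = A.tp 1 / A.T := by rw [frac_eq]; simp [Learner.tp, tpt]
    have e3 := R.frac_nonneg 0
    calc A.gamma * A.frac 0 * ∑ k, c i k * A.alloc C u H 0 k ≤ 1 * A.frac 0 * (Cm * A.T) := by
          have := R.gamma_le_one
          have : 0 ≤ ∑ k, c i k * A.alloc C u H 0 k := Finset.sum_nonneg fun k _ =>
            mul_nonneg (R.c_nonneg i k) (R.alloc_nonneg (Nat.zero_le _)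
              (hav.mono (Nat.zero_le _)) k)
          gcongr
      _ = A.tp 1 * Cm := by rw [e2]; field_simp
  have hrest : ∀ l' ∈ Finset.range l,
      A.gamma * A.frac (l' + 1) * ∑ k, c i k * A.alloc C u H (l' + 1) k ≤
      A.gamma * A.B i * A.frac (l' + 1) + 2 * V * (A.frac (l' + 1) * A.rad (l' + 1)) := by
    intro l' hl'
    have hl'' : l' + 1 ≤ l := Finset.mem_range.1 hl'
    have e1 := (R.alloc_loss (by omega) (hav.mono hl'') hx).1 i
    have e2 := R.frac_nonneg (l' + 1)
    have e3 := mul_le_mul_of_nonneg_left e1 (mul_nonneg hγ.le e2)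
    have e4 : 0 ≤ 2 * V * (A.frac (l' + 1) * A.rad (l' + 1)) :=
      mul_nonneg (by linarith [R.V_nonneg]) (mul_nonneg e2 (rad_nonneg _))
    have e5 := mul_le_of_le_one_left e4 R.gamma_le_one
    linarith
  calc ∑ k, c i k * ∑ l' ∈ Finset.range (l + 1), (A.cnt C u H l' k : ℝ)
      = ∑ l' ∈ Finset.range (l + 1), ∑ k, c i k * (A.cnt C u H l' k : ℝ) := by
        simp only [Finset.mul_sum]
        rw [Finset.sum_comm]
    _ ≤ ∑ l' ∈ Finset.range (l + 1), A.gamma * A.frac l' * ∑ k, c i k * A.alloc C u H l' k :=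
        Finset.sum_le_sum hterm
    _ ≤ ∑ l' ∈ Finset.range l, (A.gamma * A.B i * A.frac (l' + 1) +
          2 * V * (A.frac (l' + 1) * A.rad (l' + 1))) + A.tp 1 * Cm := by
        rw [Finset.sum_range_succ']
        exact add_le_add (Finset.sum_le_sum hrest) hfirst
    _ ≤ A.gamma * A.B i + 2 * V * A.err + A.tp 1 * Cm := by
        rw [Finset.sum_add_distrib, ← Finset.mul_sum, ← Finset.mul_sum]
        have e1 : ∑ l' ∈ Finset.range l, A.frac (l' + 1) ≤ 1 := by
          have e2 : ∑ l' ∈ Finset.range (l + 1), A.frac l' ≤ 1 := by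
            rw [sum_frac, div_le_one h2, ← R.tp_last]
            exact R.tp_mono (by omega)
          rw [Finset.sum_range_succ'] at e2
          linarith [R.frac_nonneg 0]
        have e3 : ∑ l' ∈ Finset.range l, A.frac (l' + 1) * A.rad (l' + 1) ≤ A.err :=
          Finset.sum_le_sum_of_subset_of_nonneg (Finset.range_subset_range.2 hl)
            fun l' _ _ => mul_nonneg (R.frac_nonneg _) (rad_nonneg _)
        have e4 := mul_le_mul_of_nonneg_left e1 (mul_nonneg hγ.le hBi)
        have e5 := mul_le_mul_of_nonneg_left e3 (by linarith [R.V_nonneg] : 0 ≤ 2 * V)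
        linarith
    _ = _ := by ring

/-- The revenue of the first epoch is discarded, which explains the factor `1 - t_1 / T`. Rounding
loses at most `Rm` per arm in an epoch, in total `6 K Rm log T` by `sum_min`. -/
theorem sum_planned_rew_ge (hav : A.Avail C u H A.ν) {x : Fin K → ℝ}
    (hx : IsLPOpt A.T A.B r c x) :
    A.gamma * (1 - A.tp 1 / A.T) * ∑ k, r k * x k - (4 * W + 2 * V * Rm / β) * A.err -
      6 * K * Rm * Real.log A.T ≤
      ∑ k, r k * ∑ l' ∈ Finset.range (A.ν + 1), (A.cnt C u H l' k : ℝ) := by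
  obtain ⟨h1, h2, h3, h4⟩ := R.cast_bounds
  have hγ := R.gamma_pos
  have hRm := R.Rm_nonneg
  have hmin0 : ∀ l, 0 ≤ min 1 (A.tp (l + 1) - A.tp l) := fun l =>
    le_min zero_le_one (sub_nonneg.2 (R.tp_mono (Nat.le_succ l)))
  have hterm : ∀ l' ∈ Finset.range (A.ν + 1), A.gamma * A.frac l' * ∑ k, r k * A.alloc C u H l' k -
      K * Rm * min 1 (A.tp (l' + 1) - A.tp l') ≤ ∑ k, r k * (A.cnt C u H l' k : ℝ) := by
    intro l' hl'
    have hl'' : l' ≤ A.ν := Nat.lt_succ_iff.1 (Finset.mem_range.1 hl')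
    have e1 : ∀ k, A.gamma * A.frac l' * (r k * A.alloc C u H l' k) -
        Rm * min 1 (A.tp (l' + 1) - A.tp l') ≤ r k * (A.cnt C u H l' k : ℝ) := by
      intro k
      have := mul_le_mul_of_nonneg_left (R.le_cnt hl'' (hav.mono hl'') k) (R.r_nonneg k)
      have := mul_le_mul_of_nonneg_right (R.r_le k) (hmin0 l')
      linarith
    refine le_trans (le_of_eq ?_) (Finset.sum_le_sum fun k _ => e1 k)
    rw [Finset.sum_sub_distrib, ← Finset.mul_sum]
    simp
    ring
  have hfirst : 0 ≤ A.gamma * A.frac 0 * ∑ k, r k * A.alloc C u H 0 k :=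
    mul_nonneg (mul_nonneg hγ.le (R.frac_nonneg 0)) (Finset.sum_nonneg fun k _ =>
      mul_nonneg (R.r_nonneg k) (R.alloc_nonneg (Nat.zero_le _) (hav.mono (Nat.zero_le _)) k))
  have hCR : 0 ≤ 4 * W + 2 * V * Rm / β := by
    have := R.W_nonneg
    have := R.V_nonneg
    have := R.β_pos
    positivity
  have hrest : ∀ l' ∈ Finset.range A.ν,
      A.gamma * (∑ k, r k * x k) * A.frac (l' + 1) -
        (4 * W + 2 * V * Rm / β) * (A.frac (l' + 1) * A.rad (l' + 1)) ≤
      A.gamma * A.frac (l' + 1) * ∑ k, r k * A.alloc C u H (l' + 1) k := by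
    intro l' hl'
    have hl'' : l' + 1 ≤ A.ν := Finset.mem_range.1 hl'
    have e1 := (R.alloc_loss (by omega) (hav.mono hl'') hx).2
    have e2 := R.frac_nonneg (l' + 1)
    have e3 := mul_le_mul_of_nonneg_left e1 (mul_nonneg hγ.le e2)
    have e4 : 0 ≤ (4 * W + 2 * V * Rm / β) * (A.frac (l' + 1) * A.rad (l' + 1)) :=
      mul_nonneg hCR (mul_nonneg e2 (rad_nonneg _))
    have e5 := mul_le_of_le_one_left e4 R.gamma_le_one
    linarith
  have hsum : ∑ l' ∈ Finset.range A.ν, A.frac (l' + 1) = 1 - A.tp 1 / A.T := by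
    have e1 := sum_frac (A := A) (N := A.ν + 1)
    rw [Finset.sum_range_succ', R.tp_last, div_self h2.ne'] at e1
    have e2 : A.frac 0 = A.tp 1 / A.T := by rw [frac_eq]; simp [Learner.tp, tpt]
    linarith
  calc _ ≤ ∑ l' ∈ Finset.range A.ν, (A.gamma * (∑ k, r k * x k) * A.frac (l' + 1) -
        (4 * W + 2 * V * Rm / β) * (A.frac (l' + 1) * A.rad (l' + 1))) -
        K * Rm * ∑ l' ∈ Finset.range (A.ν + 1), min 1 (A.tp (l' + 1) - A.tp l') := by
        rw [Finset.sum_sub_distrib, ← Finset.mul_sum, ← Finset.mul_sum, hsum]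
        have := mul_le_mul_of_nonneg_left R.sum_min (mul_nonneg h1.le hRm)
        have e : A.err = ∑ l' ∈ Finset.range A.ν, A.frac (l' + 1) * A.rad (l' + 1) := rfl
        rw [e]
        linarith
    _ ≤ ∑ l' ∈ Finset.range (A.ν + 1), A.gamma * A.frac l' * ∑ k, r k * A.alloc C u H l' k -
        K * Rm * ∑ l' ∈ Finset.range (A.ν + 1), min 1 (A.tp (l' + 1) - A.tp l') := by
        rw [Finset.sum_range_succ' (fun l' => A.gamma * A.frac l' * ∑ k, r k * A.alloc C u H l' k)]
        have := Finset.sum_le_sum hrest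
        linarith
    _ = ∑ l' ∈ Finset.range (A.ν + 1), (A.gamma * A.frac l' * ∑ k, r k * A.alloc C u H l' k -
        K * Rm * min 1 (A.tp (l' + 1) - A.tp l')) := by
        rw [Finset.sum_sub_distrib, Finset.mul_sum]
    _ ≤ ∑ l' ∈ Finset.range (A.ν + 1), ∑ k, r k * (A.cnt C u H l' k : ℝ) :=
        Finset.sum_le_sum hterm
    _ = _ := by
        simp only [Finset.mul_sum]
        rw [Finset.sum_comm]

omit R in
theorem sum_pulls : ∑ k, pulls H k = H.length := by
  simp only [pulls_eq_count]
  rw [← length_eq_sum_count, List.length_map]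

/-- Each term is `√(lam · n_k)`, and Cauchy–Schwarz applies. This is the price of passing from
planned mean amounts to realized ones. -/
theorem sum_pulls_radius_le (hH : H.length ≤ A.T) :
    ∑ k, (pulls H k : ℝ) * A.radius H k ≤ √(A.lam * K * A.T) := by
  have hlam := R.lam_nonneg
  have h1 : ∀ k, (pulls H k : ℝ) * A.radius H k = √(A.lam * pulls H k) := by
    intro k
    show (pulls H k : ℝ) * √(A.lam / pulls H k) = _
    rcases (Nat.cast_nonneg (α := ℝ) (pulls H k)).eq_or_lt with h | h
    · rw [← h]; simp
    · nth_rewrite 1 [← Real.sqrt_sq h.le]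
      rw [← Real.sqrt_mul (by positivity)]
      congr 1
      field_simp
  simp only [h1]
  refine (sum_sqrt_le Finset.univ fun k => by positivity).trans (Real.sqrt_le_sqrt ?_)
  rw [← Finset.mul_sum]
  have h2 : (∑ k, (pulls H k : ℝ)) = H.length := by exact_mod_cast sum_pulls
  have h3 : (H.length : ℝ) ≤ A.T := by exact_mod_cast hH
  rw [h2, Finset.card_univ, Fintype.card_fin]
  calc (K : ℝ) * (A.lam * H.length) ≤ K * (A.lam * A.T) := by gcongr
    _ = _ := by ring

/-- On a clean history no resource is exhausted and the revenue is close to the optimal value of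
the deterministic linear program. -/
theorem withinBudget_and_revenue_ge {E : Env d K Obs} (hEB : E.B = A.B) (hH : H.length ≤ A.T)
    (hend : H.length = A.T ∨ ¬ E.WithinBudget H ∨ (A.fullPlan C u H)[H.length]? = none)
    (hcost : ∀ i, (H.map fun e => E.cost i e.1 e.2).sum = ∑ k, (pulls H k : ℝ) * A.estCost H i k)
    (hrew : (H.map fun e => E.rew e.1 e.2).sum = ∑ k, (pulls H k : ℝ) * A.estRew H k)
    (hbudget : ∀ i, A.gamma * A.B i + A.tp 1 * Cm + 2 * V * A.err + V * √(A.lam * K * A.T) ≤ A.B i)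
    {x : Fin K → ℝ} (hx : IsLPOpt A.T A.B r c x) :
    E.WithinBudget H ∧ A.gamma * (1 - A.tp 1 / A.T) * ∑ k, r k * x k -
      (4 * W + 2 * V * Rm / β) * A.err - 6 * K * Rm * Real.log A.T - W * √(A.lam * K * A.T) ≤
      (H.map fun e => E.rew e.1 e.2).sum := by
  have hrad := R.sum_pulls_radius_le hH
  obtain ⟨l, hl, hav, hn⟩ := exists_current
  have hW : E.WithinBudget H := by
    intro i
    rw [hcost i, hEB]
    refine le_trans ?_ (hbudget i)
    have e1 : ∀ k, (pulls H k : ℝ) * A.estCost H i k ≤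
        c i k * ∑ l' ∈ Finset.range (l + 1), (A.cnt C u H l' k : ℝ) +
          V * ((pulls H k : ℝ) * A.radius H k) := by
      intro k
      have e2 : (pulls H k : ℝ) ≤ ∑ l' ∈ Finset.range (l + 1), (A.cnt C u H l' k : ℝ) := by
        exact_mod_cast R.pulls_le hl hn k
      have e3 := mul_le_mul_of_nonneg_left e2 (R.c_nonneg i k)
      rcases Nat.eq_zero_or_pos (pulls H k) with h0 | h0
      · rw [h0] at e3 ⊢
        simp only [Nat.cast_zero, zero_mul, mul_zero] at e3 ⊢
        linarith
      · have e4 := (abs_le.1 (R.cost_dev List.prefix_rfl i h0)).1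
        have e5 : A.estCost H i k ≤ c i k + V * A.radius H k := by linarith
        have e6 := mul_le_mul_of_nonneg_left e5 (Nat.cast_nonneg (α := ℝ) (pulls H k))
        linarith
    refine (Finset.sum_le_sum fun k _ => e1 k).trans ?_
    rw [Finset.sum_add_distrib, ← Finset.mul_sum]
    exact add_le_add (R.sum_planned_cost_le hl hav i)
      (mul_le_mul_of_nonneg_left hrad R.V_nonneg)
  -- As the budget holds, the history ended at the horizon or at the end of the plan. The planned
  -- counts add up to at most `T`, so in both cases the plan was completed.
  have hdone : (A.fullPlan C u H).length ≤ H.length := by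
    rcases hend with h | h | h
    · rcases hl.lt_or_eq with h' | h'
      · exfalso
        apply hn h'
        show (A.state C u H (l + 1)).plan.length ≤ H.length
        rw [h, length_eq_sum_count]
        simp only [Learner.count_plan R.valid _ (by omega : l + 1 ≤ A.ν)]
        exact R.sum_cnt_le hl hav
      · rw [h, length_eq_sum_count]
        simp only [Learner.count_fullPlan R.valid]
        rw [← h']
        exact R.sum_cnt_le hl hav
    · exact absurd hW h
    · exact List.getElem?_eq_none_iff.1 h
  have hav : A.Avail C u H A.ν := (A.plan_prefix_fullPlan C u H le_rfl).length_le.trans hdone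
  have hpulls : ∀ k, pulls H k = ∑ l' ∈ Finset.range (A.ν + 1), A.cnt C u H l' k := by
    intro k
    rw [← Learner.count_fullPlan R.valid k, pulls_eq_count, R.arms, List.take_of_length_le hdone]
  refine ⟨hW, ?_⟩
  have e0 := R.sum_planned_rew_ge hav hx
  have e1 : ∀ k, r k * ∑ l' ∈ Finset.range (A.ν + 1), (A.cnt C u H l' k : ℝ) -
      W * ((pulls H k : ℝ) * A.radius H k) ≤ (pulls H k : ℝ) * A.estRew H k := by
    intro k
    have e2 : (∑ l' ∈ Finset.range (A.ν + 1), (A.cnt C u H l' k : ℝ)) = pulls H k := by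
      rw [hpulls]; push_cast; rfl
    rw [e2]
    rcases Nat.eq_zero_or_pos (pulls H k) with h0 | h0
    · simp [h0]
    · have e4 := (abs_le.1 (R.rew_dev List.prefix_rfl h0)).2
      have e5 : r k - W * A.radius H k ≤ A.estRew H k := by linarith
      have e6 := mul_le_mul_of_nonneg_left e5 (Nat.cast_nonneg (α := ℝ) (pulls H k))
      linarith
  have e2 := Finset.sum_le_sum fun k (_ : k ∈ Finset.univ) => e1 k
  rw [Finset.sum_sub_distrib, ← Finset.mul_sum, ← hrew] at e2
  have e3 := mul_le_mul_of_nonneg_left hrad R.W_nonneg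
  linarith

theorem err_le : A.err ≤ 6 * √(A.lam * (d + 2)) * (1 + √(Real.log A.T)) * tau K A.T A.ν 0 := by
  obtain ⟨h1, h2, h3, h4⟩ := R.cast_bounds
  have hlam := R.lam_nonneg
  have hT2 : 2 ≤ A.T := by
    by_contra h
    have : A.T = 0 ∨ A.T = 1 := by omega
    have h5 := R.one_le_log
    rcases this with h | h <;> rw [h] at h5 <;> norm_num at h5
  have e1 := sum_epoch_le R.one_le_K R.K_le_T (ν := A.ν) hT2
  have e2 : A.err = 2 * √(A.lam * (d + 2)) * ∑ i ∈ Finset.range A.ν,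
      ((tpt K A.T A.ν (i + 2) : ℝ) - tpt K A.T A.ν (i + 1)) * √(K / tpt K A.T A.ν (i + 1)) := by
    rw [Learner.err, Finset.mul_sum]
    refine Finset.sum_congr rfl fun i _ => ?_
    rw [frac_eq, Learner.rad, Real.sqrt_mul (by positivity)]
    simp only [Learner.tp]
    field_simp
  rw [e2]
  have e3 := mul_le_mul_of_nonneg_left e1 (by positivity : 0 ≤ 2 * √(A.lam * (d + 2)))
  linarith

end Run

end LimitedSwitch

end

noncomputable section

namespace LimitedSwitch

/-! ### Empirical means -/

section Means

variable {K : ℕ} {Obs : Type}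

theorem empMean_affine {f Y : Obs → ℝ} {a w : ℝ} {h : Hist K Obs} {k : Fin K}
    (hf : ∀ e ∈ h, e.1 = k → f e.2 = a + w * Y e.2) (hk : 0 < pulls h k) :
    empMean f h k = a + w * empMean Y h k := by
  have h1 : (samples f h k).sum = a * pulls h k + w * (samples Y h k).sum := by
    clear hk
    induction h using List.reverseRecOn with
    | nil => simp [samples, pulls]
    | append_singleton h e ih =>
      have ih' := ih fun e he => hf e (List.mem_append_left _ he)
      rw [← length_samples f, samples_concat, samples_concat]
      rw [← length_samples f] at ih'
      by_cases he : e.1 = k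
      · simp only [he, if_true, List.sum_append, List.sum_singleton, List.length_append,
          List.length_singleton, ih', hf e (by simp) he]
        push_cast
        ring
      · simp [he, ih']
  have hk' : (0 : ℝ) < pulls h k := by exact_mod_cast hk
  rw [empMean_eq, empMean_eq, h1]
  field_simp

theorem sum_map_eq_sum_pulls (f : Fin K → Obs → ℝ) (h : Hist K Obs) :
    (h.map fun e => f e.1 e.2).sum = ∑ k, (pulls h k : ℝ) * empMean (f k) h k := by
  have h1 : ∀ k, (pulls h k : ℝ) * empMean (f k) h k = (samples (f k) h k).sum := by
    intro k
    rw [empMean_eq]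
    rcases Nat.eq_zero_or_pos (pulls h k) with h0 | h0
    · rw [← length_samples (f k)] at h0
      simp [List.length_eq_zero_iff.1 h0]
    · have hk' : (0 : ℝ) < pulls h k := by exact_mod_cast h0
      field_simp
  simp only [h1]
  clear h1
  induction h using List.reverseRecOn with
  | nil => simp [samples]
  | append_singleton h e ih =>
    simp only [List.map_append, List.sum_append, ih, samples_concat, Finset.sum_add_distrib]
    congr 1
    have : ∀ k, (if e.1 = k then [f k e.2] else []).sum = if e.1 = k then f k e.2 else 0 := by
      intro k; split_ifs <;> simp
    simp [this]

theorem empMean_nonneg {f : Obs → ℝ} {h : Hist K Obs} {k : Fin K}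
    (hf : ∀ e ∈ h, e.1 = k → 0 ≤ f e.2) : 0 ≤ empMean f h k := by
  rw [empMean_eq]
  refine div_nonneg (List.sum_nonneg fun y hy => ?_) (by positivity)
  simp only [samples, List.mem_map, List.mem_filter, decide_eq_true_eq] at hy
  obtain ⟨e, ⟨he, hek⟩, rfl⟩ := hy
  exact hf e he hek

theorem sum_map_fst (m : Fin K → ℝ) (h : Hist K Obs) :
    (h.map fun e => m e.1).sum = ∑ k, m k * pulls h k := by
  induction h with
  | nil => simp [pulls]
  | cons e h ih =>
    simp only [List.map_cons, List.sum_cons, ih, pulls, List.countP_cons, decide_eq_true_eq]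
    push_cast
    simp only [mul_add, Finset.sum_add_distrib]
    simp [add_comm]

end Means

/-! ### Expectations over histories -/

namespace Env

variable {d K : ℕ} {Obs : Type} [MeasurableSpace Obs] (E : Env d K Obs)
  (D : Fin K → Measure Obs) [∀ k, IsProbabilityMeasure (D k)]

theorem ae_outcome {P : Fin K → Obs → Prop} (h : ∀ k, ∀ᵐ o ∂D k, P k o) :
    ∀ᵐ x ∂E.law D, ∀ j k, P k (x.2 j k) := by
  rw [ae_all_iff]
  intro j
  rw [ae_all_iff]
  intro k
  have h1 : MeasurePreserving
      (Prod.snd : Seed × (Fin E.T → Fin K → Obs) → _) (E.law D) (Measure.pi fun _ => Measure.pi D) :=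
    measurePreserving_snd
  have h2 := (measurePreserving_eval D k).comp
    ((measurePreserving_eval (fun _ : Fin E.T => Measure.pi D) j).comp h1)
  exact h2.quasiMeasurePreserving.ae (h k)

theorem ae_hist {P : Fin K → Obs → Prop} (h : ∀ k, ∀ᵐ o ∂D k, P k o) (φ : Policy K Obs) (t : ℕ) :
    ∀ᵐ x ∂E.law D, ∀ e ∈ E.hist φ x.1 x.2 t, P e.1 e.2 := by
  filter_upwards [E.ae_outcome D h] with x hx e he
  obtain ⟨j, hj⟩ := E.exists_of_mem_hist φ x.1 x.2 t he
  rw [hj]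
  exact hx j e.1

theorem list_sum_le {α : Type*} {l : List α} {f : α → ℝ} {b : ℝ} (h : ∀ a ∈ l, f a ≤ b) :
    (l.map f).sum ≤ l.length * b := by
  have := List.sum_le_card_nsmul (l.map f) b (by simpa using h)
  simpa using this

theorem measurable_sum_hist (hE : ∀ i k, Measurable (E.cost i k)) (φ : Policy K Obs) (t : ℕ)
    {f : Fin K → Obs → ℝ} (hf : ∀ k, Measurable (f k)) :
    Measurable fun x : Seed × (Fin E.T → Fin K → Obs) =>
      ((E.hist φ x.1 x.2 t).map fun e => f e.1 e.2).sum :=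
  E.measurable_hist hE φ t (MeasurableHist.const (F := fun h => (h.map fun e => f e.1 e.2).sum)
    fun t => measurable_list_sum_ofFn (measurable_uncurry_fin hf) t)

theorem sum_hist_mem {f : Fin K → Obs → ℝ} {b : ℝ} (hb : 0 ≤ b)
    (hfb : ∀ k, ∀ᵐ o ∂D k, 0 ≤ f k o ∧ f k o ≤ b) (φ : Policy K Obs) {t : ℕ} :
    ∀ᵐ x ∂E.law D, 0 ≤ ((E.hist φ x.1 x.2 t).map fun e => f e.1 e.2).sum ∧
      ((E.hist φ x.1 x.2 t).map fun e => f e.1 e.2).sum ≤ t * b := by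
  filter_upwards [E.ae_hist D hfb φ t] with x hx
  refine ⟨List.sum_nonneg fun y hy => ?_, (list_sum_le fun e he => (hx e he).2).trans ?_⟩
  · obtain ⟨e, he, rfl⟩ := List.mem_map.1 hy
    exact (hx e he).1
  · have := E.length_hist_le φ x.1 x.2 t
    gcongr

theorem integrable_sum_hist (hE : ∀ i k, Measurable (E.cost i k)) {f : Fin K → Obs → ℝ}
    (hf : ∀ k, Measurable (f k)) {b : ℝ} (hb : 0 ≤ b)
    (hfb : ∀ k, ∀ᵐ o ∂D k, 0 ≤ f k o ∧ f k o ≤ b) (φ : Policy K Obs) (t : ℕ) :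
    Integrable (fun x => ((E.hist φ x.1 x.2 t).map fun e => f e.1 e.2).sum) (E.law D) := by
  refine Integrable.of_bound (E.measurable_sum_hist hE φ t hf).aestronglyMeasurable (t * b) ?_
  filter_upwards [E.sum_hist_mem D hb hfb φ] with x hx
  rw [Real.norm_eq_abs, abs_of_nonneg hx.1]
  exact hx.2

theorem integral_sum_hist (hE : ∀ i k, Measurable (E.cost i k)) {f : Fin K → Obs → ℝ}
    (hf : ∀ k, Measurable (f k)) {b : ℝ} (hb : 0 ≤ b)
    (hfb : ∀ k, ∀ᵐ o ∂D k, 0 ≤ f k o ∧ f k o ≤ b) (φ : Policy K Obs) {t : ℕ} (ht : t ≤ E.T) :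
    ∫ x, ((E.hist φ x.1 x.2 t).map fun e => f e.1 e.2).sum ∂E.law D =
      ∑ k, (∫ o, f k o ∂D k) * ∫ x, (pulls (E.hist φ x.1 x.2 t) k : ℝ) ∂E.law D := by
  have hm0 : ∀ k, 0 ≤ ∫ o, f k o ∂D k := fun k =>
    integral_nonneg_of_ae ((hfb k).mono fun o h => h.1)
  have hm1 : ∀ k, ∫⁻ o, ENNReal.ofReal (f k o) ∂D k = ENNReal.ofReal (∫ o, f k o ∂D k) := by
    intro k
    rw [ofReal_integral_eq_lintegral_ofReal _ ((hfb k).mono fun o h => h.1)]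
    refine Integrable.of_bound (hf k).aestronglyMeasurable b ?_
    filter_upwards [hfb k] with o ho
    rw [Real.norm_eq_abs, abs_of_nonneg ho.1]
    exact ho.2
  have hofReal : ∀ (l : Hist K Obs) (g : Fin K × Obs → ℝ), (∀ e ∈ l, 0 ≤ g e) →
      ENNReal.ofReal (l.map g).sum = (l.map fun e => ENNReal.ofReal (g e)).sum := by
    intro l g hg
    induction l with
    | nil => simp
    | cons e l ih =>
      have hl : ∀ e ∈ l, 0 ≤ g e := fun e he => hg e (List.mem_cons_of_mem _ he)
      simp only [List.map_cons, List.sum_cons]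
      rw [ENNReal.ofReal_add (hg e (by simp)) (List.sum_nonneg fun y hy => by
        obtain ⟨e, he, rfl⟩ := List.mem_map.1 hy
        exact hl e he), ih hl]
  have hpm : ∀ k, Measurable fun x : Seed × (Fin E.T → Fin K → Obs) =>
      (pulls (E.hist φ x.1 x.2 t) k : ℝ) := by
    intro k
    have h1 := E.measurable_sum_hist hE φ t (f := fun k' _ => if k' = k then (1 : ℝ) else 0)
      fun _ => measurable_const
    convert h1 using 2 with x
    rw [sum_map_fst (fun k' => if k' = k then (1 : ℝ) else 0)]
    simp
  have hpb : ∀ k, Integrable (fun x => (pulls (E.hist φ x.1 x.2 t) k : ℝ)) (E.law D) := by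
    intro k
    refine Integrable.of_bound (hpm k).aestronglyMeasurable t (Filter.Eventually.of_forall fun x => ?_)
    rw [Real.norm_eq_abs, abs_of_nonneg (by positivity)]
    exact_mod_cast (pulls_le_length _ _).trans (E.length_hist_le φ x.1 x.2 t)
  have hrhs : ∑ k, (∫ o, f k o ∂D k) * ∫ x, (pulls (E.hist φ x.1 x.2 t) k : ℝ) ∂E.law D =
      ∫ x, ((E.hist φ x.1 x.2 t).map fun e => ∫ o, f e.1 o ∂D e.1).sum ∂E.law D := by
    simp only [sum_map_fst (fun k => ∫ o, f k o ∂D k)]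
    rw [integral_finsetSum _ fun k _ => (hpb k).const_mul _]
    simp only [integral_const_mul]
  rw [hrhs, integral_eq_lintegral_of_nonneg_ae, integral_eq_lintegral_of_nonneg_ae]
  · congr 1
    have e1 : ∫⁻ x, ENNReal.ofReal ((E.hist φ x.1 x.2 t).map fun e => f e.1 e.2).sum ∂E.law D =
        ∫⁻ x, ((E.hist φ x.1 x.2 t).map fun e => ENNReal.ofReal (f e.1 e.2)).sum ∂E.law D := by
      refine lintegral_congr_ae ?_
      filter_upwards [E.ae_hist D hfb φ t] with x hx
      exact hofReal _ _ fun e he => (hx e he).1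
    rw [e1, E.lintegral_sum_hist D hE φ ht fun k => (hf k).ennreal_ofReal]
    refine lintegral_congr fun x => ?_
    simp only [hm1]
    exact (hofReal _ (fun e => ∫ o, f e.1 o ∂D e.1) fun e _ => hm0 e.1).symm
  · refine Filter.Eventually.of_forall fun x => List.sum_nonneg fun y hy => ?_
    obtain ⟨e, -, rfl⟩ := List.mem_map.1 hy
    exact hm0 e.1
  · exact (E.measurable_sum_hist hE φ t (f := fun k _ => ∫ o, f k o ∂D k)
      fun _ => measurable_const).aestronglyMeasurable
  · exact (E.sum_hist_mem D hb hfb φ).mono fun x hx => hx.1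
  · exact (E.measurable_sum_hist hE φ t hf).aestronglyMeasurable

theorem measurable_revenue (hE : ∀ i k, Measurable (E.cost i k)) (hr : ∀ k, Measurable (E.rew k))
    (φ : Policy K Obs) (t : ℕ) :
    Measurable fun x : Seed × (Fin E.T → Fin K → Obs) => E.revenue (E.hist φ x.1 x.2 t) := by
  classical
  refine E.measurable_hist hE φ t (MeasurableHist.const (F := E.revenue) fun t => ?_)
  have hfold : ∀ l : Hist K Obs, (l.map fun e => E.rew e.1 e.2).sum =
      l.foldl (fun s e => s + E.rew e.1 e.2) 0 := by
    intro l
    rw [List.sum_eq_foldl, List.foldl_map]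
  have htake : ∀ i, Measurable fun p : Fin t → Fin K × Obs =>
      (((List.ofFn p).take i).map fun e => E.rew e.1 e.2).sum := by
    intro i
    simp only [hfold]
    refine measurable_foldl_take_ofFn ?_ 0 t i
    exact measurable_fst.add ((measurable_uncurry_fin hr).comp measurable_snd)
  have : (fun p : Fin t → Fin K × Obs => E.revenue (List.ofFn p)) = fun p =>
      if E.WithinBudget (List.ofFn p) then (((List.ofFn p).take t).map fun e => E.rew e.1 e.2).sum
      else (((List.ofFn p).take (t - 1)).map fun e => E.rew e.1 e.2).sum := by
    funext p
    rw [revenue]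
    split_ifs
    · rw [List.take_of_length_le (by simp)]
    · rw [List.dropLast_eq_take]
      simp
  rw [this]
  exact Measurable.ite (E.measurableSet_withinBudget hE t) (htake _) (htake _)

omit [MeasurableSpace Obs] in
theorem revenue_nonneg_le {h : Hist K Obs} (hh : ∀ e ∈ h, 0 ≤ E.rew e.1 e.2) :
    0 ≤ E.revenue h ∧ E.revenue h ≤ (h.map fun e => E.rew e.1 e.2).sum := by
  have h1 : ∀ l : Hist K Obs, (∀ e ∈ l, 0 ≤ E.rew e.1 e.2) →
      0 ≤ (l.map fun e => E.rew e.1 e.2).sum := by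
    intro l hl
    refine List.sum_nonneg fun y hy => ?_
    obtain ⟨e, he, rfl⟩ := List.mem_map.1 hy
    exact hl e he
  rw [revenue]
  split_ifs
  · exact ⟨h1 _ hh, le_rfl⟩
  · refine ⟨h1 _ fun e he => hh e (List.mem_of_mem_dropLast he), ?_⟩
    rcases List.eq_nil_or_concat h with rfl | ⟨l, e, rfl⟩
    · simp
    · simp only [List.concat_eq_append, List.dropLast_concat, List.map_append, List.sum_append]
      have := hh e (by simp)
      simpa using this

/-- The revenue of any policy is at most the optimal value of the deterministic linear program, up
to the effect of the last period. -/
theorem Rev_le (hE : ∀ i k, Measurable (E.cost i k)) (hr : ∀ k, Measurable (E.rew k))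
    {Rm Cm β : ℝ} (hRm : 0 ≤ Rm) (hCm : 0 ≤ Cm) (hβ : 0 < β) (hT : 0 < E.T)
    (hB : ∀ i, β * E.T ≤ E.B i)
    (hrew : ∀ k, ∀ᵐ o ∂D k, 0 ≤ E.rew k o ∧ E.rew k o ≤ Rm)
    (hcost : ∀ i k, ∀ᵐ o ∂D k, 0 ≤ E.cost i k o ∧ E.cost i k o ≤ Cm) {x : Fin K → ℝ}
    (hx : IsLPOpt E.T E.B (fun k => ∫ o, E.rew k o ∂D k) (fun i k => ∫ o, E.cost i k o ∂D k) x)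
    (φ : Policy K Obs) :
    E.Rev D φ ≤ ∑ k, (∫ o, E.rew k o ∂D k) * x k + Cm * Rm / β := by
  have hT' : (0 : ℝ) < E.T := by exact_mod_cast hT
  set z : Fin K → ℝ := fun k => ∫ x, (pulls (E.hist φ x.1 x.2 E.T) k : ℝ) ∂E.law D with hz
  have hz0 : ∀ k, 0 ≤ z k := fun k => integral_nonneg fun x => by positivity
  have hr0 : ∀ k, 0 ≤ ∫ o, E.rew k o ∂D k := fun k =>
    integral_nonneg_of_ae ((hrew k).mono fun o h => h.1)
  have hrle : ∀ k, ∫ o, E.rew k o ∂D k ≤ Rm := by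
    intro k
    have := integral_mono_of_nonneg ((hrew k).mono fun o h => h.1) (integrable_const Rm)
      ((hrew k).mono fun o h => h.2)
    simpa using this
  have hzs : ∑ k, z k ≤ E.T := by
    have h1 := E.integral_sum_hist D hE (f := fun _ _ => 1) (fun _ => measurable_const)
      zero_le_one (fun k => by simp) φ le_rfl
    simp only [integral_const, probReal_univ, smul_eq_mul, one_mul] at h1
    rw [← h1]
    calc _ ≤ ∫ x, (E.T : ℝ) ∂E.law D := by
          refine integral_mono_of_nonneg (Filter.Eventually.of_forall fun x => ?_)
            (integrable_const _) (Filter.Eventually.of_forall fun x => ?_)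
          · simp
          · simpa using E.length_hist_le φ x.1 x.2 E.T
      _ = E.T := by simp
  -- Without its last period every history is within budget, so the overshoot is at most one
  -- period's cost.
  have hzc : ∀ i, ∑ k, (∫ o, E.cost i k o ∂D k) * z k ≤ E.B i + Cm := by
    intro i
    have hBi : 0 ≤ E.B i := le_trans (by positivity) (hB i)
    rw [← E.integral_sum_hist D hE (hE i) hCm (hcost i) φ le_rfl]
    calc _ ≤ ∫ x, (E.B i + Cm) ∂E.law D := by
          refine integral_mono_of_nonneg ((E.sum_hist_mem D hCm (hcost i) φ).mono fun x h => h.1)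
            (integrable_const _) ?_
          filter_upwards [E.ae_hist D (hcost i) φ E.T] with x hx
          rcases List.eq_nil_or_concat (E.hist φ x.1 x.2 E.T) with h | ⟨l, e, h⟩
          · rw [h]; simp; linarith
          · have h1 := E.withinBudget_dropLast_hist φ x.1 x.2 E.T (by rw [h]; simp) i
            have h2 := (hx e (by rw [h]; simp)).2
            rw [h] at h1 ⊢
            simp only [List.concat_eq_append, List.dropLast_concat, List.map_append,
              List.sum_append, List.map_cons, List.map_nil, List.sum_singleton] at h1 ⊢
            linarith
      _ = _ := by simp
  have hrev : E.Rev D φ ≤ ∑ k, (∫ o, E.rew k o ∂D k) * z k := by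
    rw [← E.integral_sum_hist D hE hr hRm hrew φ le_rfl, Rev]
    refine integral_mono_of_nonneg ?_ (E.integrable_sum_hist D hE hr hRm hrew φ E.T) ?_
    · filter_upwards [E.ae_hist D hrew φ E.T] with x hx
      exact (E.revenue_nonneg_le fun e he => (hx e he).1).1
    · filter_upwards [E.ae_hist D hrew φ E.T] with x hx
      exact (E.revenue_nonneg_le fun e he => (hx e he).1).2
  have hβT : 0 < β * E.T := by positivity
  -- Shrinking the expected pull counts by `θ` absorbs the overshoot `Cm` and makes them feasible;
  -- the loss is `(1 - θ) Rm T ≤ Cm Rm / β`.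
  set θ := β * E.T / (β * E.T + Cm) with hθ
  have hθ0 : 0 ≤ θ := by positivity
  have hθ1 : θ ≤ 1 := by rw [hθ, div_le_one (by positivity)]; linarith
  have hθeq : θ * Cm = (1 - θ) * (β * E.T) := by rw [hθ]; field_simp; ring
  have hswap : ∀ f : Fin K → ℝ, ∑ k, f k * (θ * z k) = θ * ∑ k, f k * z k := by
    intro f
    rw [Finset.mul_sum]
    exact Finset.sum_congr rfl fun k _ => by ring
  have hopt := hx.opt (fun k => θ * z k) (fun k => mul_nonneg hθ0 (hz0 k))
    (by
      rw [← Finset.mul_sum]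
      have : 0 ≤ ∑ k, z k := Finset.sum_nonneg fun k _ => hz0 k
      nlinarith)
    (fun i => by
      rw [hswap]
      have h2 := mul_le_mul_of_nonneg_left (hzc i) hθ0
      have h3 := mul_le_mul_of_nonneg_left (hB i) (sub_nonneg.2 hθ1)
      nlinarith)
  rw [hswap] at hopt
  have hJ : ∑ k, (∫ o, E.rew k o ∂D k) * z k ≤ Rm * E.T := by
    refine (Finset.sum_le_sum fun k _ => mul_le_mul_of_nonneg_right (hrle k) (hz0 k)).trans ?_
    rw [← Finset.mul_sum]
    gcongr
  have h1 : (1 - θ) * ∑ k, (∫ o, E.rew k o ∂D k) * z k ≤ Cm * Rm / β := by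
    have hθle : 1 - θ ≤ Cm / (β * E.T) := by
      rw [le_div_iff₀ hβT, ← hθeq]
      nlinarith
    calc _ ≤ (1 - θ) * (Rm * E.T) := mul_le_mul_of_nonneg_left hJ (sub_nonneg.2 hθ1)
      _ ≤ Cm / (β * E.T) * (Rm * E.T) := by gcongr
      _ = _ := by field_simp
  linarith

theorem Rev_nonneg {Rm : ℝ} (hrew : ∀ k, ∀ᵐ o ∂D k, 0 ≤ E.rew k o ∧ E.rew k o ≤ Rm)
    (φ : Policy K Obs) : 0 ≤ E.Rev D φ := by
  refine integral_nonneg_of_ae ?_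
  filter_upwards [E.ae_hist D hrew φ E.T] with x hx
  exact (E.revenue_nonneg_le fun e he => (hx e he).1).1

/-- A lower bound on the revenue outside an event gives a lower bound on the expected revenue. -/
theorem Rev_ge (hE : ∀ i k, Measurable (E.cost i k)) (hr : ∀ k, Measurable (E.rew k))
    {Rm : ℝ} (hRm : 0 ≤ Rm) (hrew : ∀ k, ∀ᵐ o ∂D k, 0 ≤ E.rew k o ∧ E.rew k o ≤ Rm)
    (φ : Policy K Obs) {S : Set (Seed × (Fin E.T → Fin K → Obs))} (hS : MeasurableSet S) {a : ℝ}
    (ha : a ≤ Rm * E.T)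
    (h : ∀ᵐ x ∂E.law D, x ∉ S → a ≤ E.revenue (E.hist φ x.1 x.2 E.T)) :
    a - Rm * E.T * (E.law D).real S ≤ E.Rev D φ := by
  have hint : Integrable (fun x => E.revenue (E.hist φ x.1 x.2 E.T)) (E.law D) := by
    refine (E.integrable_sum_hist D hE hr hRm hrew φ E.T).mono'
      (E.measurable_revenue hE hr φ E.T).aestronglyMeasurable ?_
    filter_upwards [E.ae_hist D hrew φ E.T] with x hx
    have := E.revenue_nonneg_le fun e he => (hx e he).1
    rw [Real.norm_eq_abs, abs_of_nonneg this.1]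
    exact this.2
  have hI : Integrable (fun x => a - S.indicator (fun _ => Rm * (E.T : ℝ)) x) (E.law D) :=
    (integrable_const a).sub ((integrable_const _).indicator hS)
  calc a - Rm * E.T * (E.law D).real S
      = ∫ x, (a - S.indicator (fun _ => Rm * (E.T : ℝ)) x) ∂E.law D := by
        rw [integral_sub (integrable_const a) ((integrable_const _).indicator hS),
          integral_indicator_const _ hS]
        simp [mul_comm]
    _ ≤ E.Rev D φ := by
        refine integral_mono_ae hI hint ?_
        filter_upwards [h, E.ae_hist D hrew φ E.T] with x hx hx'
        by_cases hxS : x ∈ S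
        · have := (E.revenue_nonneg_le fun e he => (hx' e he).1).1
          simp only [Set.indicator_of_mem hxS]
          linarith
        · simp only [Set.indicator_of_notMem hxS, sub_zero]
          exact hx hxS

end Env

end LimitedSwitch

end

noncomputable section

namespace LimitedSwitch

/-! ### The rate -/

/-- The factor `√(d log (dKT))` of the rate. -/
def width (d K T : ℕ) : ℝ := √((d : ℝ) * Real.log ((d : ℝ) * K * T))

/-- The regret bound without its constant. -/
def rate (d K T ν : ℕ) : ℝ := width d K T * Real.log T * tau K T ν 0

theorem regretBound_eq (c : ℝ) (T K d s : ℕ) :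
    regretBound c T K d s = c * rate d K T (nu s d K) := by
  rw [regretBound, rate, width, tau, timeExp_zero]
  ring

section Rate

variable {d K T ν : ℕ}

theorem cast_sizes (hd : 1 ≤ d) (hK : d + 1 < K) (hT : 2 ≤ T) :
    (1 : ℝ) ≤ d ∧ (d : ℝ) + 2 ≤ K ∧ (2 : ℝ) ≤ T := by
  refine ⟨by exact_mod_cast hd, ?_, by exact_mod_cast hT⟩
  exact_mod_cast (by omega : d + 2 ≤ K)

theorem six_le_prod (hd : 1 ≤ d) (hK : d + 1 < K) (hT : 2 ≤ T) : (6 : ℝ) ≤ (d : ℝ) * K * T := by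
  obtain ⟨h1, h2, h3⟩ := cast_sizes hd hK hT
  nlinarith [mul_nonneg (by linarith : (0 : ℝ) ≤ d - 1) (by linarith : (0 : ℝ) ≤ K - 3)]

theorem one_le_log_prod (hd : 1 ≤ d) (hK : d + 1 < K) (hT : 2 ≤ T) :
    1 ≤ Real.log ((d : ℝ) * K * T) := by
  have h := six_le_prod hd hK hT
  rw [Real.le_log_iff_exp_le (by linarith)]
  linarith [Real.exp_one_lt_d9]

theorem one_le_width (hd : 1 ≤ d) (hK : d + 1 < K) (hT : 2 ≤ T) : 1 ≤ width d K T := by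
  obtain ⟨h1, h2, h3⟩ := cast_sizes hd hK hT
  rw [width, Real.one_le_sqrt]
  nlinarith [one_le_log_prod hd hK hT]

theorem width_sq (hd : 1 ≤ d) (hK : d + 1 < K) (hT : 2 ≤ T) :
    width d K T ^ 2 = d * Real.log ((d : ℝ) * K * T) :=
  Real.sq_sqrt (mul_nonneg (Nat.cast_nonneg _) (by linarith [one_le_log_prod hd hK hT]))

theorem log_two_lower (hT : 2 ≤ T) : 0.69 ≤ Real.log T := by
  have h : (2 : ℝ) ≤ T := by exact_mod_cast hT
  have := Real.log_le_log (by norm_num) h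
  linarith [Real.log_two_gt_d9]

/-- With no more periods than arms, `τ_0` is already at least the horizon, so the regret bound is
trivial. This case is excluded before the lemmas that assume `K ≤ T` are used. -/
theorem le_tau_zero_of_le (hT : 1 ≤ T) (h : T ≤ K) : (T : ℝ) ≤ tau K T ν 0 := by
  have h1 : (0 : ℝ) < T := by exact_mod_cast hT
  have h2 : (T : ℝ) ≤ K := by exact_mod_cast h
  have h3 := timeExp_zero_le ν
  calc (T : ℝ) = (T : ℝ) ^ (1 - timeExp ν 0) * (T : ℝ) ^ timeExp ν 0 := by
        rw [← Real.rpow_add h1, sub_add_cancel, Real.rpow_one]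
    _ ≤ _ := by
        rw [tau]
        gcongr

theorem one_le_rate (hd : 1 ≤ d) (hK : d + 1 < K) (hT : 2 ≤ T) : 1 ≤ rate d K T ν := by
  obtain ⟨h1, h2, h3⟩ := cast_sizes hd hK hT
  have h4 := one_le_width hd hK hT
  have h5 := log_two_lower hT
  have h6 : 2 ≤ tau K T ν 0 := by
    rcases le_total K T with h | h
    · refine le_trans ?_ (sqrt_le_tau_zero (by omega) h)
      refine Real.le_sqrt_of_sq_le ?_
      nlinarith
    · exact h3.trans (le_tau_zero_of_le (by omega) h)
  have h7 : 0.69 ≤ width d K T * Real.log T := by nlinarith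
  rw [rate]
  nlinarith

/-- What it means that the regret bound is nontrivial. -/
structure SmallRate (d K T ν : ℕ) (κ δ : ℝ) : Prop where
  K_le_T : K ≤ T
  one_le_ν : 1 ≤ ν
  le_sqrt_log : 41 + κ ≤ √(Real.log T)
  first_epoch : 6 * Real.log T + 1 ≤ tpt K T ν 1 / (2 * K)
  rate_le : rate d K T ν ≤ δ * T

/-- If `K ≥ T` or `ν = 0`, then `τ_0 ≥ T` and the rate is not small. Since the rate is at least
`√T`, its smallness also gives `δ T ≥ 1`, hence `T ≥ exp ((41 + κ)²)`. -/
theorem smallRate (hd : 1 ≤ d) (hK : d + 1 < K) (hT : 2 ≤ T) {κ δ : ℝ} (hκ : 0 ≤ κ)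
    (hδ : δ ≤ 1 / 28) (hδ' : δ ≤ Real.exp (-(41 + κ) ^ 2)) (h : rate d K T ν ≤ δ * T) :
    SmallRate d K T ν κ δ := by
  obtain ⟨h1, h2, h3⟩ := cast_sizes hd hK hT
  have hQ := one_le_width hd hK hT
  have hl := log_two_lower hT
  have hQl : 0.69 ≤ width d K T * Real.log T := by nlinarith
  have hτ : ¬ (T : ℝ) ≤ tau K T ν 0 := by
    intro h6
    rw [rate] at h
    nlinarith
  have hKT : K ≤ T := by
    by_contra h'
    exact hτ (le_tau_zero_of_le (by omega) (by omega))
  have hsq := sqrt_le_tau_zero (ν := ν) (by omega : 1 ≤ K) hKT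
  have hK0 : (0 : ℝ) < K := by linarith
  have hsqT : √(T : ℝ) ≤ δ * T := by
    refine le_trans ?_ h
    have e1 : 3 / 2 * √(T : ℝ) ≤ √((K : ℝ) * T) := by
      refine Real.le_sqrt_of_sq_le ?_
      rw [mul_pow, Real.sq_sqrt (by linarith)]
      nlinarith
    have e2 := Real.sqrt_nonneg (T : ℝ)
    rw [rate]
    nlinarith
  have hsT0 : 0 < √(T : ℝ) := Real.sqrt_pos.2 (by linarith)
  have hTT := Real.mul_self_sqrt (by linarith : (0 : ℝ) ≤ T)
  have hδ1 : 1 ≤ δ * √(T : ℝ) := by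
    by_contra h'
    push Not at h'
    nlinarith
  have hδ0 : 0 < δ := by
    by_contra h'
    push Not at h'
    nlinarith
  have hδT : 1 ≤ δ * T := by
    have : 1 ≤ √(T : ℝ) := Real.one_le_sqrt.2 (by linarith)
    nlinarith
  have hlog : (41 + κ) ^ 2 ≤ Real.log T := by
    rw [Real.le_log_iff_exp_le (by linarith)]
    have e1 := mul_le_mul_of_nonneg_right hδ' (by linarith : (0 : ℝ) ≤ T)
    have e2 := Real.exp_pos ((41 + κ) ^ 2)
    have e3 : Real.exp ((41 + κ) ^ 2) * Real.exp (-(41 + κ) ^ 2) = 1 := by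
      rw [← Real.exp_add]; simp
    have e4 := mul_le_mul_of_nonneg_left (hδT.trans e1) e2.le
    rw [← mul_assoc, e3] at e4
    linarith
  refine ⟨hKT, ?_, Real.le_sqrt_of_sq_le hlog, ?_, h⟩
  · by_contra h'
    have : ν = 0 := by omega
    subst this
    exact hτ (tau_self (by omega) hKT).ge
  · have ht := tau_le_two_mul_tpt (ν := ν) (by omega : 1 ≤ K) hKT 0
    rw [zero_add] at ht
    have hl1 : 1 ≤ Real.log T := by nlinarith
    have e1 : Real.log T * √((K : ℝ) * T) ≤ δ * T := by
      refine le_trans ?_ h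
      rw [rate]
      have e2 := Real.sqrt_nonneg ((K : ℝ) * T)
      have e3 : Real.log T ≤ width d K T * Real.log T := by nlinarith
      exact mul_le_mul e3 hsq e2 (by nlinarith)
    have e2 : 0 < √((K : ℝ) * T) := Real.sqrt_pos.2 (by positivity)
    have e3 := Real.mul_self_sqrt (by positivity : (0 : ℝ) ≤ (K : ℝ) * T)
    -- `28 = 4 · 7`: a factor `2` from `τ_0 ≤ 2 t_1`, a factor `2` from the denominator `2K`, and `7
    -- log T ≥ 6 log T + 1`.
    have e4 : 28 * Real.log T * K ≤ √((K : ℝ) * T) := by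
      have e5 : 28 * Real.log T * √((K : ℝ) * T) ≤ T := by nlinarith
      have e6 := mul_le_mul_of_nonneg_left e5 hK0.le
      exact le_of_mul_le_mul_right (by linarith) e2
    rw [le_div_iff₀ (by linarith)]
    nlinarith

theorem log_succ_le (hd : 1 ≤ d) (hK : d + 1 < K) (hT : 2 ≤ T) :
    Real.log (((d : ℝ) + 1) * K * T) ≤ 2 * Real.log ((d : ℝ) * K * T) := by
  obtain ⟨h1, h2, h3⟩ := cast_sizes hd hK hT
  have h4 := six_le_prod hd hK hT
  have e1 : 2 * Real.log ((d : ℝ) * K * T) = Real.log (((d : ℝ) * K * T) ^ 2) := by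
    rw [Real.log_pow]; norm_num
  rw [e1]
  have hKT : 0 < (K : ℝ) * T := mul_pos (by linarith) (by linarith)
  refine Real.log_le_log (by nlinarith) ?_
  nlinarith

theorem log_succ_nonneg (hd : 1 ≤ d) (hK : d + 1 < K) (hT : 2 ≤ T) :
    0 < Real.log (((d : ℝ) + 1) * K * T) := by
  obtain ⟨h1, h2, h3⟩ := cast_sizes hd hK hT
  have h4 := six_le_prod hd hK hT
  refine Real.log_pos ?_
  have hKT : 0 ≤ (K : ℝ) * T := by positivity
  nlinarith

theorem sqrt_log_mul_le (hd : 1 ≤ d) (hK : d + 1 < K) (hT : 2 ≤ T) :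
    √(Real.log (((d : ℝ) + 1) * K * T) * (d + 2)) ≤ 5 / 2 * width d K T := by
  obtain ⟨h1, h2, h3⟩ := cast_sizes hd hK hT
  have h4 := log_succ_le hd hK hT
  have h5 := one_le_log_prod hd hK hT
  have h6 := one_le_width hd hK hT
  refine Real.sqrt_le_iff.2 ⟨by linarith, ?_⟩
  rw [mul_pow, width_sq hd hK hT]
  have h7 := mul_le_mul_of_nonneg_right h4 (by linarith : (0 : ℝ) ≤ d + 2)
  nlinarith

theorem sqrt_log_mul_mul_le (hd : 1 ≤ d) (hK : d + 1 < K) (hT : 2 ≤ T) (hKT : K ≤ T) :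
    √(Real.log (((d : ℝ) + 1) * K * T) * K * T) ≤ 3 / 2 * width d K T * tau K T ν 0 := by
  obtain ⟨h1, h2, h3⟩ := cast_sizes hd hK hT
  have h4 := log_succ_le hd hK hT
  have h5 := one_le_log_prod hd hK hT
  have h6 := one_le_width hd hK hT
  have h7 := sqrt_le_tau_zero (ν := ν) (by omega : 1 ≤ K) hKT
  rw [mul_assoc, Real.sqrt_mul (log_succ_nonneg hd hK hT).le]
  refine mul_le_mul (Real.sqrt_le_iff.2 ⟨by linarith, ?_⟩) h7 (Real.sqrt_nonneg _) (by linarith)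
  rw [mul_pow, width_sq hd hK hT]
  nlinarith

/-- With `n = (d+1)KT` the failure probability is `6 n · n^{-3/2}`, and `T n^{-1/2} ≤ √T ≤ τ_0`.
This is why the bets are run up to the level `3/2 * Λ`. -/
theorem failure_le (hd : 1 ≤ d) (hK : d + 1 < K) (hT : 2 ≤ T) (hKT : K ≤ T) :
    (T : ℝ) * (6 * (d + 1) * K * T *
      Real.exp (-(3 / 2 * Real.log (((d : ℝ) + 1) * K * T)))) ≤ 6 * tau K T ν 0 := by
  obtain ⟨h1, h2, h3⟩ := cast_sizes hd hK hT
  have hT0 : (0 : ℝ) < T := by linarith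
  have hn : (T : ℝ) ≤ ((d : ℝ) + 1) * K * T :=
    le_mul_of_one_le_left hT0.le (by nlinarith)
  set n : ℝ := ((d : ℝ) + 1) * K * T with hn'
  have hn0 : 0 < n := hT0.trans_le hn
  have e1 : Real.exp (-(3 / 2 * Real.log n)) * n * √n = 1 := by
    rw [Real.sqrt_eq_rpow, Real.rpow_def_of_pos hn0]
    nth_rewrite 2 [← Real.exp_log hn0]
    rw [← Real.exp_add, ← Real.exp_add, Real.exp_eq_one_iff]
    ring
  have hs := Real.sqrt_le_sqrt hn
  have hs0 : 0 < √(T : ℝ) := Real.sqrt_pos.2 hT0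
  have e2 : Real.exp (-(3 / 2 * Real.log n)) * n * √(T : ℝ) ≤ 1 := by
    rw [← e1]
    gcongr
  have e3 : √(T : ℝ) ≤ tau K T ν 0 := by
    refine le_trans (Real.sqrt_le_sqrt ?_) (sqrt_le_tau_zero (by omega) hKT)
    nlinarith
  have e4 := Real.mul_self_sqrt hT0.le
  calc (T : ℝ) * (6 * (d + 1) * K * T * Real.exp (-(3 / 2 * Real.log n)))
      = 6 * √(T : ℝ) * (Real.exp (-(3 / 2 * Real.log n)) * n * √(T : ℝ)) := by
        rw [hn']; linear_combination (-6 * ((d : ℝ) + 1) * K * T * Real.exp (-(3 / 2 * Real.log n))) * e4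
    _ ≤ 6 * √(T : ℝ) * 1 := by gcongr
    _ ≤ _ := by linarith

end Rate

end LimitedSwitch

end

noncomputable section

namespace LimitedSwitch

/-! ### Problems to which the analysis applies -/

/-- The learner `A` faces the environment `E` with outcome distributions `D`, and the mean rewards
and costs have sub-Gaussian estimators at the scale of its confidence radii. -/
structure Model {d K : ℕ} {Obs : Type} [MeasurableSpace Obs] (E : Env d K Obs)
    (A : Learner d K Obs) (D : Fin K → Measure Obs) (β Rm Cm V W Vb κ : ℝ)
    (Y : Option (Fin d) → Fin K → Obs → ℝ) : Prop where
  T_eq : E.T = A.T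
  B_eq : E.B = A.B
  measurable_rew : ∀ k, Measurable (E.rew k)
  measurable_cost : ∀ i k, Measurable (E.cost i k)
  measurable_noise : ∀ o k, Measurable (Y o k)
  estRew_eq : ∀ h k, A.estRew h k = empMean (E.rew k) h k
  estCost_eq : ∀ h i k, A.estCost h i k = empMean (E.cost i k) h k
  isProb : ∀ k, IsProbabilityMeasure (D k)
  rew_mem : ∀ k, ∀ᵐ o ∂D k, 0 ≤ E.rew k o ∧ E.rew k o ≤ Rm
  cost_mem : ∀ i k, ∀ᵐ o ∂D k, 0 ≤ E.cost i k o ∧ E.cost i k o ≤ Cm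
  rew_eq : ∀ k, ∀ᵐ o ∂D k, E.rew k o = ∫ o', E.rew k o' ∂D k + A.radRew k * Y none k o
  cost_eq : ∀ i k, ∀ᵐ o ∂D k,
    E.cost i k o = ∫ o', E.cost i k o' ∂D k + A.radCost i * Y (some i) k o
  mgf_le : ∀ o k (a : ℝ), ∫⁻ x, ENNReal.ofReal (Real.exp (a * Y o k x)) ∂D k ≤
    ENNReal.ofReal (Real.exp (a ^ 2 / 8))
  radRew_nonneg : ∀ k, 0 ≤ A.radRew k
  radRew_le : ∀ k, A.radRew k ≤ W
  radCost_nonneg : ∀ i, 0 ≤ A.radCost i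
  radCost_le : ∀ i, A.radCost i ≤ V
  Rm_nonneg : 0 ≤ Rm
  Cm_nonneg : 0 ≤ Cm
  W_nonneg : 0 ≤ W
  V_nonneg : 0 ≤ V
  V_le : V ≤ Vb
  κ_nonneg : 0 ≤ κ
  Cm_le : Cm ≤ κ * V
  β_pos : 0 < β
  B_ge : ∀ i, β * A.T ≤ A.B i
  gamma_eq : A.gamma = 1 - 3 * (V * width d K A.T * Real.log A.T / ⨅ i, A.B i) *
    (tpt K A.T A.ν 1 : ℝ)
  one_le_d : 1 ≤ d
  d_lt_K : d + 1 < K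
  two_le_T : 2 ≤ A.T

namespace Model

variable {d K : ℕ} {Obs : Type} [MeasurableSpace Obs] {E : Env d K Obs}
  {A : Learner d K Obs} {D : Fin K → Measure Obs} {β Rm Cm V W Vb κ : ℝ}
  {Y : Option (Fin d) → Fin K → Obs → ℝ} (M : Model E A D β Rm Cm V W Vb κ Y)

include M

theorem T_pos : (0 : ℝ) < A.T := by exact_mod_cast (by have := M.two_le_T; omega : 0 < A.T)

theorem B_pos (i : Fin d) : 0 < A.B i := (mul_pos M.β_pos M.T_pos).trans_le (M.B_ge i)

theorem mean_rew_nonneg (k : Fin K) : 0 ≤ ∫ o, E.rew k o ∂D k :=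
  integral_nonneg_of_ae ((M.rew_mem k).mono fun _ h => h.1)

theorem mean_rew_le (k : Fin K) : ∫ o, E.rew k o ∂D k ≤ Rm := by
  have := M.isProb
  have := integral_mono_of_nonneg ((M.rew_mem k).mono fun o h => h.1) (integrable_const Rm)
    ((M.rew_mem k).mono fun o h => h.2)
  simpa using this

theorem mean_cost_nonneg (i : Fin d) (k : Fin K) : 0 ≤ ∫ o, E.cost i k o ∂D k :=
  integral_nonneg_of_ae ((M.cost_mem i k).mono fun _ h => h.1)

theorem mean_cost_le (i : Fin d) (k : Fin K) : ∫ o, E.cost i k o ∂D k ≤ Cm := by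
  have := M.isProb
  have := integral_mono_of_nonneg ((M.cost_mem i k).mono fun o h => h.1) (integrable_const Cm)
    ((M.cost_mem i k).mono fun o h => h.2)
  simpa using this

theorem switches_le {φ : Policy K Obs} (hφ : A.IsLS2SLP φ) : E.SwitchesAtMost A.s D φ := by
  obtain ⟨C, hC, hact⟩ := hφ
  refine Filter.Eventually.of_forall fun x => ?_
  rw [Learner.map_fst_hist A C x.1 E φ hact]
  refine (switches_take_le _ _).trans
    (A.switches_fullPlan_le C x.1 hC (fun k => ?_) M.d_lt_K (fun i => (M.B_pos i).le) _)
  rw [M.estRew_eq]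
  simp [empMean]

theorem bmin : β * A.T ≤ ⨅ i, A.B i ∧ ∀ i, ⨅ i, A.B i ≤ A.B i := by
  have : Nonempty (Fin d) := ⟨⟨0, M.one_le_d⟩⟩
  exact ⟨le_ciInf M.B_ge, fun i => ciInf_le (Set.finite_range _).bddBelow i⟩

theorem one_sub_gamma {δ : ℝ} (S : SmallRate d K A.T A.ν κ δ) :
    0 ≤ 1 - A.gamma ∧ 1 - A.gamma ≤ 3 * V * rate d K A.T A.ν / (β * A.T) := by
  have h1 := M.bmin.1
  have h2 : 0 < β * A.T := mul_pos M.β_pos M.T_pos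
  have h3 := one_le_width M.one_le_d M.d_lt_K M.two_le_T
  have h4 := log_two_lower M.two_le_T
  have h5 := tpt_le_tau (ν := A.ν) (by have := M.d_lt_K; omega : 1 ≤ K) S.K_le_T 0
  rw [zero_add] at h5
  have hV := M.V_nonneg
  have h6 : 0 < ⨅ i, A.B i := h2.trans_le h1
  have h7 : 1 - A.gamma = 3 * V * (width d K A.T * Real.log A.T * tpt K A.T A.ν 1) /
      ⨅ i, A.B i := by
    rw [M.gamma_eq]; ring
  rw [h7]
  have h8 : 0 ≤ width d K A.T * Real.log A.T := by positivity
  refine ⟨by positivity, ?_⟩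
  rw [rate]
  have h9 := (Nat.cast_nonneg _).trans h5
  gcongr

/-- The capacity freed by `γ` is at least `3 log T · V Q t_1` with `Q = width d K T`, whereas the
accumulated error grows only like `√(log T) · V Q t_1`. So for large `T` the discount covers the
first epoch, the overspending and the noise. -/
theorem budget {δ : ℝ} (S : SmallRate d K A.T A.ν κ δ)
    (herr : A.err ≤ 6 * √(A.lam * (d + 2)) * (1 + √(Real.log A.T)) * tau K A.T A.ν 0) (i : Fin d) :
    A.gamma * A.B i + A.tp 1 * Cm + 2 * V * A.err + V * √(A.lam * K * A.T) ≤ A.B i := by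
  have hK1 : 1 ≤ K := by have := M.d_lt_K; omega
  have hQ := one_le_width M.one_le_d M.d_lt_K M.two_le_T
  have hτ := tau_le_two_mul_tpt (ν := A.ν) hK1 S.K_le_T 0
  rw [zero_add] at hτ
  have hτ0 := one_le_tau (ν := A.ν) hK1 S.K_le_T 0
  have e1 := sqrt_log_mul_le M.one_le_d M.d_lt_K M.two_le_T
  have e2 := sqrt_log_mul_mul_le (ν := A.ν) M.one_le_d M.d_lt_K M.two_le_T S.K_le_T
  have hB := M.bmin.2 i
  have hB0 : 0 < ⨅ i, A.B i := (mul_pos M.β_pos M.T_pos).trans_le M.bmin.1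
  have hV := M.V_nonneg
  have hG := S.le_sqrt_log
  have hκ := M.κ_nonneg
  have hGsq := Real.sq_sqrt (by linarith [log_two_lower M.two_le_T] : 0 ≤ Real.log A.T)
  have hCm := M.Cm_le
  change √(A.lam * (d + 2)) ≤ _ at e1
  change √(A.lam * K * A.T) ≤ _ at e2
  set G := √(Real.log A.T)
  set Q := width d K A.T
  set t : ℝ := ((tpt K A.T A.ν 1 : ℕ) : ℝ) with ht
  set τ := tau K A.T A.ν 0
  have htp : A.tp 1 = t := rfl
  have ht0 : 0 ≤ t := Nat.cast_nonneg _
  have f1 : A.err ≤ 30 * (Q * t) * (1 + G) := by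
    refine herr.trans ?_
    calc _ ≤ 6 * (5 / 2 * Q) * (1 + G) * (2 * t) := by gcongr
      _ = _ := by ring
  have f2 : √(A.lam * K * A.T) ≤ 3 * (Q * t) := by
    refine e2.trans ?_
    calc _ ≤ 3 / 2 * Q * (2 * t) := by gcongr
      _ = _ := by ring
  have f3 : t ≤ Q * t := le_mul_of_one_le_left ht0 hQ
  have f4 : 3 * G ^ 2 * (V * (Q * t)) ≤ (1 - A.gamma) * A.B i := by
    have : 1 - A.gamma = 3 * G ^ 2 * (V * (Q * t)) / ⨅ i, A.B i := by
      rw [M.gamma_eq, hGsq]; ring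
    rw [this, div_mul_eq_mul_div, le_div_iff₀ hB0]
    gcongr
  have f5 : t * Cm ≤ κ * (V * (Q * t)) := by
    calc t * Cm ≤ (Q * t) * (κ * V) := by gcongr; exact M.Cm_nonneg
      _ = _ := by ring
  have f6 : 2 * V * A.err ≤ 60 * (1 + G) * (V * (Q * t)) := by
    calc _ ≤ 2 * V * (30 * (Q * t) * (1 + G)) := by gcongr
      _ = _ := by ring
  have f7 : V * √(A.lam * K * A.T) ≤ 3 * (V * (Q * t)) := by
    calc _ ≤ V * (3 * (Q * t)) := by gcongr
      _ = _ := by ring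
  -- The terms come from the first epoch, from `err` and from the noise. The bound `G ≥ 41 + κ`
  -- gives `3 G² ≥ 123 G + 3 κ G`, which is enough.
  have f8 : κ + 60 * (1 + G) + 3 ≤ 3 * G ^ 2 := by nlinarith
  have f9 : 0 ≤ V * (Q * t) := by positivity
  have f10 := mul_le_mul_of_nonneg_right f8 f9
  rw [htp]
  linarith

/-- On the event that the estimators behave, the algorithm is as in the deterministic analysis. -/
theorem run {δ : ℝ} (S : SmallRate d K A.T A.ν κ δ) (hδ : 6 * Vb * δ ≤ β) {C : Choices K Obs}
    (hC : A.Valid C) {u : Seed} {H : Hist K Obs}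
    (harms : H.map Prod.fst = (A.fullPlan C u H).take H.length)
    (hclean : ∀ o, CleanFor A.lam (Y o) H)
    (hrew : ∀ e ∈ H, 0 ≤ E.rew e.1 e.2)
    (hcost : ∀ i, ∀ e ∈ H, 0 ≤ E.cost i e.1 e.2)
    (hrew' : ∀ e ∈ H, E.rew e.1 e.2 = ∫ o, E.rew e.1 o ∂D e.1 + A.radRew e.1 * Y none e.1 e.2)
    (hcost' : ∀ i, ∀ e ∈ H,
      E.cost i e.1 e.2 = ∫ o, E.cost i e.1 o ∂D e.1 + A.radCost i * Y (some i) e.1 e.2) :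
    Run A C u H (fun k => ∫ o, E.rew k o ∂D k) (fun i k => ∫ o, E.cost i k o ∂D k)
      β V W Rm Cm := by
  have hestr : ∀ h, h <+: H → ∀ k, 0 < pulls h k →
      A.estRew h k = ∫ o, E.rew k o ∂D k + A.radRew k * empMean (Y none k) h k := by
    intro h hh k hk
    rw [M.estRew_eq]
    refine empMean_affine (fun e he hek => ?_) hk
    subst hek
    exact hrew' e (hh.subset he)
  have hestc : ∀ h, h <+: H → ∀ i k, 0 < pulls h k →
      A.estCost h i k = ∫ o, E.cost i k o ∂D k + A.radCost i * empMean (Y (some i) k) h k := by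
    intro h hh i k hk
    rw [M.estCost_eq]
    refine empMean_affine (fun e he hek => ?_) hk
    subst hek
    exact hcost' i e (hh.subset he)
  have hγ := M.one_sub_gamma S
  have hT := M.T_pos
  have hβ := M.β_pos
  have hsq := S.le_sqrt_log
  have hκ := M.κ_nonneg
  have hV := M.V_nonneg
  have hlog1 : 1 ≤ Real.log A.T := Real.one_le_sqrt.1 (by linarith)
  refine
    { valid := hC
      arms := harms
      rew_true := fun h hh k hk => ?_
      rew_later := fun h₁ h₂ h12 h2 k hk => ?_
      cost_true := fun h hh i k hk => ?_
      cost_later := fun h₁ h₂ h12 h2 i k hk => ?_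
      estRew_nonneg := fun h hh k => ?_
      estCost_nonneg := fun h hh i k => ?_
      r_nonneg := M.mean_rew_nonneg
      r_le := M.mean_rew_le
      c_nonneg := M.mean_cost_nonneg
      c_le := M.mean_cost_le
      radRew_le := M.radRew_le
      radCost_le := M.radCost_le
      W_nonneg := M.W_nonneg
      V_nonneg := M.V_nonneg
      β_pos := M.β_pos
      B_ge := M.B_ge
      one_le_K := by have := M.d_lt_K; omega
      K_le_T := S.K_le_T
      one_le_log := hlog1
      half_le_gamma := ?_
      gamma_le_one := by linarith [hγ.1]
      one_le_ν := S.one_le_ν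
      first_epoch := S.first_epoch }
  · rw [hestr h hh k hk, sub_add_cancel_left, abs_neg, abs_mul, abs_of_nonneg (M.radRew_nonneg k)]
    exact mul_le_mul_of_nonneg_left (hclean none k h h List.prefix_rfl hh hk).1 (M.radRew_nonneg k)
  · rw [hestr h₁ (h12.trans h2) k hk, hestr h₂ h2 k (hk.trans_le (pulls_mono h12 k)),
      add_sub_add_left_eq_sub, ← mul_sub, abs_mul, abs_of_nonneg (M.radRew_nonneg k)]
    exact mul_le_mul_of_nonneg_left (hclean none k h₁ h₂ h12 h2 hk).2 (M.radRew_nonneg k)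
  · rw [hestc h hh i k hk, sub_add_cancel_left, abs_neg, abs_mul,
      abs_of_nonneg (M.radCost_nonneg i)]
    exact mul_le_mul_of_nonneg_left (hclean (some i) k h h List.prefix_rfl hh hk).1
      (M.radCost_nonneg i)
  · rw [hestc h₁ (h12.trans h2) i k hk, hestc h₂ h2 i k (hk.trans_le (pulls_mono h12 k)),
      add_sub_add_left_eq_sub, ← mul_sub, abs_mul, abs_of_nonneg (M.radCost_nonneg i)]
    exact mul_le_mul_of_nonneg_left (hclean (some i) k h₁ h₂ h12 h2 hk).2 (M.radCost_nonneg i)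
  · rw [M.estRew_eq]
    refine empMean_nonneg fun e he hek => ?_
    subst hek
    exact hrew e (hh.subset he)
  · rw [M.estCost_eq]
    refine empMean_nonneg fun e he hek => ?_
    subst hek
    exact hcost i e (hh.subset he)
  · have h1 : 3 * V * rate d K A.T A.ν / (β * A.T) ≤ 1 / 2 := by
      rw [div_le_iff₀ (by positivity)]
      have e1 := S.rate_le
      have e2 := one_le_rate (ν := A.ν) M.one_le_d M.d_lt_K M.two_le_T
      calc 3 * V * rate d K A.T A.ν ≤ 3 * Vb * (δ * A.T) := by
            have := M.V_le
            gcongr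
            linarith
        _ = 6 * Vb * δ * A.T / 2 := by ring
        _ ≤ β * A.T / 2 := by gcongr
        _ = _ := by ring
    linarith [hγ.2]

end Model

end LimitedSwitch

end

/-! ### Constants and the regret bound for a general model -/

noncomputable section

namespace LimitedSwitch

/-- The threshold for the ratio of the regret bound to the horizon, above which it is trivial. -/
def threshold (β Vb κ : ℝ) : ℝ :=
  min (Real.exp (-(41 + κ) ^ 2)) (min (1 / 28) (β / (6 * Vb + 1)))

/-- The constant of the regret bound. -/
def rateConst (β Rm W Vb κ : ℝ) : ℝ :=
  Rm / threshold β Vb κ + κ * Vb * Rm / β + 3 * Vb * Rm / β + Rm +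
    30 * (4 * W + 2 * Vb * Rm / β) + 6 * Rm + 3 / 2 * W + 6 * Rm + 1

section

variable {β Rm W Vb κ : ℝ} (hβ : 0 < β) (hVb : 0 ≤ Vb)

include hβ hVb

theorem threshold_pos : 0 < threshold β Vb κ := by
  refine lt_min (Real.exp_pos _) (lt_min (by norm_num) (by positivity))

theorem threshold_le : 6 * Vb * threshold β Vb κ ≤ β := by
  have h1 : threshold β Vb κ ≤ β / (6 * Vb + 1) := (min_le_right _ _).trans (min_le_right _ _)
  have h2 := threshold_pos (κ := κ) hβ hVb
  rw [le_div_iff₀ (by positivity)] at h1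
  linarith

theorem rateConst_pos (hRm : 0 ≤ Rm) (hW : 0 ≤ W) (hκ : 0 ≤ κ) : 0 < rateConst β Rm W Vb κ := by
  have h2 := threshold_pos (κ := κ) hβ hVb
  rw [rateConst]
  positivity

end

namespace Model

variable {d K : ℕ} {Obs : Type} [MeasurableSpace Obs] {E : Env d K Obs}
  {A : Learner d K Obs} {D : Fin K → Measure Obs} {β Rm Cm V W Vb κ : ℝ}
  {Y : Option (Fin d) → Fin K → Obs → ℝ} (M : Model E A D β Rm Cm V W Vb κ Y)

include M

/-- The value guaranteed by the deterministic analysis, in terms of the rate. -/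
theorem loss_le {δ : ℝ} (S : SmallRate d K A.T A.ν κ δ)
    (herr : A.err ≤ 6 * √(A.lam * (d + 2)) * (1 + √(Real.log A.T)) * tau K A.T A.ν 0) {J : ℝ}
    (hJ0 : 0 ≤ J) (hJle : J ≤ Rm * A.T) :
    J - (3 * Vb * Rm / β + Rm + 30 * (4 * W + 2 * Vb * Rm / β) + 6 * Rm + 3 / 2 * W) *
        rate d K A.T A.ν ≤
      A.gamma * (1 - A.tp 1 / A.T) * J - (4 * W + 2 * V * Rm / β) * A.err -
        6 * K * Rm * Real.log A.T - W * √(A.lam * K * A.T) := by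
  have hK1 : 1 ≤ K := by have := M.d_lt_K; omega
  have hRm := M.Rm_nonneg
  have hT := M.T_pos
  have hβ := M.β_pos
  have hV := M.V_nonneg
  have hVle := M.V_le
  have hVb : 0 ≤ Vb := hV.trans hVle
  have hW := M.W_nonneg
  have hQ := one_le_width M.one_le_d M.d_lt_K M.two_le_T
  have hτ0 := one_le_tau (ν := A.ν) hK1 S.K_le_T 0
  have hsqτ := sqrt_le_tau_zero (ν := A.ν) hK1 S.K_le_T
  have ht := tpt_le_tau (ν := A.ν) hK1 S.K_le_T 0
  rw [zero_add] at ht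
  have hG := S.le_sqrt_log
  have hκ := M.κ_nonneg
  have hlogG := Real.sq_sqrt (by linarith [log_two_lower M.two_le_T] : 0 ≤ Real.log A.T)
  have e1 := sqrt_log_mul_le M.one_le_d M.d_lt_K M.two_le_T
  have e2 := sqrt_log_mul_mul_le (ν := A.ν) M.one_le_d M.d_lt_K M.two_le_T S.K_le_T
  change √(A.lam * (d + 2)) ≤ _ at e1
  change √(A.lam * K * A.T) ≤ _ at e2
  have hγ := M.one_sub_gamma S
  set G := √(Real.log A.T)
  have hG1 : 1 ≤ G := by linarith
  have hGG : G ≤ Real.log A.T := by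
    rw [← hlogG, sq]
    exact le_mul_of_one_le_left (by linarith) hG1
  have hlog1 : 1 ≤ Real.log A.T := hG1.trans hGG
  have hGle : 1 + G ≤ 2 * Real.log A.T := by linarith
  set X := rate d K A.T A.ν with hX
  set Q := width d K A.T
  set τ := tau K A.T A.ν 0
  have hXeq : X = Q * Real.log A.T * τ := rfl
  have hQl : Q ≤ Q * Real.log A.T := le_mul_of_one_le_right (by linarith) hlog1
  have hQτX : Q * τ ≤ X := by
    rw [hXeq]
    exact mul_le_mul_of_nonneg_right hQl (by linarith)
  have hτX : τ ≤ X := (le_mul_of_one_le_left (by linarith) hQ).trans hQτX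
  have hX0 : 0 ≤ X := by linarith
  have hlτX : Real.log A.T * τ ≤ X := by
    rw [hXeq, mul_assoc]
    exact le_mul_of_one_le_left (by positivity) hQ
  have htp : A.tp 1 ≤ τ := ht
  have htp0 : 0 ≤ A.tp 1 := Nat.cast_nonneg _
  have f1 : (4 * W + 2 * V * Rm / β) * A.err ≤ 30 * (4 * W + 2 * Vb * Rm / β) * X := by
    have f0 : A.err ≤ 30 * X := by
      calc A.err ≤ 6 * (5 / 2 * Q) * (2 * Real.log A.T) * τ := by
            refine herr.trans ?_
            gcongr
        _ = 30 * X := by rw [hXeq]; ring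
    calc (4 * W + 2 * V * Rm / β) * A.err ≤ (4 * W + 2 * V * Rm / β) * (30 * X) := by gcongr
      _ ≤ (4 * W + 2 * Vb * Rm / β) * (30 * X) := by gcongr
      _ = _ := by ring
  have f2 : (1 - A.gamma) * J ≤ 3 * Vb * Rm / β * X := by
    calc (1 - A.gamma) * J ≤ 3 * V * X / (β * A.T) * (Rm * A.T) :=
          mul_le_mul hγ.2 hJle hJ0 (by positivity)
      _ = 3 * V * Rm / β * X := by field_simp
      _ ≤ _ := by gcongr
  have f3 : A.tp 1 / A.T * J ≤ Rm * X := by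
    calc A.tp 1 / A.T * J ≤ A.tp 1 / A.T * (Rm * A.T) := by gcongr
      _ = Rm * A.tp 1 := by field_simp
      _ ≤ Rm * X := by gcongr; linarith
  have f4 : A.gamma * (A.tp 1 / A.T * J) ≤ A.tp 1 / A.T * J :=
    mul_le_of_le_one_left (by positivity) (by linarith [hγ.1])
  have f5 : 6 * K * Rm * Real.log A.T ≤ 6 * Rm * X := by
    have hKτ : (K : ℝ) ≤ τ := by
      refine le_trans (Real.le_sqrt_of_sq_le ?_) hsqτ
      rw [sq]
      exact mul_le_mul_of_nonneg_left (by exact_mod_cast S.K_le_T) (Nat.cast_nonneg _)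
    calc 6 * K * Rm * Real.log A.T ≤ 6 * τ * Rm * Real.log A.T := by gcongr
      _ = 6 * Rm * (Real.log A.T * τ) := by ring
      _ ≤ _ := by gcongr
  have f6 : W * √(A.lam * K * A.T) ≤ 3 / 2 * W * X := by
    calc W * √(A.lam * K * A.T) ≤ W * (3 / 2 * Q * τ) := by gcongr
      _ = 3 / 2 * W * (Q * τ) := by ring
      _ ≤ _ := by gcongr
  have f7 : A.gamma * (1 - A.tp 1 / A.T) * J =
      J - (1 - A.gamma) * J - A.gamma * (A.tp 1 / A.T * J) := by ring
  have f8 : (3 * Vb * Rm / β + Rm + 30 * (4 * W + 2 * Vb * Rm / β) + 6 * Rm + 3 / 2 * W) * X =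
      3 * Vb * Rm / β * X + Rm * X + 30 * (4 * W + 2 * Vb * Rm / β) * X + 6 * Rm * X +
        3 / 2 * W * X := by ring
  rw [f7, f8]
  linarith only [f1, f2, f3, f4, f5, f6]

theorem failure_le_rate {δ : ℝ} (S : SmallRate d K A.T A.ν κ δ) :
    (A.T : ℝ) * (6 * ((d : ℝ) + 1) * K * A.T * Real.exp (-(3 / 2 * A.lam))) ≤
      6 * rate d K A.T A.ν := by
  refine (failure_le (ν := A.ν) M.one_le_d M.d_lt_K M.two_le_T S.K_le_T).trans ?_
  have hτ0 := one_le_tau (ν := A.ν) (by have := M.d_lt_K; omega : 1 ≤ K) S.K_le_T 0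
  have hl1 : 1 ≤ Real.log A.T :=
    Real.one_le_sqrt.1 (by linarith [S.le_sqrt_log, M.κ_nonneg])
  have hQ := one_le_width M.one_le_d M.d_lt_K M.two_le_T
  have : 1 ≤ width d K A.T * Real.log A.T := one_le_mul_of_one_le_of_one_le hQ hl1
  rw [rate]
  have := le_mul_of_one_le_left (by linarith : 0 ≤ tau K A.T A.ν 0) this
  linarith

/-- The expected revenue of the algorithm when the regret bound is nontrivial. -/
theorem rev_ge {δ : ℝ} (S : SmallRate d K A.T A.ν κ δ) (hδ : 6 * Vb * δ ≤ β) {φ : Policy K Obs}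
    (hφ : A.IsLS2SLP φ) {x : Fin K → ℝ}
    (hx : IsLPOpt A.T A.B (fun k => ∫ o, E.rew k o ∂D k) (fun i k => ∫ o, E.cost i k o ∂D k) x) :
    ∑ k, (∫ o, E.rew k o ∂D k) * x k - (3 * Vb * Rm / β + Rm +
      30 * (4 * W + 2 * Vb * Rm / β) + 6 * Rm + 3 / 2 * W + 6 * Rm) * rate d K A.T A.ν ≤
      E.Rev D φ := by
  have := M.isProb
  obtain ⟨C, hC, hact⟩ := hφ
  have hlam : 0 < A.lam := log_succ_nonneg M.one_le_d M.d_lt_K M.two_le_T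
  obtain ⟨Z, hZm, hZ, hclean⟩ := E.exists_clean_event D M.measurable_cost φ M.measurable_noise
    M.mgf_le hlam
  have hloss := fun herr => M.loss_le S herr (J := ∑ k, (∫ o, E.rew k o ∂D k) * x k)
  set J := ∑ k, (∫ o, E.rew k o ∂D k) * x k with hJ
  have hJ0 : 0 ≤ J := Finset.sum_nonneg fun k _ => mul_nonneg (M.mean_rew_nonneg k) (hx.nonneg k)
  have hRm := M.Rm_nonneg
  have hW := M.W_nonneg
  have hβ := M.β_pos
  have hVb : 0 ≤ Vb := M.V_nonneg.trans M.V_le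
  have hJle : J ≤ Rm * A.T := by
    refine (Finset.sum_le_sum fun k _ =>
      mul_le_mul_of_nonneg_right (M.mean_rew_le k) (hx.nonneg k)).trans ?_
    rw [← Finset.mul_sum]
    exact mul_le_mul_of_nonneg_left hx.sum_le hRm
  have hX0 := zero_le_one.trans (one_le_rate (ν := A.ν) M.one_le_d M.d_lt_K M.two_le_T)
  have hfail := M.failure_le_rate S
  set X := rate d K A.T A.ν with hX
  set b := J - (3 * Vb * Rm / β + Rm + 30 * (4 * W + 2 * Vb * Rm / β) + 6 * Rm +
    3 / 2 * W) * X with hb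
  have hbT : b ≤ Rm * E.T := by
    rw [M.T_eq]
    refine le_trans ?_ hJle
    rw [hb, sub_le_self_iff]
    positivity
  have hrev := E.Rev_ge D M.measurable_cost M.measurable_rew hRm M.rew_mem φ hZm hbT (by
    filter_upwards [E.ae_hist D M.rew_mem φ E.T,
      ae_all_iff.2 fun i => E.ae_hist D (M.cost_mem i) φ E.T,
      E.ae_hist D M.rew_eq φ E.T,
      ae_all_iff.2 fun i => E.ae_hist D (M.cost_eq i) φ E.T] with y g1 g2 g3 g4 hy
    have R := M.run S hδ hC (Learner.map_fst_hist A C y.1 E φ hact y.2 E.T) (hclean y hy)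
      (fun e he => (g1 e he).1) (fun i e he => (g2 i e he).1) g3 g4
    have hend := E.hist_end φ y.1 y.2 E.T le_rfl
    rw [hact] at hend
    have hlen := E.length_hist_le φ y.1 y.2 E.T
    have hres := R.withinBudget_and_revenue_ge M.B_eq (by rw [← M.T_eq]; exact hlen)
      (by rw [← M.T_eq]; exact hend)
      (fun i => by
        rw [sum_map_eq_sum_pulls (E.cost i)]
        simp only [M.estCost_eq])
      (by
        rw [sum_map_eq_sum_pulls E.rew]
        simp only [M.estRew_eq])
      (M.budget S R.err_le) hx
    rw [Env.revenue, if_pos hres.1]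
    exact (hloss R.err_le hJ0 hJle).trans hres.2)
  have hp : Rm * E.T * (E.law D).real Z ≤ 6 * Rm * X := by
    have hT : (E.T : ℝ) = A.T := by rw [M.T_eq]
    rw [Fintype.card_option, Fintype.card_fin, Nat.cast_add, Nat.cast_one, hT] at hZ
    rw [hT]
    calc Rm * A.T * (E.law D).real Z ≤ Rm * (A.T * (6 * ((d : ℝ) + 1) * K * A.T *
          Real.exp (-(3 / 2 * A.lam)))) := by rw [mul_assoc]; gcongr
      _ ≤ Rm * (6 * X) := by gcongr
      _ = _ := by ring
  have : (3 * Vb * Rm / β + Rm + 30 * (4 * W + 2 * Vb * Rm / β) + 6 * Rm + 3 / 2 * W + 6 * Rm) *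
      X = (3 * Vb * Rm / β + Rm + 30 * (4 * W + 2 * Vb * Rm / β) + 6 * Rm + 3 / 2 * W) * X +
        6 * Rm * X := by ring
  rw [this]
  linarith only [hrev, hp, hb]

theorem regret_le {φ : Policy K Obs} (hφ : A.IsLS2SLP φ) (π : Policy K Obs) :
    E.Rev D π ≤ E.Rev D φ + rateConst β Rm W Vb κ * rate d K A.T A.ν := by
  have := M.isProb
  have hT := M.T_pos
  have hβ := M.β_pos
  have hRm := M.Rm_nonneg
  have hκ := M.κ_nonneg
  have hW := M.W_nonneg
  have hVb : 0 ≤ Vb := M.V_nonneg.trans M.V_le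
  have hδ0 := threshold_pos (κ := κ) hβ hVb
  obtain ⟨x, hx⟩ := exists_isLPOpt A.T hT.le A.B (fun i => (M.B_pos i).le)
    (fun k => ∫ o, E.rew k o ∂D k) (fun i k => ∫ o, E.cost i k o ∂D k)
  have hπ := E.Rev_le D M.measurable_cost M.measurable_rew hRm M.Cm_nonneg hβ
    (by rw [M.T_eq]; have := M.two_le_T; omega) (by rw [M.T_eq, M.B_eq]; exact M.B_ge)
    M.rew_mem M.cost_mem (by rw [M.T_eq, M.B_eq]; exact hx) π
  have hX1 := one_le_rate (ν := A.ν) M.one_le_d M.d_lt_K M.two_le_T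
  -- The constant loss in the benchmark is absorbed because the rate is at least `1`.
  have hCR : Cm * Rm / β ≤ κ * Vb * Rm / β * rate d K A.T A.ν := by
    refine le_trans ?_ (le_mul_of_one_le_right (by positivity) hX1)
    have := M.Cm_le.trans (mul_le_mul_of_nonneg_left M.V_le hκ)
    gcongr
  set X := rate d K A.T A.ν
  set δ := threshold β Vb κ with hδ
  rw [rateConst, ← hδ]
  have hrest : 0 ≤ (3 * Vb * Rm / β + Rm + 30 * (4 * W + 2 * Vb * Rm / β) + 6 * Rm +
    3 / 2 * W + 6 * Rm + 1) * X := by positivity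
  -- Above the threshold the program's value is at most `Rm * T ≤ Rm / δ * X`, while the algorithm's
  -- revenue is nonnegative, so there is nothing else to prove.
  rcases le_or_gt X (δ * A.T) with h | h
  · have S := smallRate (ν := A.ν) M.one_le_d M.d_lt_K M.two_le_T hκ
      ((min_le_right _ _).trans (min_le_left _ _)) (min_le_left _ _) h
    have h1 := M.rev_ge S (threshold_le hβ hVb) hφ hx
    have h2 : 0 ≤ Rm / δ * X := by positivity
    linarith
  · have h1 := E.Rev_nonneg D M.rew_mem φ
    have h2 : ∑ k, (∫ o, E.rew k o ∂D k) * x k ≤ Rm / δ * X := by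
      refine (Finset.sum_le_sum fun k _ =>
        mul_le_mul_of_nonneg_right (M.mean_rew_le k) (hx.nonneg k)).trans ?_
      rw [← Finset.mul_sum]
      calc Rm * ∑ k, x k ≤ Rm * (X / δ) := by
            gcongr
            rw [le_div_iff₀ hδ0]
            have := mul_le_mul_of_nonneg_left hx.sum_le hδ0.le
            linarith
        _ = _ := by ring
    linarith

theorem optRev_sub_le {φ : Policy K Obs} (hφ : A.IsLS2SLP φ) :
    E.optRev D - (E.Rev D φ : EReal) ≤
      ((regretBound (rateConst β Rm W Vb κ) A.T K d A.s : ℝ) : EReal) := by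
  rw [regretBound_eq]
  refine EReal.sub_le_of_le_add ?_
  refine iSup_le fun π => ?_
  have h := M.regret_le hφ π
  rw [add_comm] at h
  exact_mod_cast h

end Model

theorem Env.switchRegret_le_overallRegret {d K : ℕ} {Obs : Type} [MeasurableSpace Obs]
    (E : Env d K Obs) (𝒟 : Set (Fin K → Measure Obs)) (s : ℕ) (φ : Policy K Obs) :
    E.switchRegret 𝒟 s φ ≤ E.overallRegret 𝒟 φ := by
  refine iSup₂_mono fun D _ => EReal.sub_le_sub ?_ le_rfl
  exact iSup₂_le fun π _ => le_iSup (fun π => (E.Rev D π : EReal)) π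

end LimitedSwitch

end

/-! ### Sub-Gaussian noise and the verification of the two setups -/

noncomputable section

namespace LimitedSwitch

open ProbabilityTheory in
-- Dividing by the scale `w` turns the variance proxy `w² / 4` into `1 / 4`, the normalization of
-- the bets. For `w = 0` the quotient is `0` by convention and the bound holds trivially.
theorem lintegral_exp_div_le {Ω : Type*} [MeasurableSpace Ω] {μ : Measure Ω}
    [IsProbabilityMeasure μ] {X : Ω → ℝ} {c : NNReal} (h : HasSubgaussianMGF X c μ) {w : ℝ}
    (hw : (c : ℝ) = w ^ 2 / 4) (a : ℝ) :
    ∫⁻ x, ENNReal.ofReal (Real.exp (a * (X x / w))) ∂μ ≤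
      ENNReal.ofReal (Real.exp (a ^ 2 / 8)) := by
  rcases eq_or_ne w 0 with rfl | hw0
  · simp only [div_zero, mul_zero, Real.exp_zero, ENNReal.ofReal_one, lintegral_const,
      measure_univ, mul_one]
    rw [← ENNReal.ofReal_one]
    exact ENNReal.ofReal_le_ofReal (Real.one_le_exp (by positivity))
  · have e1 : ∀ x, a * (X x / w) = a / w * X x := fun x => by ring
    simp only [e1]
    rw [← ofReal_integral_eq_lintegral_ofReal (h.integrable_exp_mul _)
      (Filter.Eventually.of_forall fun x => (Real.exp_pos _).le)]
    refine ENNReal.ofReal_le_ofReal ((h.mgf_le (a / w)).trans_eq ?_)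
    rw [hw]
    congr 1
    field_simp
    ring

open ProbabilityTheory in
theorem hasSubgaussianMGF_of_mem {Ω : Type*} [MeasurableSpace Ω] {μ : Measure Ω}
    [IsProbabilityMeasure μ] {X : Ω → ℝ} (hX : Measurable X) {w : ℝ}
    (h : ∀ᵐ x ∂μ, 0 ≤ X x ∧ X x ≤ w) :
    HasSubgaussianMGF (fun x => X x - ∫ x', X x' ∂μ) ((‖w - 0‖₊ / 2) ^ 2) μ :=
  hasSubgaussianMGF_of_mem_Icc hX.aemeasurable h

theorem lintegral_exp_bounded_le {Ω : Type*} [MeasurableSpace Ω] {μ : Measure Ω}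
    [IsProbabilityMeasure μ] {X : Ω → ℝ} (hX : Measurable X) {w : ℝ}
    (h : ∀ᵐ x ∂μ, 0 ≤ X x ∧ X x ≤ w) (a : ℝ) :
    ∫⁻ x, ENNReal.ofReal (Real.exp (a * ((X x - ∫ x', X x' ∂μ) / w))) ∂μ ≤
      ENNReal.ofReal (Real.exp (a ^ 2 / 8)) := by
  refine lintegral_exp_div_le (hasSubgaussianMGF_of_mem hX h) ?_ a
  simp [div_pow]
  norm_num

/-! ### Linear functions of independent demands -/

section Linear

variable {n : ℕ} {Q : Fin n → Measure ℝ} [∀ j, IsProbabilityMeasure (Q j)]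

theorem ae_pi_mem (hQ : ∀ j, ∀ᵐ q ∂Q j, q ∈ Set.Icc (0 : ℝ) 1) :
    ∀ᵐ q ∂Measure.pi Q, ∀ j, q j ∈ Set.Icc (0 : ℝ) 1 :=
  ae_all_iff.2 fun j => (measurePreserving_eval Q j).quasiMeasurePreserving.ae (hQ j)

open ProbabilityTheory in
-- By independence of the demands the variance proxies `v j ^ 2 / 4` add up. Hence the right scale
-- is the Euclidean norm of `v`, the one used in the confidence radii.
theorem lintegral_exp_linear_le (hQ : ∀ j, ∀ᵐ q ∂Q j, q ∈ Set.Icc (0 : ℝ) 1) {v : Fin n → ℝ}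
    (hv : ∀ j, 0 ≤ v j) (a : ℝ) :
    ∫⁻ q, ENNReal.ofReal (Real.exp (a * ((∑ j, v j * q j -
      ∫ q', ∑ j, v j * q' j ∂Measure.pi Q) / √(∑ j, v j ^ 2)))) ∂Measure.pi Q ≤
      ENNReal.ofReal (Real.exp (a ^ 2 / 8)) := by
  have hm : ∀ j, Measurable fun q : Fin n → ℝ => v j * q j := fun j => by fun_prop
  have hb : ∀ j, ∀ᵐ q ∂Measure.pi Q, 0 ≤ v j * q j ∧ v j * q j ≤ v j := by
    intro j
    filter_upwards [ae_pi_mem hQ] with q hq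
    exact ⟨mul_nonneg (hv j) (hq j).1, mul_le_of_le_one_right (hv j) (hq j).2⟩
  have hint : ∀ j, Integrable (fun q : Fin n → ℝ => v j * q j) (Measure.pi Q) := by
    intro j
    refine Integrable.of_bound (hm j).aestronglyMeasurable (v j) ?_
    filter_upwards [hb j] with q hq
    rw [Real.norm_eq_abs, abs_of_nonneg hq.1]
    exact hq.2
  have hind : iIndepFun (fun j (q : Fin n → ℝ) =>
      v j * q j - ∫ q', v j * q' j ∂Measure.pi Q) (Measure.pi Q) :=
    iIndepFun_pi (X := fun j y => v j * y - ∫ q', v j * q' j ∂Measure.pi Q)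
      fun j => by fun_prop
  have hsub := HasSubgaussianMGF.sum_of_iIndepFun hind (s := Finset.univ)
    fun j _ => hasSubgaussianMGF_of_mem (hm j) (hb j)
  have e1 : ∀ q : Fin n → ℝ, ∑ j, (v j * q j - ∫ q', v j * q' j ∂Measure.pi Q) =
      ∑ j, v j * q j - ∫ q', ∑ j, v j * q' j ∂Measure.pi Q := by
    intro q
    rw [Finset.sum_sub_distrib, integral_finsetSum _ fun j _ => hint j]
  simp only [e1] at hsub
  refine lintegral_exp_div_le hsub ?_ a
  rw [Real.sq_sqrt (Finset.sum_nonneg fun j _ => sq_nonneg _), Finset.sum_div]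
  push_cast
  refine Finset.sum_congr rfl fun j _ => ?_
  simp [div_pow]
  norm_num

theorem sqrt_sum_sq_le {v : Fin n → ℝ} {b : ℝ} (hv : ∀ j, 0 ≤ v j) (hvb : ∀ j, v j ≤ b)
    (hb : 0 ≤ b) : √(∑ j, v j ^ 2) ≤ √n * b := by
  rw [Real.sqrt_le_iff]
  refine ⟨by positivity, ?_⟩
  rw [mul_pow, Real.sq_sqrt (Nat.cast_nonneg n)]
  calc ∑ j, v j ^ 2 ≤ ∑ _j : Fin n, b ^ 2 :=
        Finset.sum_le_sum fun j _ => pow_le_pow_left₀ (hv j) (hvb j) 2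
    _ = n * b ^ 2 := by simp

omit [∀ j, IsProbabilityMeasure (Q j)] in
theorem linear_eq_add {v : Fin n → ℝ} (q : Fin n → ℝ) :
    ∑ j, v j * q j = ∫ q', ∑ j, v j * q' j ∂Measure.pi Q + √(∑ j, v j ^ 2) *
      ((∑ j, v j * q j - ∫ q', ∑ j, v j * q' j ∂Measure.pi Q) / √(∑ j, v j ^ 2)) := by
  rcases eq_or_ne √(∑ j, v j ^ 2) 0 with h | h
  · have h1 : ∑ j, v j ^ 2 = 0 :=
      (Real.sqrt_eq_zero (Finset.sum_nonneg fun j _ => sq_nonneg _)).1 h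
    rw [Finset.sum_eq_zero_iff_of_nonneg fun j _ => sq_nonneg _] at h1
    have h2 : ∀ j, v j = 0 := fun j => by simpa using h1 j (Finset.mem_univ j)
    simp [h2]
  · field_simp
    ring

theorem linear_mem {v : Fin n → ℝ} {b : ℝ} (hv : ∀ j, 0 ≤ v j) (hvb : ∀ j, v j ≤ b)
    {q : Fin n → ℝ} (hq : ∀ j, q j ∈ Set.Icc (0 : ℝ) 1) :
    0 ≤ ∑ j, v j * q j ∧ ∑ j, v j * q j ≤ n * b := by
  refine ⟨Finset.sum_nonneg fun j _ => mul_nonneg (hv j) (hq j).1, ?_⟩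
  calc ∑ j, v j * q j ≤ ∑ _j : Fin n, b :=
        Finset.sum_le_sum fun j _ => (mul_le_of_le_one_right (hv j) (hq j).2).trans (hvb j)
    _ = n * b := by simp

theorem sum_mul_empMean {K : ℕ} (v : Fin n → ℝ) (h : Hist K (Fin n → ℝ)) (k : Fin K) :
    ∑ j, v j * empMean (fun q => q j) h k = empMean (fun q => ∑ j, v j * q j) h k := by
  simp only [empMean, mul_div_assoc', ← Finset.sum_div]
  congr 1
  generalize h.filter _ = l
  induction l with
  | nil => simp
  | cons e l ih =>
    simp only [List.map_cons, List.sum_cons, mul_add, Finset.sum_add_distrib, ih]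

end Linear

/-! ### The two setups -/

namespace BNRM

variable {d K n : ℕ} (P : BNRM d K n)

theorem aMax_nonneg (ha : ∀ i j, 0 ≤ P.a i j) : 0 ≤ P.aMax :=
  Real.iSup_nonneg fun i => Real.iSup_nonneg fun j => ha i j

theorem a_le_aMax (i : Fin d) (j : Fin n) : P.a i j ≤ P.aMax :=
  (le_ciSup (f := fun j => P.a i j) (Set.finite_range _).bddAbove j).trans
    (le_ciSup (f := fun i => ⨆ j, P.a i j) (Set.finite_range _).bddAbove i)

theorem aMax_le {aBar : ℝ} (ha : ∀ i j, P.a i j ≤ aBar) : P.aMax ≤ |aBar| :=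
  Real.iSup_le (fun i => Real.iSup_le (fun j => (ha i j).trans (le_abs_self _)) (abs_nonneg _))
    (abs_nonneg _)

/-- Euclidean norms cost a factor `√n`: with `V = √n · aMax` the discount has the required form, and
`κ = √n` because the total cost `n · aMax` equals `√n · V`. Absolute values keep the constants
nonnegative when `n = 0` leaves `pBar` and `aBar` unconstrained. -/
theorem model {pBar aBar β : ℝ} (hβ : 0 < β) (s : ℕ) (hd : 1 ≤ d) (hK : d + 1 < K) (hT : 2 ≤ P.T)
    (hp : ∀ j k, 0 ≤ P.p j k ∧ P.p j k ≤ pBar) (ha : ∀ i j, 0 ≤ P.a i j ∧ P.a i j ≤ aBar)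
    (hB : ∀ i, β * (P.T : ℝ) ≤ P.B i) {D : Fin K → Measure (Fin n → ℝ)} (hD : D ∈ dists K n) :
    Model P.env (P.learner s) D β (n * |pBar|) (n * P.aMax) (√n * P.aMax) (√n * |pBar|)
      (√n * |aBar|) √n (fun o k q => o.elim
        ((P.env.rew k q - ∫ q', P.env.rew k q' ∂D k) / (P.learner s).radRew k)
        fun i => (P.env.cost i k q - ∫ q', P.env.cost i k q' ∂D k) / (P.learner s).radCost i) := by
  obtain ⟨Q, hQ, rfl⟩ := hD
  have hQ1 : ∀ k j, IsProbabilityMeasure (Q j k) := fun k j => (hQ j k).1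
  have hQ2 : ∀ k j, ∀ᵐ q ∂Q j k, q ∈ Set.Icc (0 : ℝ) 1 := fun k j => (hQ j k).2
  have ha0 := P.aMax_nonneg fun i j => (ha i j).1
  have hpB : ∀ k j, P.p j k ≤ |pBar| := fun k j => (hp j k).2.trans (le_abs_self _)
  have hmr : ∀ k, Measurable (P.env.rew k) := fun k => by unfold env; fun_prop
  have hmc : ∀ i k, Measurable (P.env.cost i k) := fun i k => by unfold env; fun_prop
  exact
    { T_eq := rfl
      B_eq := rfl
      measurable_rew := hmr
      measurable_cost := hmc
      measurable_noise := fun o k => by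
        cases o with
        | none => exact ((hmr k).sub_const _).div_const _
        | some i => exact ((hmc i k).sub_const _).div_const _
      estRew_eq := fun h k => sum_mul_empMean _ h k
      estCost_eq := fun h i k => sum_mul_empMean _ h k
      isProb := fun k => inferInstance
      rew_mem := fun k => (ae_pi_mem (hQ2 k)).mono fun q hq =>
        linear_mem (fun j => (hp j k).1) (hpB k) hq
      cost_mem := fun i k => (ae_pi_mem (hQ2 k)).mono fun q hq =>
        linear_mem (fun j => (ha i j).1) (P.a_le_aMax i) hq
      rew_eq := fun k => Filter.Eventually.of_forall fun q => linear_eq_add q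
      cost_eq := fun i k => Filter.Eventually.of_forall fun q => linear_eq_add q
      mgf_le := fun o k a => by
        cases o with
        | none => exact lintegral_exp_linear_le (hQ2 k) (fun j => (hp j k).1) a
        | some i => exact lintegral_exp_linear_le (hQ2 k) (fun j => (ha i j).1) a
      radRew_nonneg := fun k => Real.sqrt_nonneg _
      radRew_le := fun k => sqrt_sum_sq_le (fun j => (hp j k).1) (hpB k) (abs_nonneg _)
      radCost_nonneg := fun i => Real.sqrt_nonneg _
      radCost_le := fun i => sqrt_sum_sq_le (fun j => (ha i j).1) (P.a_le_aMax i) ha0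
      Rm_nonneg := by positivity
      Cm_nonneg := by positivity
      W_nonneg := by positivity
      V_nonneg := by positivity
      V_le := by
        have := P.aMax_le fun i j => (ha i j).2
        gcongr
      κ_nonneg := Real.sqrt_nonneg _
      Cm_le := by rw [← mul_assoc, Real.mul_self_sqrt (Nat.cast_nonneg n)]
      β_pos := hβ
      B_ge := hB
      gamma_eq := by
        have : √((d : ℝ) * n * Real.log ((d : ℝ) * K * P.T)) = √n * width d K P.T := by
          rw [width, ← Real.sqrt_mul (Nat.cast_nonneg n)]
          congr 1
          ring
        simp only [learner, Learner.ν, this, Bmin]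
        ring
      one_le_d := hd
      d_lt_K := hK
      two_le_T := hT }

end BNRM

namespace BwK

variable {d K : ℕ} (P : BwK d K)

/-- For `w = 0` division by `w` destroys the noise, but then `X` vanishes almost surely; hence the
almost-everywhere form. -/
theorem eq_add_of_mem {Ω : Type*} [MeasurableSpace Ω] {μ : Measure Ω} {X : Ω → ℝ} {w : ℝ}
    (h : ∀ᵐ x ∂μ, 0 ≤ X x ∧ X x ≤ w) :
    ∀ᵐ x ∂μ, X x = ∫ x', X x' ∂μ + w * ((X x - ∫ x', X x' ∂μ) / w) := by
  rcases eq_or_ne w 0 with rfl | hw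
  · have h0 : ∀ᵐ x ∂μ, X x = 0 := h.mono fun x hx => le_antisymm hx.2 hx.1
    rw [integral_eq_zero_of_ae h0]
    simpa using h0
  · refine Filter.Eventually.of_forall fun x => ?_
    field_simp
    ring

theorem model {rBar cBar β : ℝ} (hβ : 0 < β) (s : ℕ) (hd : 1 ≤ d) (hK : d + 1 < K) (hT : 2 ≤ P.T)
    (hR : 0 ≤ P.Rmax) (hr : P.Rmax ≤ rBar) (hC : 0 ≤ P.Cmax) (hc : P.Cmax ≤ cBar)
    (hB : ∀ i, β * (P.T : ℝ) ≤ P.B i) {D : Fin K → Measure (ℝ × (Fin d → ℝ))} (hD : D ∈ P.dists) :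
    Model P.env (P.learner s) D β |rBar| P.Cmax P.Cmax |rBar| |cBar| 1 (fun o k q => o.elim
        ((P.env.rew k q - ∫ q', P.env.rew k q' ∂D k) / P.Rmax)
        fun i => (P.env.cost i k q - ∫ q', P.env.cost i k q' ∂D k) / P.Cmax) := by
  have hP : ∀ k, IsProbabilityMeasure (D k) := fun k => (hD k).1
  have hmr : ∀ k, Measurable (P.env.rew k) := fun k => measurable_fst
  have hmc : ∀ i k, Measurable (P.env.cost i k) := fun i k => by unfold env; fun_prop
  have hrew : ∀ k, ∀ᵐ o ∂D k, 0 ≤ P.env.rew k o ∧ P.env.rew k o ≤ P.Rmax := fun k =>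
    (hD k).2.mono fun o ho => ho.1
  have hcost : ∀ i k, ∀ᵐ o ∂D k, 0 ≤ P.env.cost i k o ∧ P.env.cost i k o ≤ P.Cmax := fun i k =>
    (hD k).2.mono fun o ho => ho.2 i
  have hrB := hr.trans (le_abs_self _)
  exact
    { T_eq := rfl
      B_eq := rfl
      measurable_rew := hmr
      measurable_cost := hmc
      measurable_noise := fun o k => by
        cases o with
        | none => exact ((hmr k).sub_const _).div_const _
        | some i => exact ((hmc i k).sub_const _).div_const _
      estRew_eq := fun h k => rfl
      estCost_eq := fun h i k => rfl
      isProb := hP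
      rew_mem := fun k => (hrew k).mono fun o ho => ⟨ho.1, ho.2.trans hrB⟩
      cost_mem := hcost
      rew_eq := fun k => eq_add_of_mem (hrew k)
      cost_eq := fun i k => eq_add_of_mem (hcost i k)
      mgf_le := fun o k a => by
        cases o with
        | none => exact lintegral_exp_bounded_le (hmr k) (hrew k) a
        | some i => exact lintegral_exp_bounded_le (hmc i k) (hcost i k) a
      radRew_nonneg := fun k => hR
      radRew_le := fun k => hrB
      radCost_nonneg := fun i => hC
      radCost_le := fun i => le_rfl
      Rm_nonneg := abs_nonneg _
      Cm_nonneg := hC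
      W_nonneg := abs_nonneg _
      V_nonneg := hC
      V_le := hc.trans (le_abs_self _)
      κ_nonneg := zero_le_one
      Cm_le := (one_mul _).ge
      β_pos := hβ
      B_ge := hB
      gamma_eq := rfl
      one_le_d := hd
      d_lt_K := hK
      two_le_T := hT }

end BwK

end LimitedSwitch

end

theorem theorem2 :
    (∀ (n : ℕ) (pBar aBar β : ℝ), 0 < β →
      ∃ c : ℝ, 0 < c ∧
        ∀ (d K s : ℕ) (P : LimitedSwitch.BNRM d K n),
          1 ≤ d → d + 1 < K → 2 ≤ P.T →
          (∀ j k, 0 ≤ P.p j k ∧ P.p j k ≤ pBar) →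
          (∀ i j, 0 ≤ P.a i j ∧ P.a i j ≤ aBar) →
          (∀ i, β * (P.T : ℝ) ≤ P.B i) →
          ∀ φ : LimitedSwitch.Policy K (Fin n → ℝ), (P.learner s).IsLS2SLP φ →
            P.env.IsSwitchLearning (LimitedSwitch.BNRM.dists K n) s φ ∧
            P.env.switchRegret (LimitedSwitch.BNRM.dists K n) s φ ≤
              P.env.overallRegret (LimitedSwitch.BNRM.dists K n) φ ∧
            P.env.overallRegret (LimitedSwitch.BNRM.dists K n) φ ≤
              ((LimitedSwitch.regretBound c P.T K d s : ℝ) : EReal)) ∧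
    (∀ (rBar cBar β : ℝ), 0 < β →
      ∃ c : ℝ, 0 < c ∧
        ∀ (d K s : ℕ) (P : LimitedSwitch.BwK d K),
          1 ≤ d → d + 1 < K → 2 ≤ P.T →
          0 ≤ P.Rmax → P.Rmax ≤ rBar →
          0 ≤ P.Cmax → P.Cmax ≤ cBar →
          (∀ i, β * (P.T : ℝ) ≤ P.B i) →
          ∀ φ : LimitedSwitch.Policy K (ℝ × (Fin d → ℝ)), (P.learner s).IsLS2SLP φ →
            P.env.IsSwitchLearning P.dists s φ ∧
            P.env.switchRegret P.dists s φ ≤ P.env.overallRegret P.dists φ ∧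
            P.env.overallRegret P.dists φ ≤
              ((LimitedSwitch.regretBound c P.T K d s : ℝ) : EReal)) := by
  refine ⟨fun n pBar aBar β hβ => ⟨LimitedSwitch.rateConst β (n * |pBar|) (√n * |pBar|)
    (√n * |aBar|) √n, LimitedSwitch.rateConst_pos hβ (by positivity) (by positivity)
    (by positivity) (by positivity), ?_⟩, fun rBar cBar β hβ =>
    ⟨LimitedSwitch.rateConst β |rBar| |rBar| |cBar| 1, LimitedSwitch.rateConst_pos hβ
    (by positivity) (by positivity) (by positivity) (by positivity), ?_⟩⟩
  · intro d K s P hd hK hT hp ha hB φ hφ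
    have hM := fun D hD => P.model (D := D) hβ s hd hK hT hp ha hB hD
    exact ⟨fun D hD => (hM D hD).switches_le hφ,
      LimitedSwitch.Env.switchRegret_le_overallRegret _ _ _ _,
      iSup₂_le fun D hD => (hM D hD).optRev_sub_le hφ⟩
  · intro d K s P hd hK hT hR hr hC hc hB φ hφ
    have hM := fun D hD => P.model (D := D) hβ s hd hK hT hR hr hC hc hB hD
    exact ⟨fun D hD => (hM D hD).switches_le hφ,
      LimitedSwitch.Env.switchRegret_le_overallRegret _ _ _ _,
      iSup₂_le fun D hD => (hM D hD).optRev_sub_le hφ⟩
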